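/- Let $G$ be a simply connected semisimple complex algebraic group with maximal torus $T$, $\mathfrak t=\operatorname{Lie}T$, Weyl group $W$, set of roots $R$, and let $\check T$ be the dual torus (whose characters are the cocharacters of $T$; the coroots $\check\alpha$ are characters of $\check T$). Equivalently, start from a reduced root datum $(X,R,Y,\check R)$ with $R$ finite and with $Y$ spanned by the coroots, and put $T=\operatorname{Spec}\mathbb C[X]$, $\mathfrak t=\operatorname{Spec}\operatorname{Sym}(\mathbb C\otimes X)$, $\check T=\operatorname{Spec}\mathbb C[Y]$. For a root $\alpha$ write ${}^1\alpha,{}^2\alpha$ (and ${}^1\check\alpha$) for its composition with the projection of a product to the first and second factor, and define the affine blow-ups, with $W$ acting diagonally, by $$\mathfrak B_{\mathfrak g}^{\mathfrak g}=\operatorname{Spec}\mathbb C\Big[\mathfrak t\times\mathfrak t,\tfrac{{}^1\alpha}{{}^2\alpha},\alpha\in R\Big]^W,\quad \mathfrak B_{G}^{\mathfrak g}=\operatorname{Spec}\mathbb C\Big[\mathfrak t\times T,\tfrac{{}^1\alpha}{{}^2\alpha-1},\alpha\in R\Big]^W,\quad \mathfrak B_{\mathfrak g}^{G}=\operatorname{Spec}\mathbb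 C\Big[T\times\mathfrak t,\tfrac{{}^1\alpha-1}{{}^2\alpha},\alpha\in R\Big]^W,$$ $$\mathfrak B_{G}^{G}=\operatorname{Spec}\mathbb C\Big[T\times T,\tfrac{{}^1\alpha-1}{{}^2\alpha-1},\alpha\in R\Big]^W,\quad \mathfrak B_{G}^{\check G}=\operatorname{Spec}\mathbb C\Big[\check T\times T,\tfrac{{}^1\check\alpha-1}{{}^2\alpha-1},\alpha\in R\Big]^W .$$ These are schemes over $\mathfrak t/W$ (those with lower index $\mathfrak g$) or over $T/W$ (those with lower index $G$) via the second factor. Consider the following functors to sets, on the category of schemes $S$ flat over $\mathfrak t/W$, respectively $T/W$. Morphisms are over $\mathbb C$, and $\operatorname{Mor}(\cdot,\cdot)^W$ denotes those $f$ with $f(ws)=wf(s)$ for all $w\in W$, where $W$ acts on the fibre product through its second factor. * $\mathfrak F_{\mathfrak g}^{\mathfrak g}(S)=\operatorname{Mor}(S\times_{\mathfrak t/W}\mathfrak t,\mathfrak t)^W$ and $\mathfrak F_{G}^{\mathfrak g}(S)=\operatorname{Mor}(S\times_{T/W}T,\mathfrak t)^W$; * $\mathfrak F_{\mathfrak g}^{G}(S)$,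 the set of $f\in\operatorname{Mor}(S\times_{\mathfrak t/W}\mathfrak t,T)^W$ with $\alpha(f(\alpha^{-1}(0)))=1$ for all $\alpha\in R$; * $\mathfrak F_{G}^{G}(S)$, the set of $f\in\operatorname{Mor}(S\times_{T/W}T,T)^W$ with $\alpha(f(\alpha^{-1}(1)))=1$ for all $\alpha\in R$; * $\mathfrak F_{G}^{\check G}(S)$, the set of $f\in\operatorname{Mor}(S\times_{T/W}T,\check T)^W$ with $\check\alpha(f(\alpha^{-1}(1)))=1$ for all $\alpha\in R$. Here $\alpha^{-1}(0)$ and $\alpha^{-1}(1)$ denote the closed subschemes of the fibre product that are the inverse images of $\{\alpha=0\}\subset\mathfrak t$ and $\{\alpha=1\}\subset T$. Then $\mathfrak F_{\mathfrak g}^{\mathfrak g}$ (resp. $\mathfrak F_{G}^{\mathfrak g}$, $\mathfrak F_{\mathfrak g}^{G}$, $\mathfrak F_{G}^{G}$, $\mathfrak F_{G}^{\check G}$) is represented by the scheme $\mathfrak B_{\mathfrak g}^{\mathfrak g}$ (resp. $\mathfrak B_{G}^{\mathfrak g}$, $\mathfrak B_{\mathfrak g}^{G}$, $\mathfrak B_{G}^{G}$,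 $\mathfrak B_{G}^{\check G}$): for $S$ flat over the base $\mathfrak t/W$, resp. $T/W$, there is a bijection, natural in $S$, between $\mathfrak F(S)$ and the set of morphisms $S\to\mathfrak B$ over that base. -/

import Mathlib

open CategoryTheory CategoryTheory.Limits AlgebraicGeometry
open scoped TensorProduct

noncomputable section

namespace AffineBlowUp

/-! ### Affine complex varieties with an action of `W` and a family of walls -/

/-- An affine scheme `Z = Spec A` over `ℂ` with an action of the group `W`, given by the action
`(w • φ)(z) = φ (w⁻¹ z)` on functions, together with a function `wall i` for every `i`
(below: `α` on a Lie algebra, `α - 1` on a torus, for `α` a root), whose zero locus is the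
wall attached to `i`. -/
structure WScheme (W : Type*) [Group W] (ι : Type*) where
  A : Type
  [commRing : CommRing A]
  [algebra : Algebra ℂ A]
  ρ : W →* (A ≃ₐ[ℂ] A)
  wall : ι → A

attribute [instance] WScheme.commRing WScheme.algebra

namespace WScheme

variable {W : Type*} [Group W] {ι : Type*} (Z Z' : WScheme W ι)

/-- The scheme `Z = Spec A`. -/
abbrev space : Scheme.{0} := Spec (CommRingCat.of Z.A)

/-- The structure morphism `Z ⟶ Spec ℂ`. -/
def toC : Z.space ⟶ Spec (CommRingCat.of ℂ) :=
  Spec.map (CommRingCat.ofHom (algebraMap ℂ Z.A))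

/-- The action `z ↦ w z` of `w : W` on `Z`. -/
def act (w : W) : Z.space ⟶ Z.space :=
  Spec.map (CommRingCat.ofHom (Z.ρ w⁻¹ : Z.A →+* Z.A))

/-- The ring of invariants `A ^ W`. -/
def invariants : Subring Z.A where
  carrier := {x | ∀ w, Z.ρ w x = x}
  mul_mem' hx hy w := by rw [map_mul, hx w, hy w]
  one_mem' w := map_one _
  add_mem' hx hy w := by rw [map_add, hx w, hy w]
  zero_mem' w := map_zero _
  neg_mem' hx w := by rw [map_neg, hx w]

/-- The categorical quotient `Z / W = Spec (A ^ W)`. -/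
abbrev quot : Scheme.{0} := Spec (CommRingCat.of Z.invariants)

/-- The projection `Z ⟶ Z / W`. -/
def quotMap : Z.space ⟶ Z.quot :=
  Spec.map (CommRingCat.ofHom Z.invariants.subtype)

lemma act_quotMap (w : W) : Z.act w ≫ Z.quotMap = Z.quotMap := by
  unfold act quotMap
  rw [← Spec.map_comp, ← CommRingCat.ofHom_comp]
  congr 2
  ext x
  exact x.2 w⁻¹

/-- The closed subscheme `{wall i = 0}` of `Z`, e.g. `α⁻¹(0) ⊆ 𝔱` or `α⁻¹(1) ⊆ T`. -/
abbrev wallScheme (i : ι) : Scheme.{0} :=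
  Spec (CommRingCat.of (Z.A ⧸ Ideal.span {Z.wall i}))

/-- The inclusion of the closed subscheme `{wall i = 0}` into `Z`. -/
def wallIncl (i : ι) : Z.wallScheme i ⟶ Z.space :=
  Spec.map (CommRingCat.ofHom (Ideal.Quotient.mk (Ideal.span {Z.wall i})))

/-! ### The affine blow-up -/

/-- The total ring of fractions of the coordinate ring of `Z × Z'`. -/
abbrev Frac : Type := FractionRing (Z.A ⊗[ℂ] Z'.A)

/-- The diagonal action of `W` on the functions on `Z × Z'`. -/
def diag (w : W) : (Z.A ⊗[ℂ] Z'.A) ≃ₐ[ℂ] (Z.A ⊗[ℂ] Z'.A) :=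
  Algebra.TensorProduct.congr (Z.ρ w) (Z'.ρ w)

/-- The diagonal action of `W` on the rational functions on `Z × Z'`. -/
def diagFrac (w : W) : Frac Z Z' ≃+* Frac Z Z' :=
  IsFractionRing.ringEquivOfRingEquiv (Z.diag Z' w).toRingEquiv

/-- The ring `ℂ[Z × Z', ¹wallᵢ / ²wallᵢ, i ∈ ι]` of functions on the affine blow-up of `Z × Z'`
at the diagonal walls (before dividing by `W`). Here `¹wallᵢ`, `²wallᵢ` are the functions `wallᵢ`
on the first and on the second factor; the fraction `¹wallᵢ / ²wallᵢ` is the element `q` with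
`q * ²wallᵢ = ¹wallᵢ`, which is unique because `²wallᵢ` is not a zero divisor in the cases
considered. -/
def blowUpRing : Subalgebra ℂ (Frac Z Z') :=
  Algebra.adjoin ℂ
    (Set.range (algebraMap (Z.A ⊗[ℂ] Z'.A) (Frac Z Z')) ∪
      {q | ∃ i, q * algebraMap (Z.A ⊗[ℂ] Z'.A) (Frac Z Z') (1 ⊗ₜ Z'.wall i) =
        algebraMap (Z.A ⊗[ℂ] Z'.A) (Frac Z Z') (Z.wall i ⊗ₜ 1)})

/-- The ring of `W`-invariants `ℂ[Z × Z', ¹wallᵢ / ²wallᵢ, i ∈ ι] ^ W`. -/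
def blowUpInvariants : Subring (Frac Z Z') where
  carrier := {x | x ∈ blowUpRing Z Z' ∧ ∀ w, diagFrac Z Z' w x = x}
  mul_mem' hx hy := ⟨mul_mem hx.1 hy.1, fun w => by rw [map_mul, hx.2 w, hy.2 w]⟩
  one_mem' := ⟨one_mem _, fun w => map_one _⟩
  add_mem' hx hy := ⟨add_mem hx.1 hy.1, fun w => by rw [map_add, hx.2 w, hy.2 w]⟩
  zero_mem' := ⟨zero_mem _, fun w => map_zero _⟩
  neg_mem' hx := ⟨neg_mem hx.1, fun w => by rw [map_neg, hx.2 w]⟩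

/-- The inclusion `ℂ[Z'] ^ W → ℂ[Z × Z', ¹wallᵢ / ²wallᵢ, i ∈ ι] ^ W`, `x ↦ 1 ⊗ x`. -/
def toBlowUpInvariants : Z'.invariants →+* blowUpInvariants Z Z' :=
  RingHom.codRestrict
    (((algebraMap (Z.A ⊗[ℂ] Z'.A) (Frac Z Z')).comp
      (Algebra.TensorProduct.includeRight : Z'.A →ₐ[ℂ] Z.A ⊗[ℂ] Z'.A).toRingHom).comp
        Z'.invariants.subtype)
    (blowUpInvariants Z Z')
    (fun x => by
      refine ⟨Algebra.subset_adjoin (Or.inl ⟨_, rfl⟩), fun w => ?_⟩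
      have h : Z'.ρ w x = x := x.2 w
      simp [diagFrac, diag, h])

/-- The affine blow-up `𝔅 = Spec (ℂ[Z × Z', ¹wallᵢ / ²wallᵢ, i ∈ ι] ^ W)`, with its projection
`ϖ` to `Z' / W`. -/
def blowUp : Over Z'.quot :=
  Over.mk (Y := Spec (CommRingCat.of (blowUpInvariants Z Z')))
    (Spec.map (CommRingCat.ofHom (toBlowUpInvariants Z Z')))

/-! ### The functors of `W`-invariant morphisms -/

/-- The category of schemes flat over `B` (a full subcategory of the category of schemes
over `B`). -/
abbrev FlatOver (B : Scheme.{0}) : Type 1 :=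
  ObjectProperty.FullSubcategory (fun S : Over B => Flat S.hom)

/-- The scheme `S ×_{Z'/W} Z'`. -/
abbrev cover (S : Over Z'.quot) : Scheme.{0} := pullback S.hom Z'.quotMap

/-- The projection `S ×_{Z'/W} Z' ⟶ S`. -/
def coverFst (S : Over Z'.quot) : Z'.cover S ⟶ S.left := pullback.fst S.hom Z'.quotMap

/-- The projection `S ×_{Z'/W} Z' ⟶ Z'`. -/
def coverSnd (S : Over Z'.quot) : Z'.cover S ⟶ Z'.space := pullback.snd S.hom Z'.quotMap

/-- The morphism `S ×_{Z'/W} Z' ⟶ S' ×_{Z'/W} Z'` induced by `g : S ⟶ S'`. -/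
def coverMap {S S' : Over Z'.quot} (g : S ⟶ S') : Z'.cover S ⟶ Z'.cover S' :=
  pullback.lift (pullback.fst S.hom Z'.quotMap ≫ g.left) (pullback.snd S.hom Z'.quotMap)
    (by rw [Category.assoc, Over.w g, pullback.condition])

/-- The action of `W` on `S ×_{Z'/W} Z'` through the second factor. -/
def coverAct (S : Over Z'.quot) (w : W) : Z'.cover S ⟶ Z'.cover S :=
  pullback.lift (pullback.fst S.hom Z'.quotMap) (pullback.snd S.hom Z'.quotMap ≫ Z'.act w)
    (by rw [Category.assoc, act_quotMap, pullback.condition])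

lemma coverMap_fst {S S' : Over Z'.quot} (g : S ⟶ S') :
    Z'.coverMap g ≫ Z'.coverFst S' = Z'.coverFst S ≫ g.left :=
  pullback.lift_fst _ _ _

lemma coverMap_snd {S S' : Over Z'.quot} (g : S ⟶ S') :
    Z'.coverMap g ≫ Z'.coverSnd S' = Z'.coverSnd S :=
  pullback.lift_snd _ _ _

lemma coverAct_fst (S : Over Z'.quot) (w : W) :
    Z'.coverAct S w ≫ Z'.coverFst S = Z'.coverFst S :=
  pullback.lift_fst _ _ _

lemma coverAct_snd (S : Over Z'.quot) (w : W) :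
    Z'.coverAct S w ≫ Z'.coverSnd S = Z'.coverSnd S ≫ Z'.act w :=
  pullback.lift_snd _ _ _

lemma cover_hom_ext {T : Scheme.{0}} {S : Over Z'.quot} {f g : T ⟶ Z'.cover S}
    (h₁ : f ≫ Z'.coverFst S = g ≫ Z'.coverFst S) (h₂ : f ≫ Z'.coverSnd S = g ≫ Z'.coverSnd S) :
    f = g :=
  pullback.hom_ext h₁ h₂

lemma coverMap_id (S : Over Z'.quot) : Z'.coverMap (𝟙 S) = 𝟙 _ := by
  apply cover_hom_ext
  · rw [coverMap_fst, Over.id_left, Category.comp_id, Category.id_comp]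
  · rw [coverMap_snd, Category.id_comp]

lemma coverMap_comp {S S' S'' : Over Z'.quot} (g : S ⟶ S') (h : S' ⟶ S'') :
    Z'.coverMap (g ≫ h) = Z'.coverMap g ≫ Z'.coverMap h := by
  apply cover_hom_ext
  · rw [coverMap_fst, Category.assoc, coverMap_fst, ← Category.assoc, coverMap_fst, Over.comp_left,
      Category.assoc]
  · rw [coverMap_snd, Category.assoc, coverMap_snd, coverMap_snd]

lemma coverAct_coverMap {S S' : Over Z'.quot} (g : S ⟶ S') (w : W) :
    Z'.coverAct S w ≫ Z'.coverMap g = Z'.coverMap g ≫ Z'.coverAct S' w := by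
  apply cover_hom_ext
  · rw [Category.assoc, coverMap_fst, ← Category.assoc, coverAct_fst, Category.assoc, coverAct_fst,
      coverMap_fst]
  · rw [Category.assoc, coverMap_snd, coverAct_snd, Category.assoc, coverAct_snd, ← Category.assoc,
      coverMap_snd]

/-- `f : S ×_{Z'/W} Z' ⟶ Z` is a `W`-invariant morphism of schemes over `ℂ`, i.e. an element of
`Mor(S ×_{Z'/W} Z', Z) ^ W`, where `W` acts on both `S ×_{Z'/W} Z'` and `Z`. -/
def IsInvariant (S : Over Z'.quot) (f : Z'.cover S ⟶ Z.space) : Prop :=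
  f ≫ Z.toC = Z'.coverSnd S ≫ Z'.toC ∧ ∀ w : W, Z'.coverAct S w ≫ f = f ≫ Z.act w

/-- `f : S ×_{Z'/W} Z' ⟶ Z` maps the inverse image in `S ×_{Z'/W} Z'` of the wall
`{wallᵢ = 0} ⊆ Z'` into the wall `{wallᵢ = 0} ⊆ Z`, for all `i`. When `Z' = T` and `Z = Ť`, with
walls `α = 1` and `αˇ = 1`, this is the condition `αˇ(f(α⁻¹(1))) = 1` for all roots `α`. -/
def WallCondition (S : Over Z'.quot) (f : Z'.cover S ⟶ Z.space) : Prop :=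
  ∀ i : ι, ∃ h : pullback (Z'.coverSnd S) (Z'.wallIncl i) ⟶ Z.wallScheme i,
    h ≫ Z.wallIncl i = pullback.fst (Z'.coverSnd S) (Z'.wallIncl i) ≫ f

variable {Z Z'} in
lemma IsInvariant.comp {S S' : Over Z'.quot} (g : S ⟶ S') {f : Z'.cover S' ⟶ Z.space}
    (hf : IsInvariant Z Z' S' f) : IsInvariant Z Z' S (Z'.coverMap g ≫ f) := by
  refine ⟨?_, fun w => ?_⟩
  · rw [Category.assoc, hf.1, ← Category.assoc, coverMap_snd]
  · rw [← Category.assoc, coverAct_coverMap, Category.assoc, hf.2 w, Category.assoc]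

variable {Z Z'} in
lemma WallCondition.comp {S S' : Over Z'.quot} (g : S ⟶ S') {f : Z'.cover S' ⟶ Z.space}
    (hf : WallCondition Z Z' S' f) : WallCondition Z Z' S (Z'.coverMap g ≫ f) := by
  intro i
  obtain ⟨h, hh⟩ := hf i
  refine ⟨pullback.lift (pullback.fst _ _ ≫ Z'.coverMap g) (pullback.snd _ _) ?_ ≫ h, ?_⟩
  · rw [Category.assoc, coverMap_snd, pullback.condition]
  · rw [Category.assoc, hh, ← Category.assoc, pullback.lift_fst, Category.assoc]

/-- The functor `S ↦ Mor(S ×_{Z'/W} Z', Z) ^ W` on schemes flat over `Z' / W`. -/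
def invMor : (FlatOver Z'.quot)ᵒᵖ ⥤ Type where
  obj S := {f : Z'.cover S.unop.obj ⟶ Z.space // IsInvariant Z Z' S.unop.obj f}
  map g := ↾fun f => ⟨Z'.coverMap g.unop.hom ≫ f.1, f.2.comp g.unop.hom⟩
  map_id S := by
    ext f
    simp [coverMap_id]
  map_comp g h := by
    ext f
    simp [coverMap_comp]

/-- The subfunctor `S ↦ Mor(S ×_{Z'/W} Z', Z)₀ ^ W` of `invMor` of the morphisms subject to the
wall condition. -/
def invMorZero : (FlatOver Z'.quot)ᵒᵖ ⥤ Type where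
  obj S := {f : Z'.cover S.unop.obj ⟶ Z.space //
    IsInvariant Z Z' S.unop.obj f ∧ WallCondition Z Z' S.unop.obj f}
  map g := ↾fun f =>
    ⟨Z'.coverMap g.unop.hom ≫ f.1, f.2.1.comp g.unop.hom, f.2.2.comp g.unop.hom⟩
  map_id S := by
    ext f
    simp [coverMap_id]
  map_comp g h := by
    ext f
    simp [coverMap_comp]

/-- The functor `F` on the category of schemes flat over `B` is represented by the `B`-scheme `X`:
there are bijections `F(S) ≃ Mor_B(S, X)`, natural in the flat `B`-scheme `S`. -/
def RepresentedBy {B : Scheme.{0}} (F : (FlatOver B)ᵒᵖ ⥤ Type) (X : Over B) : Prop :=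
  Nonempty (F ≅ (ObjectProperty.ι (fun S : Over B => Flat S.hom)).op ⋙ yoneda.obj X)

end WScheme

/-! ### Tori and Cartan algebras of a root datum -/

/-- The torus with character lattice `L`, i.e. `Spec ℂ[L]`, with the action of `W` induced from an
action on `L`, and with the functions `e^α - 1` for `α` in a family of characters. -/
def torusOf {W : Type*} [Group W] {ι : Type*} {L : Type} [AddCommGroup L]
    (σ : W →* (L ≃ₗ[ℤ] L)) (α : ι → L) : WScheme W ι where
  A := AddMonoidAlgebra ℂ L
  ρ :=
    { toFun := fun w => AddMonoidAlgebra.domCongr ℂ ℂ (σ w).toAddEquiv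
      map_one' := by
        apply AlgEquiv.coe_toAlgHom_injective
        ext x
        simp
      map_mul' := fun v w => by
        apply AlgEquiv.coe_toAlgHom_injective
        ext x
        simp }
  wall i := AddMonoidAlgebra.single (α i) 1 - 1

/-- The Lie algebra of the torus with character lattice `L`, i.e. `Spec Sym(ℂ ⊗ L)`, with the
action of `W` induced from an action on `L`, and with the linear functions given by (the
differentials of) the characters `α` in a given family. -/
def lieOf {W : Type*} [Group W] {ι : Type*} {L : Type} [AddCommGroup L]
    (σ : W →* (L ≃ₗ[ℤ] L)) (α : ι → L) : WScheme W ι where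
  A := SymmetricAlgebra ℂ (ℂ ⊗[ℤ] L)
  ρ :=
    { toFun := fun w => AlgEquiv.ofAlgHom
        (SymmetricAlgebra.lift
          ((SymmetricAlgebra.ι ℂ (ℂ ⊗[ℤ] L)).comp ((σ w).toLinearMap.baseChange ℂ)))
        (SymmetricAlgebra.lift
          ((SymmetricAlgebra.ι ℂ (ℂ ⊗[ℤ] L)).comp ((σ w⁻¹).toLinearMap.baseChange ℂ)))
        (by ext x; simp)
        (by ext x; simp)
      map_one' := by
        apply AlgEquiv.coe_toAlgHom_injective
        ext x
        simp
      map_mul' := fun v w => by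
        apply AlgEquiv.coe_toAlgHom_injective
        ext x
        simp }
  wall i := SymmetricAlgebra.ι ℂ (ℂ ⊗[ℤ] L) (1 ⊗ₜ α i)

variable {ι X Y : Type} [AddCommGroup X] [AddCommGroup Y] (P : RootPairing ι ℤ X Y)

/-- The action of the Weyl group on the character lattice `X`. -/
def weylX : P.weylGroup →* (X ≃ₗ[ℤ] X) :=
  (RootPairing.Equiv.weightHom P).comp P.weylGroup.subtype

/-- The action of the Weyl group on the cocharacter lattice `Y`, contragredient to the action
on `X`: `⟨w x, w y⟩ = ⟨x, y⟩`. -/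
def weylY : P.weylGroup →* (Y ≃ₗ[ℤ] Y) where
  toFun w := (RootPairing.Equiv.coweightHom P (w : P.Aut)⁻¹).unop
  map_one' := by rw [Subgroup.coe_one, inv_one, map_one, MulOpposite.unop_one]
  map_mul' v w := by
    rw [Subgroup.coe_mul, mul_inv_rev, map_mul, MulOpposite.unop_mul]

/-- The maximal torus `T` of the group `G` with root datum `P`, with the functions `α - 1` for
`α` a root. -/
def torus : WScheme P.weylGroup ι := torusOf (weylX P) P.root

/-- The dual torus `Ť`, with character lattice `Y`, with the functions `αˇ - 1` for `αˇ` a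
coroot. -/
def dualTorus : WScheme P.weylGroup ι := torusOf (weylY P) P.coroot

/-- The Lie algebra `𝔱` of `T`, with the linear functions `α` for `α` a root. -/
def cartan : WScheme P.weylGroup ι := lieOf (weylX P) P.root

/-- The semisimple group with root datum `P` is simply connected: the cocharacter lattice is
spanned by the coroots. -/
def IsSimplyConnected : Prop := Submodule.span ℤ (Set.range P.coroot) = ⊤

end AffineBlowUp

end

open AffineBlowUp AffineBlowUp.WScheme

/-! Write `A` for the functions on `Z'`, `B` for the functions on the blow-up before dividing by
`W`, and `R → R'` for the functions on `S` and on its cover `S ×_{Z'/W} Z'`. Since `Z` and the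
blow-up are affine, the claim concerns ring homomorphisms: equivariant `f : ℂ[Z] → R'` subject to
the wall condition on one side, `g : B^W → R` over `A^W` on the other. Both are compared with
homomorphisms `F : B → R'` extending the given `A → R'`. Averaging over `W` identifies `R` with the
invariants of `R'`. Flatness of `S` makes `A → R'` flat, so nonzerodivisors of `A`, and elements of
`A` regular modulo them, stay such in `R'`.

From `f` to `g` (`existsUnique_corresponds_right`): the wall condition provides the quotients
`f(¹wall) / ²wall` in `R'`, uniquely because `²wall` is regular there. So `f` extends to an
equivariant `F`, which is restricted to invariants.

From `g` to `f` (`existsUnique_corresponds_left`) the argument is of Hartogs type. The maps `g` and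
`A → R'` define a map on `B^W ⊗ A`, which must be extended to `B`. Traces show that a discriminant
`∏ (a_w - w a_w)` over `w ≠ 1` multiplies `B` into the image of `B^W ⊗ A` (`prod_mul_mem_range`). In
`R'` the discriminant is then divided out factor by factor: a factor cancels as soon as `h b` lies
in the image for some `h` regular modulo that factor (`exists_of_prod`). If `w` is not a reflection,
its factor can be chosen so that a second discriminant serves as `h`. If `w = s` is a reflection,
its factor is the wall up to a unit, and `exists_regMod_wall_mul_mem_range` uses `2b = (b + s b) +
(b - s b)`, where `b - s b` is divisible by the wall up to harmless factors
(`exists_divided_difference`).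

The hypothesis `IsSeparated` collects what this requires of `Z'`. It rests on two facts about root
data: a Weyl group element acting trivially modulo a line is trivial unless that line contains a
root (`exists_mem_satSpan_of_reflection`, `exists_generic`), and in the simply connected case every
coroot takes the value `1` on `X` (`exists_pairing_eq_one`). For the target `𝔱` the wall condition
is automatic, because reflections negate their roots and `2` is invertible. -/

namespace AffineBlowUp

open scoped nonZeroDivisors

/-! ### Elements regular modulo another element -/

section RegMod

variable {R : Type*} [CommRing R]

/-- Multiplication by `h` is injective modulo `x`. -/
def RegMod (x h : R) : Prop := ∀ r r', h * r = x * r' → x ∣ r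

lemma RegMod.one (x : R) : RegMod x 1 := fun r r' h => ⟨r', by rw [← h, one_mul]⟩

lemma RegMod.mul {x h h' : R} (H : RegMod x h) (H' : RegMod x h') : RegMod x (h * h') := by
  intro r r' e
  obtain ⟨c, hc⟩ := H (h' * r) r' (by rw [← e, mul_assoc])
  exact H' r c hc

lemma RegMod.prod {x : R} {κ : Type*} (s : Finset κ) (f : κ → R) (H : ∀ k ∈ s, RegMod x (f k)) :
    RegMod x (∏ k ∈ s, f k) := by
  classical
  induction s using Finset.induction_on with
  | empty => simpa using RegMod.one x
  | insert a s ha ih =>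
    rw [Finset.prod_insert ha]
    exact (H a (by simp)).mul (ih fun k hk => H k (by simp [hk]))

lemma RegMod.congr {x h h' : R} (H : RegMod x h) (hd : x ∣ h' - h) : RegMod x h' := by
  obtain ⟨c, hc⟩ := hd
  intro r r' e
  refine H r (r' - c * r) ?_
  linear_combination e - r * hc

lemma RegMod.of_isUnit (x : R) {h : R} (hu : IsUnit h) : RegMod x h := by
  intro r r' e
  obtain ⟨u, rfl⟩ := hu
  exact ⟨↑u⁻¹ * r', by rw [mul_left_comm, ← e, Units.inv_mul_cancel_left]⟩

lemma RegMod.of_dvd_dvd {x x' h : R} (H : RegMod x h) (h₁ : x ∣ x') (h₂ : x' ∣ x) :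
    RegMod x' h := by
  intro r r' e
  obtain ⟨c, rfl⟩ := h₁
  exact h₂.trans (H r (c * r') (by rw [e, mul_assoc]))

lemma RegMod.mul_isUnit {x h u : R} (H : RegMod x h) (hu : IsUnit u) : RegMod x (u * h) :=
  (RegMod.of_isUnit x hu).mul H

variable {M : Type*} [CommRing M] [Algebra R M] [Module.Flat R M]

/-- By the equational criterion for flatness, `a • r = 0` forces `r` to be a combination of elements
with coefficients killed by `a`. -/
lemma algebraMap_mem_nonZeroDivisors_of_flat {a : R} (ha : a ∈ R⁰) : algebraMap R M a ∈ M⁰ := by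
  rw [mem_nonZeroDivisors_iff_right]
  intro r hr
  obtain ⟨k, c, y, h₁, h₂⟩ := Module.Flat.isTrivialRelation_of_sum_smul_eq_zero (R := R) (M := M)
    (f := ![a]) (x := ![r]) (by simpa [Algebra.smul_def, mul_comm] using hr)
  have h₃ : ∀ j, c 0 j = 0 := fun j => by
    have := h₂ j
    simp only [Finset.univ_unique, Finset.sum_singleton] at this
    exact (mem_nonZeroDivisors_iff_right.1 ha) _ (by simpa [mul_comm] using this)
  simpa [h₃] using h₁ 0

/-- The equational criterion again: the relation `h r - x r' = 0` comes from relations over `R`, and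
each of those has first coefficient divisible by `x`. -/
lemma RegMod.algebraMap_of_flat {x h : R} (H : RegMod x h) :
    RegMod (algebraMap R M x) (algebraMap R M h) := by
  intro r r' e
  obtain ⟨k, c, y, h₁, h₂⟩ := Module.Flat.isTrivialRelation_of_sum_smul_eq_zero (R := R) (M := M)
    (f := ![h, -x]) (x := ![r, r']) (by simp [Algebra.smul_def, Fin.sum_univ_two, e])
  have h₃ : ∀ j, x ∣ c 0 j := fun j => by
    have := h₂ j
    simp only [Fin.sum_univ_two] at this
    exact H _ (c 1 j) (by simpa [add_neg_eq_zero] using this)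
  choose d hd using h₃
  refine ⟨∑ j, d j • y j, ?_⟩
  have := h₁ 0
  simp only [Matrix.cons_val_zero] at this
  rw [this, Finset.mul_sum]
  refine Finset.sum_congr rfl fun j _ => ?_
  rw [hd, mul_smul, Algebra.smul_def x]

end RegMod

/-! ### Extending ring homomorphisms along denominators -/

section Extension

variable {A C F R : Type*} [CommRing A] [CommRing C] [CommRing F] [CommRing R]

/-- An element `b` is treated as a fraction `m c / m (i a)` and sent to the quotient of `G c` by `G
(i a)`, which is unique because `G (i a)` is regular. The conclusion allows every presentation of
`b` as a fraction, so values can be computed from any convenient one. -/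
theorem exists_ringHom_extension (i : A →+* C) (m : C →+* F) (G : C →+* R) (B : Subring F)
    (hR : ∀ a ∈ A⁰, G (i a) ∈ R⁰) (hker : ∀ c, m c = 0 → G c = 0)
    (hB : ∀ b ∈ B, ∃ a ∈ A⁰, ∃ c r, m c = m (i a) * b ∧ G c = G (i a) * r) :
    ∃ φ : B →+* R, ∀ b : B, ∀ a ∈ A⁰, ∀ c, m c = m (i a) * b → G c = G (i a) * φ b := by
  -- Independence of the presentation: `i a * c' - i a' * c` is killed by `m`, hence by `G`.
  have key : ∀ b : F, ∀ a ∈ A⁰, ∀ c r, m c = m (i a) * b → G c = G (i a) * r →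
      ∀ a' c', m c' = m (i a') * b → G c' = G (i a') * r := by
    intro b a ha c r h₁ h₂ a' c' h₃
    have h₄ : G (i a * c' - i a' * c) = 0 := hker _ (by
      rw [map_sub, map_mul, map_mul, h₁, h₃]; ring)
    have h₅ : (G c' - G (i a') * r) * G (i a) = 0 := by
      rw [map_sub, map_mul, map_mul, h₂] at h₄
      linear_combination h₄
    exact sub_eq_zero.1 ((mem_nonZeroDivisors_iff_right.1 (hR a ha)) _ h₅)
  choose! α hα c r h₁ h₂ using hB
  have uniq : ∀ b ∈ B, ∀ a ∈ A⁰, ∀ c' r', m c' = m (i a) * b → G c' = G (i a) * r' → r b = r' := by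
    intro b hb a ha c' r' e₁ e₂
    have := key b (α b) (hα b hb) (c b) (r b) (h₁ b hb) (h₂ b hb) a c' e₁
    rw [e₂] at this
    exact ((mul_cancel_left_mem_nonZeroDivisors (hR a ha)).1 this).symm
  refine ⟨RingHom.mk ⟨⟨fun b => r b, ?_⟩, ?_⟩ ?_ ?_, ?_⟩
  · exact uniq _ (one_mem _) 1 (one_mem _) 1 1 (by simp) (by simp)
  · rintro ⟨b, hb⟩ ⟨b', hb'⟩
    refine uniq _ (mul_mem hb hb') (α b * α b') (mul_mem (hα _ hb) (hα _ hb')) (c b * c b') _ ?_ ?_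
    · rw [map_mul, h₁ b hb, h₁ b' hb', map_mul, map_mul]; ring
    · rw [map_mul, h₂ b hb, h₂ b' hb', map_mul, map_mul]; ring
  · exact uniq _ (zero_mem _) 1 (one_mem _) 0 0 (by simp) (by simp)
  · rintro ⟨b, hb⟩ ⟨b', hb'⟩
    refine uniq _ (add_mem hb hb') (α b * α b') (mul_mem (hα _ hb) (hα _ hb'))
      (i (α b') * c b + i (α b) * c b') _ ?_ ?_
    · rw [map_add, map_mul, map_mul, h₁ b hb, h₁ b' hb', map_mul, map_mul]; ring
    · rw [map_add, map_mul, map_mul, h₂ b hb, h₂ b' hb', map_mul, map_mul]; ring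
  · rintro ⟨b, hb⟩ a ha c' e
    exact key b (α b) (hα b hb) (c b) (r b) (h₁ b hb) (h₂ b hb) a c' e

/-- The product of two ring homomorphisms to a commutative ring. -/
noncomputable def intProductMap (f : A →+* R) (g : C →+* R) : A ⊗[ℤ] C →+* R :=
  (Algebra.TensorProduct.productMap f.toIntAlgHom g.toIntAlgHom).toRingHom

lemma intProductMap_tmul (f : A →+* R) (g : C →+* R) (a : A) (c : C) :
    intProductMap f g (a ⊗ₜ c) = f a * g c :=
  Algebra.TensorProduct.productMap_apply_tmul _ _ _ _

lemma exists_ringHom_comp_eq {j : C →+* F} (hj : Function.Injective j) (φ : A →+* F)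
    (h : ∀ a, ∃ c, j c = φ a) : ∃ g : A →+* C, j.comp g = φ := by
  choose g hg using h
  refine ⟨RingHom.mk ⟨⟨g, ?_⟩, ?_⟩ ?_ ?_, RingHom.ext hg⟩
  · apply hj; simp [hg]
  · intro x y; apply hj; simp [hg]
  · apply hj; simp [hg]
  · intro x y; apply hj; simp [hg]

/-- The elements `m c / a` of `F` for which `G c` is divisible by `a`, form a subring. -/
def extensionDomain (i : A →+* C) (m : C →+* F) (G : C →+* R) : Subring F where
  carrier := {b | ∃ a ∈ A⁰, ∃ c r, m c = m (i a) * b ∧ G c = G (i a) * r}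
  mul_mem' := by
    rintro b b' ⟨a, ha, c, r, h₁, h₂⟩ ⟨a', ha', c', r', h₁', h₂'⟩
    refine ⟨a * a', mul_mem ha ha', c * c', r * r', ?_, ?_⟩
    · rw [map_mul, h₁, h₁', map_mul, map_mul]; ring
    · rw [map_mul, h₂, h₂', map_mul, map_mul]; ring
  one_mem' := ⟨1, one_mem _, 1, 1, by simp, by simp⟩
  add_mem' := by
    rintro b b' ⟨a, ha, c, r, h₁, h₂⟩ ⟨a', ha', c', r', h₁', h₂'⟩
    refine ⟨a * a', mul_mem ha ha', i a' * c + i a * c', r + r', ?_, ?_⟩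
    · rw [map_add, map_mul, map_mul, h₁, h₁', map_mul, map_mul]; ring
    · rw [map_add, map_mul, map_mul, h₂, h₂', map_mul, map_mul]; ring
  zero_mem' := ⟨1, one_mem _, 0, 0, by simp, by simp⟩
  neg_mem' := by
    rintro b ⟨a, ha, c, r, h₁, h₂⟩
    exact ⟨a, ha, -c, -r, by rw [map_neg, h₁, mul_neg], by rw [map_neg, h₂, mul_neg]⟩

end Extension

end AffineBlowUp

/-! ### Reflective and separated actions, and the ring of functions on the blow-up. -/

noncomputable section

namespace AffineBlowUp

namespace WScheme

open scoped nonZeroDivisors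

variable {W : Type*} [Group W] {ι : Type*}

lemma ρ_mul_apply (Z : WScheme W ι) (v w : W) (a : Z.A) : Z.ρ (v * w) a = Z.ρ v (Z.ρ w a) := by
  rw [map_mul]; rfl

lemma ρ_one_apply (Z : WScheme W ι) (a : Z.A) : Z.ρ 1 a = a := by
  rw [map_one]; rfl

/-- The reflections `s i` act trivially on the walls `wall i = 0`, map `wall i` to `-wall i`
to first order, and the action permutes the walls by `π`. -/
structure IsReflective (Z : WScheme W ι) (s : ι → W) (π : W → ι → ι) : Prop where
  mul_self (i : ι) : s i * s i = 1
  perm (w : W) (i : ι) : Z.ρ w (Z.wall i) = Z.wall (π w i)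
  dvd_sub (i : ι) (a : Z.A) : Z.wall i ∣ Z.ρ (s i) a - a
  refl (i : ι) : ∃ u, Z.ρ (s i) (Z.wall i) = u * Z.wall i ∧ Z.wall i ∣ u + 1

/-- In codimension one the action is free away from the walls, and its stabilizer along the wall
`wall i = 0` is `{1, s i}`. -/
structure IsSeparated (Z : WScheme W ι) (s : ι → W) (π : W → ι → ι) : Prop where
  wall_mem (i : ι) : Z.wall i ∈ Z.A⁰
  wall_wall (i j : ι) : RegMod (Z.wall i) (Z.wall j) ∨ j = i ∨ j = π (s i) i
  along_wall (i : ι) (w : W) : w ≠ 1 → w ≠ s i → ∃ a, RegMod (Z.wall i) (a - Z.ρ w a)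
  generic (w : W) : w ≠ 1 → ∃ a, a - Z.ρ w a ∈ Z.A⁰ ∧
    ((∃ i, w = s i ∧ a - Z.ρ w a ∣ Z.wall i) ∨
      ∀ w', w' ≠ 1 → ∃ a', RegMod (a - Z.ρ w a) (a' - Z.ρ w' a'))

section Frac

variable (Z Z' : WScheme W ι)

/-- Functions on the first factor. -/
def fstFrac : Z.A →+* Frac Z Z' :=
  (algebraMap (Z.A ⊗[ℂ] Z'.A) (Frac Z Z')).comp
    (Algebra.TensorProduct.includeLeft : Z.A →ₐ[ℂ] Z.A ⊗[ℂ] Z'.A).toRingHom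

/-- Functions on the second factor. -/
def sndFrac : Z'.A →+* Frac Z Z' :=
  (algebraMap (Z.A ⊗[ℂ] Z'.A) (Frac Z Z')).comp
    (Algebra.TensorProduct.includeRight : Z'.A →ₐ[ℂ] Z.A ⊗[ℂ] Z'.A).toRingHom

lemma algebraMap_tmul (a : Z.A) (b : Z'.A) :
    algebraMap (Z.A ⊗[ℂ] Z'.A) (Frac Z Z') (a ⊗ₜ b) = fstFrac Z Z' a * sndFrac Z Z' b := by
  rw [fstFrac, sndFrac, RingHom.comp_apply, RingHom.comp_apply, ← map_mul]
  simp

lemma diagFrac_algebraMap (w : W) (x : Z.A ⊗[ℂ] Z'.A) :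
    diagFrac Z Z' w (algebraMap _ _ x) = algebraMap _ _ (diag Z Z' w x) := by
  simp [diagFrac]

lemma diagFrac_fst (w : W) (a : Z.A) :
    diagFrac Z Z' w (fstFrac Z Z' a) = fstFrac Z Z' (Z.ρ w a) := by
  simp [fstFrac, diagFrac_algebraMap, diag]

lemma diagFrac_snd (w : W) (a : Z'.A) :
    diagFrac Z Z' w (sndFrac Z Z' a) = sndFrac Z Z' (Z'.ρ w a) := by
  simp [sndFrac, diagFrac_algebraMap, diag]

lemma diag_mul (v w : W) (x : Z.A ⊗[ℂ] Z'.A) :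
    diag Z Z' (v * w) x = diag Z Z' v (diag Z Z' w x) := by
  induction x using TensorProduct.induction_on with
  | zero => simp
  | tmul a b => simp [diag]
  | add x y hx hy => rw [map_add, hx, hy, map_add, map_add]

lemma diag_one (x : Z.A ⊗[ℂ] Z'.A) : diag Z Z' 1 x = x := by
  induction x using TensorProduct.induction_on with
  | zero => simp
  | tmul a b => simp [diag]
  | add x y hx hy => rw [map_add, hx, hy]

lemma diagFrac_mul (v w : W) (x : Frac Z Z') :
    diagFrac Z Z' (v * w) x = diagFrac Z Z' v (diagFrac Z Z' w x) := by
  have : (diagFrac Z Z' (v * w) : Frac Z Z' →+* Frac Z Z') =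
      (diagFrac Z Z' v : Frac Z Z' →+* Frac Z Z').comp (diagFrac Z Z' w) := by
    apply IsLocalization.ringHom_ext (Z.A ⊗[ℂ] Z'.A)⁰
    refine RingHom.ext fun x => ?_
    simp [diagFrac_algebraMap, diag_mul]
  exact RingHom.congr_fun this x

lemma diagFrac_one (x : Frac Z Z') : diagFrac Z Z' 1 x = x := by
  have : (diagFrac Z Z' 1 : Frac Z Z' →+* Frac Z Z') = RingHom.id _ := by
    apply IsLocalization.ringHom_ext (Z.A ⊗[ℂ] Z'.A)⁰
    refine RingHom.ext fun x => ?_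
    simp [diagFrac_algebraMap, diag_one]
  exact RingHom.congr_fun this x

/-- Multiplication by `a` is an injective linear map, and it stays injective after tensoring over
the field `ℂ`. -/
lemma includeRight_mem {a : Z'.A} (ha : a ∈ Z'.A⁰) : (1 ⊗ₜ a : Z.A ⊗[ℂ] Z'.A) ∈ (Z.A ⊗[ℂ] Z'.A)⁰ := by
  rw [mem_nonZeroDivisors_iff_right]
  intro r hr
  have h : Function.Injective (LinearMap.mulLeft ℂ a) := fun b c h => by
    simpa [mul_cancel_left_mem_nonZeroDivisors ha] using h
  have := Module.Flat.lTensor_preserves_injective_linearMap (M := Z.A) _ h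
  refine this ?_
  rw [map_zero, ← hr, mul_comm]
  clear hr
  induction r using TensorProduct.induction_on with
  | zero => simp
  | tmul a b => simp
  | add x y hx hy => rw [map_add, hx, hy, mul_add]

lemma isUnit_sndFrac {a : Z'.A} (ha : a ∈ Z'.A⁰) : IsUnit (sndFrac Z Z' a) :=
  IsLocalization.map_units (Frac Z Z') (⟨_, includeRight_mem Z Z' ha⟩ : (Z.A ⊗[ℂ] Z'.A)⁰)

/-- The ring of functions on the affine blow-up, as a subring. -/
abbrev blowUpSubring : Subring (Frac Z Z') := (blowUpRing Z Z').toSubring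

lemma algebraMap_mem (x : Z.A ⊗[ℂ] Z'.A) : algebraMap _ _ x ∈ blowUpSubring Z Z' :=
  Algebra.subset_adjoin (Or.inl ⟨_, rfl⟩)

lemma fst_mem (a : Z.A) : fstFrac Z Z' a ∈ blowUpSubring Z Z' := algebraMap_mem _ _ _

lemma snd_mem (a : Z'.A) : sndFrac Z Z' a ∈ blowUpSubring Z Z' := algebraMap_mem _ _ _

lemma quotient_mem {q : Frac Z Z'} {i : ι}
    (h : q * sndFrac Z Z' (Z'.wall i) = fstFrac Z Z' (Z.wall i)) : q ∈ blowUpSubring Z Z' :=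
  Algebra.subset_adjoin (Or.inr ⟨i, h⟩)

/-- A subring containing the functions on both factors and the fractions contains the ring of
functions on the blow-up. -/
lemma blowUpSubring_le (S : Subring (Frac Z Z')) (h₁ : ∀ a, fstFrac Z Z' a ∈ S)
    (h₂ : ∀ a, sndFrac Z Z' a ∈ S)
    (h₃ : ∀ q i, q * sndFrac Z Z' (Z'.wall i) = fstFrac Z Z' (Z.wall i) → q ∈ S) :
    blowUpSubring Z Z' ≤ S := by
  have h : ∀ x : Z.A ⊗[ℂ] Z'.A, algebraMap _ (Frac Z Z') x ∈ S := fun x => by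
    induction x using TensorProduct.induction_on with
    | zero => simp
    | tmul a b => rw [algebraMap_tmul]; exact mul_mem (h₁ a) (h₂ b)
    | add x y hx hy => rw [map_add]; exact add_mem hx hy
  intro x hx
  refine Algebra.adjoin_induction (p := fun x _ => x ∈ S) ?_ ?_ (fun _ _ _ _ => add_mem)
    (fun _ _ _ _ => mul_mem) hx
  · rintro x (⟨y, rfl⟩ | ⟨i, hi⟩)
    · exact h y
    · exact h₃ x i hi
  · intro r
    rw [IsScalarTower.algebraMap_apply ℂ (Z.A ⊗[ℂ] Z'.A)]
    exact h _

lemma exists_quotient {i : ι} (h : Z'.wall i ∈ Z'.A⁰) :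
    ∃ q ∈ blowUpSubring Z Z', q * sndFrac Z Z' (Z'.wall i) = fstFrac Z Z' (Z.wall i) := by
  obtain ⟨u, hu⟩ := isUnit_sndFrac Z Z' h
  have : fstFrac Z Z' (Z.wall i) * ↑u⁻¹ * sndFrac Z Z' (Z'.wall i) = fstFrac Z Z' (Z.wall i) := by
    rw [← hu, Units.inv_mul_cancel_right]
  exact ⟨_, quotient_mem Z Z' this, this⟩

variable {Z Z'} {s : ι → W} {π : W → ι → ι}

lemma diagFrac_quotient (hZ : IsReflective Z s π) (hZ' : IsReflective Z' s π) {q : Frac Z Z'}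
    {i : ι} (h : q * sndFrac Z Z' (Z'.wall i) = fstFrac Z Z' (Z.wall i)) (w : W) :
    diagFrac Z Z' w q * sndFrac Z Z' (Z'.wall (π w i)) = fstFrac Z Z' (Z.wall (π w i)) := by
  rw [← hZ.perm, ← hZ'.perm, ← diagFrac_fst, ← diagFrac_snd, ← map_mul, h]

lemma diagFrac_mem (hZ : IsReflective Z s π) (hZ' : IsReflective Z' s π) (w : W) {b : Frac Z Z'}
    (hb : b ∈ blowUpSubring Z Z') : diagFrac Z Z' w b ∈ blowUpSubring Z Z' := by
  have : blowUpSubring Z Z' ≤ (blowUpSubring Z Z').comap (diagFrac Z Z' w : Frac Z Z' →+* _) := by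
    apply blowUpSubring_le
    · intro a
      simpa [diagFrac_fst] using fst_mem Z Z' _
    · intro a
      simpa [diagFrac_snd] using snd_mem Z Z' _
    · intro q i h
      exact quotient_mem Z Z' (diagFrac_quotient hZ hZ' h w)
  exact this hb

end Frac

end WScheme

end AffineBlowUp

end

noncomputable section

namespace AffineBlowUp

namespace WScheme

open scoped nonZeroDivisors

variable {W : Type*} [Group W] {ι : Type*} (Z Z' : WScheme W ι)

/-! ### The correspondence for the rings of functions -/

/-- Functions on the first factor, as functions on the blow-up. -/
def fstB : Z.A →+* blowUpSubring Z Z' := (fstFrac Z Z').codRestrict _ (fst_mem Z Z')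

/-- Functions on the second factor, as functions on the blow-up. -/
def sndB : Z'.A →+* blowUpSubring Z Z' := (sndFrac Z Z').codRestrict _ (snd_mem Z Z')

/-- The inclusion of the `W`-invariant functions on the blow-up. -/
def invB : blowUpInvariants Z Z' →+* blowUpSubring Z Z' := Subring.inclusion fun _ h => h.1

/-- The action of `W` on the functions on the blow-up. -/
def diagB {s : ι → W} {π : W → ι → ι} {Z Z' : WScheme W ι} (hZ : IsReflective Z s π)
    (hZ' : IsReflective Z' s π) (w : W) : blowUpSubring Z Z' →+* blowUpSubring Z Z' :=
  ((diagFrac Z Z' w : Frac Z Z' →+* Frac Z Z').comp (blowUpSubring Z Z').subtype).codRestrict _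
    fun b => diagFrac_mem hZ hZ' w b.2

variable {Z Z'}

lemma toBlowUpInvariants_coe (x : Z'.invariants) :
    (toBlowUpInvariants Z Z' x : Frac Z Z') = sndFrac Z Z' x := rfl

/-- Rings of functions `R` on a base and `R'` on its cover pulled back from `Z' ⟶ Z' / W`. -/
structure CoverData (Z' : WScheme W ι) {R R' : Type*} [CommRing R] [CommRing R'] (j : R →+* R')
    (σ : W → R' →+* R') (q : Z'.A →+* R') (k : Z'.invariants →+* R) : Prop where
  inj : Function.Injective j
  fixed (r' : R') : (∀ w, σ w r' = r') → ∃ r, j r = r'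
  σ_j (w : W) (r : R) : σ w (j r) = j r
  σ_q (w : W) (a : Z'.A) : σ w (q a) = q (Z'.ρ w a)
  comm (x : Z'.invariants) : j (k x) = q x
  nzd (a : Z'.A) : a ∈ Z'.A⁰ → q a ∈ R'⁰
  regMod (a b : Z'.A) : a ∈ Z'.A⁰ → RegMod a b → RegMod (q a) (q b)

variable {R R' : Type*} [CommRing R] [CommRing R'] {j : R →+* R'} {σ : W → R' →+* R'}
  {q : Z'.A →+* R'} {k : Z'.invariants →+* R}

/-- `W`-equivariant ring homomorphisms subject to the wall condition. -/
structure IsInvHom (σ : W → R' →+* R') (q : Z'.A →+* R') (f : Z.A →+* R') : Prop where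
  alg (c : ℂ) : f (algebraMap ℂ Z.A c) = q (algebraMap ℂ Z'.A c)
  σ_f (w : W) (a : Z.A) : σ w (f a) = f (Z.ρ w a)
  wall (i : ι) : q (Z'.wall i) ∣ f (Z.wall i)

/-- An equivariant homomorphism `f` corresponds to the homomorphism `g` on invariants when both are
restrictions of a homomorphism on the ring of functions on the blow-up. -/
def Corresponds (j : R →+* R') (q : Z'.A →+* R') (f : Z.A →+* R')
    (g : blowUpInvariants Z Z' →+* R) : Prop :=
  ∃ F : blowUpSubring Z Z' →+* R', F.comp (fstB Z Z') = f ∧ F.comp (sndB Z Z') = q ∧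
    F.comp (invB Z Z') = j.comp g

/-- The value at a fraction is determined by the values on the two factors, because its product with
the regular element `²wall` is. -/
lemma blowUp_hom_ext {F F' : blowUpSubring Z Z' →+* R'}
    (h₁ : F.comp (fstB Z Z') = F'.comp (fstB Z Z')) (h₂ : F.comp (sndB Z Z') = F'.comp (sndB Z Z'))
    (h₃ : ∀ i, F (sndB Z Z' (Z'.wall i)) ∈ R'⁰) : F = F' := by
  have : blowUpSubring Z Z' ≤ (F.eqLocus F').map (blowUpSubring Z Z').subtype := by
    apply blowUpSubring_le
    · exact fun a => ⟨fstB Z Z' a, RingHom.congr_fun h₁ a, rfl⟩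
    · exact fun a => ⟨sndB Z Z' a, RingHom.congr_fun h₂ a, rfl⟩
    · intro t i ht
      refine ⟨⟨t, quotient_mem Z Z' ht⟩, ?_, rfl⟩
      have e : (⟨t, quotient_mem Z Z' ht⟩ : blowUpSubring Z Z') * sndB Z Z' (Z'.wall i) =
          fstB Z Z' (Z.wall i) := Subtype.ext ht
      have e₁ := congrArg F e
      have e₂ := congrArg F' e
      have e₃ := RingHom.congr_fun h₁ (Z.wall i)
      have e₄ := RingHom.congr_fun h₂ (Z'.wall i)
      simp only [RingHom.comp_apply] at e₃ e₄
      rw [map_mul] at e₁ e₂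
      rw [← e₃, ← e₁, ← e₄] at e₂
      exact ((mul_cancel_right_mem_nonZeroDivisors (h₃ i)).1 e₂).symm
  ext x
  obtain ⟨y, hy, e⟩ := this x.2
  rwa [show y = x from Subtype.ext e] at hy

section

variable {s : ι → W} {π : W → ι → ι} (hZ : IsReflective Z s π) (hZ' : IsReflective Z' s π)

lemma diagB_fstB (w : W) (a : Z.A) :
    diagB hZ hZ' w (fstB Z Z' a) = fstB Z Z' (Z.ρ w a) := Subtype.ext (diagFrac_fst Z Z' w a)

lemma diagB_sndB (w : W) (a : Z'.A) :
    diagB hZ hZ' w (sndB Z Z' a) = sndB Z Z' (Z'.ρ w a) := Subtype.ext (diagFrac_snd Z Z' w a)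

lemma diagB_invB (w : W) (x : blowUpInvariants Z Z') :
    diagB hZ hZ' w (invB Z Z' x) = invB Z Z' x := Subtype.ext (x.2.2 w)

include hZ hZ'

/-- Every generator of the blow-up ring has a denominator `1` or `²wall`, and the wall condition
divides `f` by the latter, so `f` and `q` extend to `F`. By uniqueness of extensions `F` is
equivariant; invariant functions thus go to fixed elements of `R'`, which come from `R`. -/
theorem existsUnique_corresponds_right (hw : ∀ i, Z'.wall i ∈ Z'.A⁰) (D : CoverData Z' j σ q k)
    {f : Z.A →+* R'} (hf : IsInvHom σ q f) :
    ∃! g : blowUpInvariants Z Z' →+* R, Corresponds j q f g := by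
  let _ : Algebra ℂ R' := (q.comp (algebraMap ℂ Z'.A)).toAlgebra
  let f' : Z.A →ₐ[ℂ] R' := { f with commutes' := hf.alg }
  let q' : Z'.A →ₐ[ℂ] R' := { q with commutes' := fun _ => rfl }
  let G : Z.A ⊗[ℂ] Z'.A →+* R' := (Algebra.TensorProduct.productMap f' q').toRingHom
  let i : Z'.A →+* Z.A ⊗[ℂ] Z'.A :=
    (Algebra.TensorProduct.includeRight : Z'.A →ₐ[ℂ] Z.A ⊗[ℂ] Z'.A).toRingHom
  let m : Z.A ⊗[ℂ] Z'.A →+* Frac Z Z' := algebraMap _ _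
  have hGf : ∀ a : Z.A, G (a ⊗ₜ 1) = f a := fun a => by simp [G, f']
  have hGq : ∀ a : Z'.A, G (1 ⊗ₜ a) = q a := fun a => by simp [G, q']
  have hGi : ∀ a : Z'.A, G (i a) = q a := hGq
  have hmf : ∀ a : Z.A, m (a ⊗ₜ 1) = fstFrac Z Z' a := fun a => rfl
  have hmq : ∀ a : Z'.A, m (1 ⊗ₜ a) = sndFrac Z Z' a := fun a => rfl
  have hmi : ∀ a : Z'.A, m (i a) = sndFrac Z Z' a := hmq
  have hinj : Function.Injective m := IsFractionRing.injective _ _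
  have hB : blowUpSubring Z Z' ≤ extensionDomain i m G := by
    apply blowUpSubring_le
    · exact fun a => ⟨1, one_mem _, a ⊗ₜ 1, f a, by simp [hmf], by simp [hGf]⟩
    · exact fun a => ⟨1, one_mem _, 1 ⊗ₜ a, q a, by simp [hmq], by simp [hGq]⟩
    · intro t n ht
      obtain ⟨c, hc⟩ := hf.wall n
      exact ⟨Z'.wall n, hw n, Z.wall n ⊗ₜ 1, c, by rw [hmf, ← ht, hmi, mul_comm],
        by rw [hGf, hc, hGi]⟩
  obtain ⟨F, hF⟩ := exists_ringHom_extension i m G (blowUpSubring Z Z')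
    (fun a ha => by rw [hGi]; exact D.nzd a ha)
    (fun c hc => by rw [hinj (hc.trans (map_zero m).symm), map_zero]) (fun b hb => hB hb)
  have hF₁ : F.comp (fstB Z Z') = f := by
    ext a
    have := hF (fstB Z Z' a) 1 (one_mem _) (a ⊗ₜ 1) (by rw [map_one, map_one, one_mul]; rfl)
    rw [hGf, map_one, map_one, one_mul] at this
    exact this.symm
  have hF₂ : F.comp (sndB Z Z') = q := by
    ext a
    have := hF (sndB Z Z' a) 1 (one_mem _) (1 ⊗ₜ a) (by rw [map_one, map_one, one_mul]; rfl)
    rw [hGq, map_one, map_one, one_mul] at this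
    exact this.symm
  have hF₁' : ∀ a, F (fstB Z Z' a) = f a := RingHom.congr_fun hF₁
  have hF₂' : ∀ a, F (sndB Z Z' a) = q a := RingHom.congr_fun hF₂
  have hFσ : ∀ w, F.comp (diagB hZ hZ' w) = (σ w).comp F := fun w => by
    apply blowUp_hom_ext
    · ext a
      simp [diagB_fstB, hF₁', hf.σ_f]
    · ext a
      simp [diagB_sndB, hF₂', D.σ_q]
    · intro n
      rw [RingHom.comp_apply, diagB_sndB, hF₂', hZ'.perm]
      exact D.nzd _ (hw _)
  have hfix : ∀ x : blowUpInvariants Z Z', ∃ r, j r = F (invB Z Z' x) := fun x =>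
    D.fixed _ fun w => by
      have := RingHom.congr_fun (hFσ w) (invB Z Z' x)
      rw [RingHom.comp_apply, diagB_invB] at this
      exact this.symm
  obtain ⟨g, hg⟩ := exists_ringHom_comp_eq D.inj (F.comp (invB Z Z')) hfix
  refine ⟨g, ⟨F, hF₁, hF₂, hg.symm⟩, ?_⟩
  · rintro g' ⟨F', h₁, h₂, h₃⟩
    have : F' = F := by
      apply blowUp_hom_ext (h₁.trans hF₁.symm) (h₂.trans hF₂.symm)
      intro n
      rw [← RingHom.comp_apply, h₂]
      exact D.nzd _ (hw n)
    subst this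
    ext x
    exact D.inj (RingHom.congr_fun (h₃.symm.trans hg.symm) x)

end

lemma Corresponds.comp_toBlowUpInvariants (D : CoverData Z' j σ q k) {f : Z.A →+* R'}
    {g : blowUpInvariants Z Z' →+* R} (h : Corresponds j q f g) :
    g.comp (toBlowUpInvariants Z Z') = k := by
  obtain ⟨F, -, h₂, h₃⟩ := h
  ext x
  apply D.inj
  rw [D.comm, ← h₂]
  exact (RingHom.congr_fun h₃ (toBlowUpInvariants Z Z' x)).symm

end WScheme

end AffineBlowUp

end

noncomputable section

namespace AffineBlowUp

namespace WScheme

open scoped nonZeroDivisors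

variable {W : Type*} [Group W] {ι : Type*}

/-! ### Functions on the group which separate its elements -/

section Separator

variable (Z' : WScheme W ι)

/-- The function `w ↦ ∑ aᵢ * w cᵢ` attached to `∑ aᵢ ⊗ cᵢ`. -/
def separator : Z'.A ⊗[ℤ] Z'.A →+* (W → Z'.A) :=
  intProductMap (RingHom.pi fun _ => RingHom.id Z'.A)
    (RingHom.pi fun w => (Z'.ρ w : Z'.A →+* Z'.A))

lemma separator_tmul (a c : Z'.A) (w : W) : separator Z' (a ⊗ₜ c) w = a * Z'.ρ w c := by
  rw [separator, intProductMap_tmul]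
  rfl

/-- A separator supported away from the inverses of a given finite set. -/
lemma exists_separator (S : Finset W) (a : W → Z'.A) :
    ∃ z, (∀ v, v⁻¹ ∈ S → separator Z' z v = 0) ∧
      ∀ v, separator Z' z v = ∏ w ∈ S, (a w - Z'.ρ v (Z'.ρ w (a w))) := by
  have h : ∀ v, separator Z' (∏ w ∈ S, (a w ⊗ₜ 1 - 1 ⊗ₜ Z'.ρ w (a w))) v =
      ∏ w ∈ S, (a w - Z'.ρ v (Z'.ρ w (a w))) := fun v => by
    rw [map_prod, Finset.prod_apply]
    refine Finset.prod_congr rfl fun w _ => ?_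
    rw [map_sub, Pi.sub_apply, separator_tmul, separator_tmul, map_one, mul_one, one_mul]
  refine ⟨_, fun v hv => ?_, h⟩
  rw [h]
  refine Finset.prod_eq_zero hv ?_
  rw [← ρ_mul_apply, mul_inv_cancel, ρ_one_apply, sub_self]

end Separator

/-! ### Multiplying functions on the blow-up into the image of `B^W ⊗ A`. -/

section Descent

variable {Z Z' : WScheme W ι} {s : ι → W} {π : W → ι → ι}

lemma regMod_mul_dvd_wall (hZ' : IsReflective Z' s π) (i : ι) {a : Z'.A}
    (h : RegMod (Z'.wall i) a) : RegMod (Z'.wall i) (Z'.ρ (s i) a) :=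
  h.congr (hZ'.dvd_sub i a)

lemma regMod_two (x : Z'.A) : RegMod x (2 : Z'.A) := by
  apply RegMod.of_isUnit
  have : (2 : Z'.A) = algebraMap ℂ Z'.A 2 := (map_ofNat _ 2).symm
  rw [this]
  exact (isUnit_iff_ne_zero.2 two_ne_zero).map _

/-- Up to denominators prime to the wall, the difference `b - s b` of a function on the blow-up and
its reflection is divisible by the equation of the wall. -/
lemma exists_divided_difference (hZ : IsReflective Z s π) (hZ' : IsReflective Z' s π)
    (hS : IsSeparated Z' s π) (i : ι) {b : Frac Z Z'} (hb : b ∈ blowUpSubring Z Z') :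
    ∃ h, RegMod (Z'.wall i) h ∧ ∃ b' ∈ blowUpSubring Z Z',
      sndFrac Z Z' h * (b - diagFrac Z Z' (s i) b) = sndFrac Z Z' (Z'.wall i) * b' := by
  obtain ⟨t, htB, ht⟩ := exists_quotient Z Z' (hS.wall_mem i)
  set p := sndFrac Z Z' with hp
  set p₁ := fstFrac Z Z' with hp₁
  set D := diagFrac Z Z' (s i) with hD
  have hss : ∀ b, D (D b) = b := fun b => by
    rw [hD, ← diagFrac_mul, hZ.mul_self, diagFrac_one]
  let S : Subring (Frac Z Z') :=
    { carrier := {b | b ∈ blowUpSubring Z Z' ∧ ∃ h, RegMod (Z'.wall i) h ∧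
        ∃ b' ∈ blowUpSubring Z Z', p h * (b - D b) = p (Z'.wall i) * b'}
      mul_mem' := by
        rintro b c ⟨hb, h, hh, b', hb', e⟩ ⟨hc, k, hk, c', hc', e'⟩
        -- Twisted Leibniz rule: `bc - D(bc) = (b - D b) c + D b (c - D c)`.
        refine ⟨mul_mem hb hc, h * k, hh.mul hk, p k * b' * c + D b * (p h * c'), ?_, ?_⟩
        · exact add_mem (mul_mem (mul_mem (snd_mem _ _ _) hb') hc)
            (mul_mem (diagFrac_mem hZ hZ' _ hb) (mul_mem (snd_mem _ _ _) hc'))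
        · rw [map_mul, map_mul]
          linear_combination p k * c * e + D b * p h * e'
      one_mem' := ⟨one_mem _, 1, RegMod.one _, 0, zero_mem _, by simp⟩
      add_mem' := by
        rintro b c ⟨hb, h, hh, b', hb', e⟩ ⟨hc, k, hk, c', hc', e'⟩
        refine ⟨add_mem hb hc, h * k, hh.mul hk, p k * b' + p h * c', ?_, ?_⟩
        · exact add_mem (mul_mem (snd_mem _ _ _) hb') (mul_mem (snd_mem _ _ _) hc')
        · rw [map_mul, map_add]
          linear_combination p k * e + p h * e'
      zero_mem' := ⟨zero_mem _, 1, RegMod.one _, 0, zero_mem _, by simp⟩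
      neg_mem' := by
        rintro b ⟨hb, h, hh, b', hb', e⟩
        refine ⟨neg_mem hb, h, hh, -b', neg_mem hb', ?_⟩
        rw [map_neg]
        linear_combination -e }
  -- the divided difference of the fraction attached to the wall itself
  have htS : ∃ b' ∈ blowUpSubring Z Z', t - D t = p (Z'.wall i) * b' := by
    obtain ⟨u, hu, c, hc⟩ := hZ'.refl i
    obtain ⟨v, hv, d, hd⟩ := hZ.refl i
    have hsu : Z'.ρ (s i) u * u = 1 := by
      have h₁ : Z'.ρ (s i) (Z'.ρ (s i) (Z'.wall i)) = Z'.wall i := by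
        rw [← ρ_mul_apply, hZ.mul_self, ρ_one_apply]
      rw [hu, map_mul, hu, ← mul_assoc] at h₁
      exact (mul_cancel_right_mem_nonZeroDivisors (hS.wall_mem i)).1 (h₁.trans (one_mul _).symm)
    have e₁ : D t * (p u * p (Z'.wall i)) = p₁ v * p₁ (Z.wall i) := by
      rw [← map_mul, ← map_mul, ← hu, ← hv, hp, hp₁, ← diagFrac_fst, ← diagFrac_snd, ← map_mul, ht]
    have hx : IsUnit (p (Z'.wall i)) := isUnit_sndFrac Z Z' (hS.wall_mem i)
    have e₂ : p u * D t = p₁ v * t := by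
      apply hx.mul_left_injective
      change p u * D t * _ = p₁ v * t * _
      rw [mul_assoc (p₁ v), ht, ← e₁]; ring
    -- With `u` inverted this reads `D t = (v / u) t`. Both `u + 1` and `v + 1` are multiples of
    -- `²wall`, the latter because `¹wall = t * ²wall`. Hence so is `u - v`, and with it `t - D t`.
    have e₃ : p (Z'.ρ (s i) u) * p u = 1 := by rw [← map_mul, hsu, map_one]
    have e₄ : p u + 1 = p (Z'.wall i) * p c := by rw [← map_mul, ← hc, map_add, map_one]
    have e₅ : p₁ v + 1 = t * p (Z'.wall i) * p₁ d := by
      rw [ht, ← map_mul, ← hd, map_add, map_one]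
    refine ⟨p (Z'.ρ (s i) u) * (p c - t * p₁ d) * t, ?_, ?_⟩
    · exact mul_mem (mul_mem (snd_mem _ _ _) (sub_mem (snd_mem _ _ _)
        (mul_mem htB (fst_mem _ _ _)))) htB
    · linear_combination (t - D t) * (-e₃) - p (Z'.ρ (s i) u) * e₂ +
        p (Z'.ρ (s i) u) * t * (e₄ - e₅)
  suffices H : blowUpSubring Z Z' ≤ S from (H hb).2
  apply blowUpSubring_le
  · intro a
    obtain ⟨c, hc⟩ := hZ.dvd_sub i a
    refine ⟨fst_mem _ _ _, 1, RegMod.one _, -(t * p₁ c), neg_mem (mul_mem htB (fst_mem _ _ _)), ?_⟩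
    have e : p₁ (Z.ρ (s i) a) - p₁ a = p₁ (Z.wall i) * p₁ c := by rw [← map_sub, hc, map_mul]
    rw [hD, diagFrac_fst, map_one]
    linear_combination -e + p₁ c * ht
  · intro a
    obtain ⟨c, hc⟩ := hZ'.dvd_sub i a
    refine ⟨snd_mem _ _ _, 1, RegMod.one _, -p c, neg_mem (snd_mem _ _ _), ?_⟩
    have e : p (Z'.ρ (s i) a) - p a = p (Z'.wall i) * p c := by rw [← map_sub, hc, map_mul]
    rw [hD, diagFrac_snd, map_one]
    linear_combination -e
  · intro r l hr
    refine ⟨quotient_mem _ _ hr, ?_⟩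
    have hx : IsUnit (p (Z'.wall i)) := isUnit_sndFrac Z Z' (hS.wall_mem i)
    rcases hS.wall_wall i l with h | rfl | rfl
    · obtain ⟨c, hc⟩ := hZ.dvd_sub i (Z.wall l)
      obtain ⟨c', hc'⟩ := hZ'.dvd_sub i (Z'.wall l)
      refine ⟨Z'.wall l * Z'.ρ (s i) (Z'.wall l), h.mul (regMod_mul_dvd_wall hZ' i h),
        p₁ (Z.wall l) * p c' - p (Z'.wall l) * (t * p₁ c), ?_, ?_⟩
      · exact sub_mem (mul_mem (fst_mem _ _ _) (snd_mem _ _ _))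
          (mul_mem (snd_mem _ _ _) (mul_mem htB (fst_mem _ _ _)))
      · have e : D r * p (Z'.ρ (s i) (Z'.wall l)) = p₁ (Z.ρ (s i) (Z.wall l)) := by
          rw [hp, hp₁, ← diagFrac_fst, ← diagFrac_snd, ← map_mul, hr]
        have e' : p₁ (Z.ρ (s i) (Z.wall l)) - p₁ (Z.wall l) = p₁ (Z.wall i) * p₁ c := by
          rw [← map_sub, hc, map_mul]
        have e'' : p (Z'.ρ (s i) (Z'.wall l)) - p (Z'.wall l) = p (Z'.wall i) * p c' := by
          rw [← map_sub, hc', map_mul]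
        rw [map_mul]
        linear_combination p (Z'.ρ (s i) (Z'.wall l)) * hr - p (Z'.wall l) * e
          - p (Z'.wall l) * e' + p₁ (Z.wall l) * e'' + p (Z'.wall l) * p₁ c * ht
    · obtain ⟨b', hb', e⟩ := htS
      have : r = t := (isUnit_sndFrac Z Z' (hS.wall_mem l)).mul_left_injective (hr.trans ht.symm)
      subst this
      exact ⟨1, RegMod.one _, b', hb', by rw [map_one, one_mul, e]⟩
    · obtain ⟨b', hb', e⟩ := htS
      have : r = D t := (isUnit_sndFrac Z Z' (hS.wall_mem _)).mul_left_injective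
        (hr.trans (diagFrac_quotient hZ hZ' ht (s i)).symm)
      subst this
      refine ⟨1, RegMod.one _, -b', neg_mem hb', ?_⟩
      rw [map_one, hss]
      linear_combination -e

variable (Z Z') in
/-- The multiplication map on the tensor product of the invariant functions on the blow-up and the
functions on `Z'`. -/
def mulInv : blowUpInvariants Z Z' ⊗[ℤ] Z'.A →+* Frac Z Z' :=
  intProductMap (blowUpInvariants Z Z').subtype (sndFrac Z Z')

lemma mulInv_tmul (x : blowUpInvariants Z Z') (a : Z'.A) :
    mulInv Z Z' (x ⊗ₜ a) = x * sndFrac Z Z' a := intProductMap_tmul _ _ _ _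

variable [Fintype W]

/-- The trace of a function on `Z'`. -/
def trace (Z' : WScheme W ι) (a : Z'.A) : Z'.invariants :=
  ⟨∑ w, Z'.ρ w a, fun v => by
    rw [map_sum]
    simp_rw [← ρ_mul_apply]
    exact Fintype.sum_equiv (Equiv.mulLeft v) _ _ fun _ => rfl⟩

/-- For `z = a ⊗ c` the sum is `a` times the trace of `c b`, and traces are invariant. -/
lemma sum_separator_mem (hZ : IsReflective Z s π) (hZ' : IsReflective Z' s π)
    (z : Z'.A ⊗[ℤ] Z'.A) {b : Frac Z Z'} (hb : b ∈ blowUpSubring Z Z') :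
    ∑ w, sndFrac Z Z' (separator Z' z w) * diagFrac Z Z' w b ∈ (mulInv Z Z').range := by
  induction z using TensorProduct.induction_on with
  | zero => simp
  | tmul a c =>
    have hx : ∑ w, diagFrac Z Z' w (sndFrac Z Z' c * b) ∈ blowUpInvariants Z Z' := by
      refine ⟨sum_mem fun w _ => diagFrac_mem hZ hZ' w (mul_mem (snd_mem _ _ _) hb), fun v => ?_⟩
      rw [map_sum]
      simp_rw [← diagFrac_mul]
      exact Fintype.sum_equiv (Equiv.mulLeft v) _ _ fun _ => rfl
    refine ⟨⟨_, hx⟩ ⊗ₜ a, ?_⟩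
    rw [mulInv_tmul, Finset.sum_mul]
    refine Finset.sum_congr rfl fun w _ => ?_
    rw [separator_tmul, map_mul, map_mul, diagFrac_snd]
    ring
  | add x y hx hy =>
    simp only [map_add, Pi.add_apply, add_mul, Finset.sum_add_distrib]
    exact add_mem hx hy

variable [DecidableEq W]

/-- Functions on the blow-up become sums of products of invariant functions and functions on `Z'`
after multiplication with a function supported where `W` acts freely. -/
lemma prod_mul_mem_range (hZ : IsReflective Z s π) (hZ' : IsReflective Z' s π) (a : W → Z'.A)
    {b : Frac Z Z'} (hb : b ∈ blowUpSubring Z Z') :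
    sndFrac Z Z' (∏ w ∈ Finset.univ.erase 1, (a w - Z'.ρ w (a w))) * b ∈ (mulInv Z Z').range := by
  obtain ⟨z, h₁, h₂⟩ := exists_separator Z' (Finset.univ.erase 1) a
  have := sum_separator_mem hZ hZ' z hb
  rw [Finset.sum_eq_single 1] at this
  · rw [h₂, diagFrac_one] at this
    simpa only [ρ_one_apply] using this
  · intro w _ hw
    rw [h₁ w (by simpa using hw), map_zero, zero_mul]
  · exact fun h => absurd (Finset.mem_univ _) h

/-- Functions on the blow-up become sums of products of invariant functions and functions on `Z'`
after multiplication with a function which is regular along a given wall. -/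
lemma exists_regMod_wall_mul_mem_range (hZ : IsReflective Z s π) (hZ' : IsReflective Z' s π)
    (hS : IsSeparated Z' s π) (i : ι) {b : Frac Z Z'} (hb : b ∈ blowUpSubring Z Z') :
    ∃ h, RegMod (Z'.wall i) h ∧ sndFrac Z Z' h * b ∈ (mulInv Z Z').range := by
  choose! a ha using hS.along_wall i
  -- This separator may be nonzero only at `1` and `s i`. Its values `e`, `e'` there agree modulo
  -- the wall, as `s i` acts trivially on it, so `e + e'` is congruent to `2 e` and regular along
  -- the wall.
  obtain ⟨z, hz₁, hz₂⟩ := exists_separator Z' ((Finset.univ.erase 1).erase (s i)) a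
  set e := separator Z' z 1 with he
  set e' := separator Z' z (s i) with he'
  have hsinv : (s i)⁻¹ = s i := inv_eq_of_mul_eq_one_left (hZ.mul_self i)
  have hsi : ∀ w, w ≠ 1 → w ≠ s i → separator Z' z w = 0 := fun w h₁ h₂ =>
    hz₁ w (by simp [h₁, inv_eq_iff_eq_inv, hsinv, h₂])
  have hdvd : ∀ y : Z'.A ⊗[ℤ] Z'.A,
      Z'.wall i ∣ separator Z' y (s i) - separator Z' y 1 := fun y => by
    induction y using TensorProduct.induction_on with
    | zero => simp
    | tmul a c =>
      rw [separator_tmul, separator_tmul, ← mul_sub, ρ_one_apply]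
      exact (hZ'.dvd_sub i c).mul_left a
    | add x y hx hy =>
      simp only [map_add, Pi.add_apply]
      rw [add_sub_add_comm]
      exact dvd_add hx hy
  have hreg : RegMod (Z'.wall i) e := by
    rw [he, hz₂]
    refine RegMod.prod _ _ fun w hw => ?_
    rw [ρ_one_apply]
    simp only [Finset.mem_erase, Finset.mem_univ, and_true] at hw
    exact ha w hw.2 hw.1
  have hreg' : RegMod (Z'.wall i) (e + e') := by
    refine ((regMod_two _).mul hreg).congr ?_
    have : e + e' - 2 * e = e' - e := by ring
    rw [this]
    exact hdvd z
  have hfix : ∀ c ∈ blowUpSubring Z Z', diagFrac Z Z' (s i) c = c →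
      sndFrac Z Z' (e + e') * c ∈ (mulInv Z Z').range := by
    intro c hc hsc
    -- The axioms do not exclude `s i = 1`; the sum then has the single term `e * c`, and is doubled
    -- to give the same conclusion.
    by_cases h1 : s i = 1
    · have h₃ : e' = e := by rw [he, he', h1]
      have := sum_separator_mem hZ hZ' z hc
      rw [Finset.sum_eq_single 1 (fun w _ hw => by
        rw [hsi w hw (h1 ▸ hw), map_zero, zero_mul])
        (fun h => absurd (Finset.mem_univ _) h), diagFrac_one, ← he] at this
      have h₄ : sndFrac Z Z' (e + e') * c =
          sndFrac Z Z' e * c + sndFrac Z Z' e * c := by rw [h₃, map_add, add_mul]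
      rw [h₄]
      exact add_mem this this
    · have := sum_separator_mem hZ hZ' z hc
      rw [← Finset.sum_subset (Finset.subset_univ {1, s i}) (fun w _ hw => by
        simp only [Finset.mem_insert, Finset.mem_singleton, not_or] at hw
        rw [hsi w hw.1 hw.2, map_zero, zero_mul]), Finset.sum_pair (Ne.symm h1), diagFrac_one, hsc,
        ← add_mul, ← map_add] at this
      exact this
  obtain ⟨u, hu, c, hc⟩ := hZ'.refl i
  obtain ⟨h₀, hh₀, b₀, hb₀, eb₀⟩ := exists_divided_difference hZ hZ' hS i hb
  have hss : ∀ b, diagFrac Z Z' (s i) (diagFrac Z Z' (s i) b) = b := fun b => by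
    rw [← diagFrac_mul, hZ.mul_self, diagFrac_one]
  have hdv := hZ'.dvd_sub i
  have hss' : ∀ a, Z'.ρ (s i) (Z'.ρ (s i) a) = a := fun a => by
    rw [← ρ_mul_apply, hZ.mul_self, ρ_one_apply]
  set p := sndFrac Z Z' with hp
  have hDp : ∀ a, diagFrac Z Z' (s i) (p a) = p (Z'.ρ (s i) a) := diagFrac_snd Z Z' (s i)
  have hDB : ∀ b ∈ blowUpSubring Z Z',
      diagFrac Z Z' (s i) b ∈ blowUpSubring Z Z' :=
    fun b hb => diagFrac_mem hZ hZ' _ hb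
  have hxu : IsUnit (p (Z'.wall i)) := isUnit_sndFrac Z Z' (hS.wall_mem i)
  generalize diagFrac Z Z' (s i) = D at *
  generalize Z'.wall i = x at *
  -- Replacing `h₀` by its norm makes the denominator `h` fixed by the reflection. Applying `D` to
  -- `h (b - D b) = x b'` then gives `b' = -u D b'`. Therefore `(1 - s u) b' = b' + D b'` is fixed
  -- by the reflection, where `1 - s u` is `2` modulo the wall.
  obtain ⟨h, hh⟩ : ∃ h, h = h₀ * Z'.ρ (s i) h₀ := ⟨_, rfl⟩
  obtain ⟨b', hb'⟩ : ∃ b', b' = p (Z'.ρ (s i) h₀) * b₀ := ⟨_, rfl⟩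
  have hbB : b' ∈ blowUpSubring Z Z' := by
    rw [hb']
    exact mul_mem (snd_mem _ _ _) hb₀
  have hreg₁ : RegMod x h := by
    rw [hh]
    exact hh₀.mul (hh₀.congr (hdv h₀))
  have eb : p h * (b - D b) = p x * b' := by
    rw [hh, hb', map_mul]
    linear_combination p (Z'.ρ (s i) h₀) * eb₀
  have hDh : D (p h) = p h := by
    rw [hDp, hh, map_mul, hss', mul_comm]
  have hDx : D (p x) = p u * p x := by rw [hDp, hu, map_mul]
  have hb₁ : b' = -(p u * D b') := by
    have h₂ := congrArg D eb
    rw [map_mul, map_sub, map_mul, hDh, hDx, hss] at h₂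
    apply hxu.mul_right_injective
    change p x * b' = p x * _
    linear_combination -eb - h₂
  have hb₂ : D b' = -(p (Z'.ρ (s i) u) * b') := by
    have h₂ := congrArg D hb₁
    rw [map_neg, map_mul, hss, hDp] at h₂
    exact h₂
  have hd : p (1 - Z'.ρ (s i) u) * b' = b' + D b' := by
    rw [hb₂, map_sub, map_one]; ring
  have hreg₂ : RegMod x (1 - Z'.ρ (s i) u) := by
    refine (regMod_two x).congr ?_
    have h₃ : (1 - Z'.ρ (s i) u - 2 : Z'.A) = -((Z'.ρ (s i) u - u) + (u + 1)) := by ring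
    rw [h₃, dvd_neg]
    exact dvd_add (hdv u) ⟨c, hc⟩
  refine ⟨2 * (h * (1 - Z'.ρ (s i) u) * (e + e')),
    (regMod_two _).mul ((hreg₁.mul hreg₂).mul hreg'), ?_⟩
  have m₁ := hfix (b + D b) (add_mem hb (hDB _ hb)) (by
    rw [map_add, hss, add_comm])
  have m₂ := hfix (b' + D b') (add_mem hbB (hDB _ hbB)) (by
    rw [map_add, hss, add_comm])
  have hsnd : ∀ a, p a ∈ (mulInv Z Z').range := fun a => ⟨1 ⊗ₜ a, by
    rw [mulInv_tmul]; simp [hp]⟩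
  -- This is `2 h b = h (b + D b) + x b'`, multiplied by `(1 - s u)(e + e')`: both summands become
  -- multiples of functions covered by `hfix`.
  have : p (2 * (h * (1 - Z'.ρ (s i) u) * (e + e'))) * b =
      p (h * (1 - Z'.ρ (s i) u)) * (p (e + e') * (b + D b)) +
        p x * (p (e + e') * (b' + D b')) := by
    rw [← hd]
    simp only [map_mul, map_ofNat]
    linear_combination p (1 - Z'.ρ (s i) u) * p (e + e') * eb
  rw [this]
  exact add_mem (mul_mem (hsnd _) m₁) (mul_mem (hsnd _) m₂)

end Descent

end WScheme

end AffineBlowUp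

end

noncomputable section

namespace AffineBlowUp

namespace WScheme

open scoped nonZeroDivisors

variable {W : Type*} [Group W] {ι : Type*}

/-! ### Extending homomorphisms from invariants -/

section Extend

variable {Z Z' : WScheme W ι} {s : ι → W} {π : W → ι → ι}
  {R R' : Type*} [CommRing R] [CommRing R'] {j : R →+* R'} {σ : W → R' →+* R'}
  {q : Z'.A →+* R'} {k : Z'.invariants →+* R}

lemma ρ_mem_nonZeroDivisors (w : W) {a : Z'.A} (ha : a ∈ Z'.A⁰) : Z'.ρ w a ∈ Z'.A⁰ := by
  rw [mem_nonZeroDivisors_iff_right] at ha ⊢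
  intro r hr
  have := ha ((Z'.ρ w).symm r) ((Z'.ρ w).injective (by simpa using hr))
  simpa using this

variable [Fintype W]

/-- The element `t` is the trace of `d` times the product represented by `c`. On `x ⊗ a` it equals
`x * trace (d * a)`, and the value of `g` on a trace from `Z'` is prescribed by `k`. So `g t` is
known without extending `g` beyond invariants. -/
lemma exists_trace_mul (D : CoverData Z' j σ q k) {g : blowUpInvariants Z Z' →+* R}
    (hg : g.comp (toBlowUpInvariants Z Z') = k) (d : Z'.A)
    (c : blowUpInvariants Z Z' ⊗[ℤ] Z'.A) :
    ∃ t : blowUpInvariants Z Z',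
      (t : Frac Z Z') = ∑ w, sndFrac Z Z' (Z'.ρ w d) * diagFrac Z Z' w (mulInv Z Z' c) ∧
      j (g t) = ∑ w, q (Z'.ρ w d) *
        intProductMap (j.comp g) (q.comp (Z'.ρ w : Z'.A →+* Z'.A)) c := by
  induction c using TensorProduct.induction_on with
  | zero => exact ⟨0, by simp, by simp⟩
  | tmul x a =>
    refine ⟨x * toBlowUpInvariants Z Z' (trace Z' (d * a)), ?_, ?_⟩
    · rw [Subring.coe_mul, toBlowUpInvariants_coe, trace, mulInv_tmul]
      simp only [map_sum, map_mul, diagFrac_snd, x.2.2]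
      rw [Finset.mul_sum]
      exact Finset.sum_congr rfl fun w _ => by ring
    · have h : j (g (toBlowUpInvariants Z Z' (trace Z' (d * a)))) =
          ∑ w, q (Z'.ρ w d) * q (Z'.ρ w a) := by
        rw [show g (toBlowUpInvariants Z Z' (trace Z' (d * a))) = k _ from RingHom.congr_fun hg _,
          D.comm, trace, map_sum]
        simp only [map_mul]
      rw [map_mul, map_mul, h, Finset.mul_sum]
      refine Finset.sum_congr rfl fun w _ => ?_
      rw [intProductMap_tmul]
      change _ = _ * (j (g x) * q (Z'.ρ w a))
      ring
  | add x y hx hy =>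
    obtain ⟨t, ht, ht'⟩ := hx
    obtain ⟨u, hu, hu'⟩ := hy
    refine ⟨t + u, ?_, ?_⟩
    · simp only [Subring.coe_add, ht, hu, map_add, mul_add, Finset.sum_add_distrib]
    · simp only [ht', hu', map_add, mul_add, Finset.sum_add_distrib]

variable [DecidableEq W]

lemma prod_sub_mem {a : W → Z'.A} (ha : ∀ w, w ≠ 1 → a w - Z'.ρ w (a w) ∈ Z'.A⁰) :
    ∏ w ∈ Finset.univ.erase 1, (a w - Z'.ρ w (a w)) ∈ Z'.A⁰ :=
  prod_mem fun w hw => ha w (Finset.ne_of_mem_erase hw)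

/-- The homomorphism on the tensor product induced by a homomorphism on invariant functions
vanishes on the kernel of the multiplication map. -/
lemma intProductMap_eq_zero (hS : IsSeparated Z' s π) (D : CoverData Z' j σ q k)
    {g : blowUpInvariants Z Z' →+* R} (hg : g.comp (toBlowUpInvariants Z Z') = k)
    {c : blowUpInvariants Z Z' ⊗[ℤ] Z'.A} (hc : mulInv Z Z' c = 0) :
    intProductMap (j.comp g) q c = 0 := by
  choose! a ha using fun w (hw : w ≠ 1) => hS.generic w hw
  obtain ⟨z, h₁, h₂⟩ := exists_separator Z' (Finset.univ.erase 1) a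
  -- All the traces attached to `c` vanish, so every separator gives a linear relation between the
  -- `W`-twists of the value at `c`. The separator `z` isolates the term `w = 1`, with a regular
  -- coefficient.
  have h₃ : ∀ y : Z'.A ⊗[ℤ] Z'.A, ∑ w, q (separator Z' y w) *
      intProductMap (j.comp g) (q.comp (Z'.ρ w : Z'.A →+* Z'.A)) c = 0 := fun y => by
    induction y using TensorProduct.induction_on with
    | zero => simp
    | tmul b d =>
      obtain ⟨t, ht, ht'⟩ := exists_trace_mul D hg d c
      have : t = 0 := by
        apply Subtype.ext
        rw [ht, hc]
        simp
      rw [this, map_zero, map_zero] at ht'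
      simp only [separator_tmul, map_mul, mul_assoc]
      rw [← Finset.mul_sum, ← ht', mul_zero]
    | add x y hx hy =>
      simp only [map_add, Pi.add_apply, add_mul, Finset.sum_add_distrib]
      rw [hx, hy, add_zero]
  have h₄ := h₃ z
  rw [Finset.sum_eq_single 1 (fun w _ hw => by
    rw [h₁ w (by simpa using hw), map_zero, zero_mul])
    (fun h => absurd (Finset.mem_univ _) h), h₂] at h₄
  have h₅ : q.comp (Z'.ρ 1 : Z'.A →+* Z'.A) = q := by
    ext x
    simp
  simp only [ρ_one_apply, h₅] at h₄
  exact (mem_nonZeroDivisors_iff_right.1 (D.nzd _ (prod_sub_mem fun w hw => (ha w hw).1))) _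
    (by rw [mul_comm]; exact h₄)

/-- If multiples of `b` by elements regular modulo each of the factors of a product extend, and the
multiple by the product extends, then `b` itself extends. -/
lemma exists_of_prod (hS : IsSeparated Z' s π) (D : CoverData Z' j σ q k)
    {g : blowUpInvariants Z Z' →+* R} (hg : g.comp (toBlowUpInvariants Z Z') = k)
    (S : Finset W) (d : W → Z'.A) (b : Frac Z Z') (hd : ∀ w ∈ S, d w ∈ Z'.A⁰)
    (hreg : ∀ w ∈ S, ∃ h, RegMod (d w) h ∧ sndFrac Z Z' h * b ∈ (mulInv Z Z').range)
    (c : blowUpInvariants Z Z' ⊗[ℤ] Z'.A)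
    (hc : mulInv Z Z' c = sndFrac Z Z' (∏ w ∈ S, d w) * b) :
    ∃ r, intProductMap (j.comp g) q c = q (∏ w ∈ S, d w) * r := by
  set G := intProductMap (j.comp g) q
  have hG : ∀ c c', mulInv Z Z' c = mulInv Z Z' c' → G c = G c' := fun c c' h => by
    rw [← sub_eq_zero, ← map_sub]
    exact intProductMap_eq_zero hS D hg (by rw [map_sub, h, sub_self])
  have hmq : ∀ a, mulInv Z Z' (1 ⊗ₜ a) = sndFrac Z Z' a := fun a => by
    rw [mulInv_tmul, Subring.coe_one, one_mul]
  have hGq : ∀ a, G (1 ⊗ₜ a) = q a := fun a => by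
    rw [intProductMap_tmul, map_one, one_mul]
  -- `r` stands for the value of the extension at `(∏ w ∈ T, d w) * b`
  have key : ∀ T ⊆ S, ∀ r : R', (∀ h c', mulInv Z Z' c' = sndFrac Z Z' h * b →
      q h * r = q (∏ w ∈ T, d w) * G c') → ∃ r' : R', ∀ h c',
        mulInv Z Z' c' = sndFrac Z Z' h * b → q h * r' = G c' := by
    intro T
    induction T using Finset.induction_on with
    | empty => exact fun _ r hr => ⟨r, fun h c' hc' => by simpa using hr h c' hc'⟩
    | insert w T hw ih =>
      intro hT r hr
      obtain ⟨h, hh, c', hc'⟩ := hreg w (hT (Finset.mem_insert_self w T))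
      have hwS := hd w (hT (Finset.mem_insert_self w T))
      have e := hr h c' hc'
      rw [Finset.prod_insert hw, map_mul, mul_assoc] at e
      -- The relation has the form `q h * r = q (d w) * _` with `h` regular modulo `d w`, so `q (d
      -- w)` divides `r` and one factor is removed.
      obtain ⟨r', rfl⟩ := D.regMod _ _ hwS hh _ _ e
      refine ih (fun x hx => hT (Finset.mem_insert_of_mem hx)) r' fun h' c'' hc'' => ?_
      have e' := hr h' c'' hc''
      rw [Finset.prod_insert hw, map_mul, mul_assoc, mul_left_comm] at e'
      exact (mul_cancel_left_mem_nonZeroDivisors (D.nzd _ hwS)).1 e'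
  obtain ⟨r', hr'⟩ := key S subset_rfl (G c) fun h c' hc' => by
    rw [← hGq, ← hGq, ← map_mul, ← map_mul]
    apply hG
    rw [map_mul, map_mul, hmq, hmq, hc, hc']
    ring
  exact ⟨r', (hr' _ _ hc).symm⟩

/-- Two homomorphisms which agree on invariants and on functions on `Z'` are equal. -/
lemma blowUp_hom_ext_invariants (hZ : IsReflective Z s π) (hZ' : IsReflective Z' s π)
    (hS : IsSeparated Z' s π) {F F' : blowUpSubring Z Z' →+* R'}
    (h₁ : F.comp (invB Z Z') = F'.comp (invB Z Z')) (h₂ : F.comp (sndB Z Z') = F'.comp (sndB Z Z'))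
    (h₃ : ∀ a ∈ Z'.A⁰, F (sndB Z Z' a) ∈ R'⁰) : F = F' := by
  choose! a ha using fun w (hw : w ≠ 1) => hS.generic w hw
  have key : ∀ c : blowUpInvariants Z Z' ⊗[ℤ] Z'.A,
      ∃ y : blowUpSubring Z Z', (y : Frac Z Z') = mulInv Z Z' c ∧ F y = F' y := fun c => by
    induction c using TensorProduct.induction_on with
    | zero => exact ⟨0, by simp, by simp⟩
    | tmul x a =>
      refine ⟨invB Z Z' x * sndB Z Z' a, by rw [mulInv_tmul]; rfl, ?_⟩
      have e₁ := RingHom.congr_fun h₁ x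
      have e₂ := RingHom.congr_fun h₂ a
      simp only [RingHom.comp_apply] at e₁ e₂
      rw [map_mul, map_mul, e₁, e₂]
    | add x y hx hy =>
      obtain ⟨u, hu, hu'⟩ := hx
      obtain ⟨v, hv, hv'⟩ := hy
      exact ⟨u + v, by rw [Subring.coe_add, hu, hv, map_add], by rw [map_add, map_add, hu', hv']⟩
  ext b
  obtain ⟨c, hc⟩ := prod_mul_mem_range hZ hZ' a b.2
  obtain ⟨y, hy, hy'⟩ := key c
  have : y = sndB Z Z' (∏ w ∈ Finset.univ.erase 1, (a w - Z'.ρ w (a w))) * b :=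
    Subtype.ext (hy.trans hc)
  rw [this, map_mul, map_mul, ← RingHom.comp_apply F', ← h₂] at hy'
  exact (mul_cancel_left_mem_nonZeroDivisors
    (h₃ _ (prod_sub_mem fun w hw => (ha w hw).1))).1 hy'

/-- The tensor product is taken over `ℤ`; `intProductMap_eq_zero` shows that its map to `R'`
nevertheless depends only on the product in the fraction ring. Divisibility by the discriminant,
from `exists_of_prod`, then lets `exists_ringHom_extension` define `F` on the blow-up ring, and `f`
is its restriction to the first factor. The wall condition holds because `F` has a value at each
fraction `¹wall / ²wall`. -/
theorem existsUnique_corresponds_left (hZ : IsReflective Z s π) (hZ' : IsReflective Z' s π)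
    (hS : IsSeparated Z' s π) (D : CoverData Z' j σ q k)
    {g : blowUpInvariants Z Z' →+* R} (hg : g.comp (toBlowUpInvariants Z Z') = k) :
    ∃! f : Z.A →+* R', IsInvHom σ q f ∧ Corresponds j q f g := by
  choose! a ha using fun w (hw : w ≠ 1) => hS.generic w hw
  have hreg : ∀ b ∈ blowUpSubring Z Z', ∀ w, w ≠ 1 → ∃ h, RegMod (a w - Z'.ρ w (a w)) h ∧
      sndFrac Z Z' h * b ∈ (mulInv Z Z').range := by
    intro b hb w hw
    -- A reflection's factor is equivalent to its wall, where the local statement along the wall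
    -- applies. For the other factors a second discriminant, built from the `a'`, is regular modulo
    -- the factor.
    rcases (ha w hw).2 with ⟨i, rfl, hi⟩ | h
    · obtain ⟨h, hh, hb'⟩ := exists_regMod_wall_mul_mem_range hZ hZ' hS i hb
      refine ⟨h, hh.of_dvd_dvd ?_ hi, hb'⟩
      rw [← dvd_neg, neg_sub]
      exact hZ'.dvd_sub i _
    · choose! a' ha' using h
      refine ⟨_, RegMod.prod _ _ fun w' hw' => ha' w' (Finset.ne_of_mem_erase hw'),
        prod_mul_mem_range hZ hZ' a' hb⟩
  set G := intProductMap (j.comp g) q with hGdef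
  let i : Z'.A →+* blowUpInvariants Z Z' ⊗[ℤ] Z'.A :=
    (Algebra.TensorProduct.includeRight : Z'.A →ₐ[ℤ] _).toRingHom
  have hmi : ∀ a, mulInv Z Z' (i a) = sndFrac Z Z' a := fun a => by
    change mulInv Z Z' (1 ⊗ₜ a) = _
    rw [mulInv_tmul, Subring.coe_one, one_mul]
  have hGi : ∀ a, G (i a) = q a := fun a => by
    change G (1 ⊗ₜ a) = _
    rw [hGdef, intProductMap_tmul, map_one, one_mul]
  obtain ⟨F, hF⟩ := exists_ringHom_extension i (mulInv Z Z') G (blowUpSubring Z Z')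
    (fun a ha => by rw [hGi]; exact D.nzd a ha) (fun c hc => intProductMap_eq_zero hS D hg hc)
    (fun b hb => by
      obtain ⟨c, hc⟩ := prod_mul_mem_range hZ hZ' a hb
      obtain ⟨r, hr⟩ := exists_of_prod hS D hg (Finset.univ.erase 1) (fun w => a w - Z'.ρ w (a w)) b
        (fun w hw => (ha w (Finset.ne_of_mem_erase hw)).1)
        (fun w hw => hreg b hb w (Finset.ne_of_mem_erase hw)) c hc
      exact ⟨_, prod_sub_mem fun w hw => (ha w hw).1, c, r, by rw [hc, hmi], by rw [hr, hGi]⟩)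
  have hF₁ : F.comp (invB Z Z') = j.comp g := by
    ext x
    have := hF (invB Z Z' x) 1 (one_mem _) (x ⊗ₜ 1) (by
      rw [map_one, map_one, one_mul, mulInv_tmul, map_one, mul_one]; rfl)
    rw [hGdef, intProductMap_tmul, map_one, map_one, map_one, one_mul, mul_one] at this
    exact this.symm
  have hF₂ : F.comp (sndB Z Z') = q := by
    ext x
    have := hF (sndB Z Z' x) 1 (one_mem _) (i x) (by rw [map_one, map_one, one_mul, hmi]; rfl)
    rw [hGi, map_one, map_one, one_mul] at this
    exact this.symm
  have hF₁' : ∀ x, F (invB Z Z' x) = j (g x) := RingHom.congr_fun hF₁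
  have hF₂' : ∀ x, F (sndB Z Z' x) = q x := RingHom.congr_fun hF₂
  have hFσ : ∀ w, F.comp (diagB hZ hZ' w) = (σ w).comp F := fun w => by
    apply blowUp_hom_ext_invariants hZ hZ' hS
    · ext x
      simp [diagB_invB, hF₁', D.σ_j]
    · ext x
      simp [diagB_sndB, hF₂', D.σ_q]
    · intro x hx
      rw [RingHom.comp_apply, diagB_sndB, hF₂']
      exact D.nzd _ (ρ_mem_nonZeroDivisors w hx)
  refine ⟨F.comp (fstB Z Z'), ⟨⟨fun c => ?_, fun w x => ?_, fun n => ?_⟩, F, rfl, hF₂, hF₁⟩, ?_⟩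
  · rw [← hF₂]
    refine congrArg F (Subtype.ext ?_)
    have e : (algebraMap ℂ Z.A c ⊗ₜ 1 : Z.A ⊗[ℂ] Z'.A) = 1 ⊗ₜ algebraMap ℂ Z'.A c := by
      rw [Algebra.algebraMap_eq_smul_one (A := Z.A), Algebra.algebraMap_eq_smul_one (A := Z'.A),
        TensorProduct.smul_tmul]
    exact congrArg (algebraMap (Z.A ⊗[ℂ] Z'.A) (Frac Z Z')) e
  · have := RingHom.congr_fun (hFσ w) (fstB Z Z' x)
    rw [RingHom.comp_apply, diagB_fstB] at this
    exact this.symm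
  · obtain ⟨t, ht, e⟩ := exists_quotient Z Z' (hS.wall_mem n)
    refine ⟨F ⟨t, ht⟩, ?_⟩
    rw [← hF₂', ← map_mul]
    exact congrArg F (Subtype.ext (e.symm.trans (mul_comm _ _)))
  · rintro f' ⟨-, F', rfl, h₂, h₃⟩
    have : F' = F := by
      apply blowUp_hom_ext_invariants hZ hZ' hS (h₃.trans hF₁.symm) (h₂.trans hF₂.symm)
      intro x hx
      rw [← RingHom.comp_apply, h₂]
      exact D.nzd _ hx
    rw [this]

end Extend

end WScheme

end AffineBlowUp

end

noncomputable section

namespace AffineBlowUp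

/-! ### Lattices -/

section Lattice

variable {L : Type*} [AddCommGroup L]

/-- The elements of a lattice proportional to a given one. -/
def satSpan (ν : L) : Submodule ℤ L where
  carrier := {x | ∃ a : ℤ, a ≠ 0 ∧ ∃ b : ℤ, a • x = b • ν}
  add_mem' := by
    rintro x y ⟨a, ha, b, e⟩ ⟨c, hc, d, e'⟩
    refine ⟨a * c, mul_ne_zero ha hc, c * b + a * d, ?_⟩
    rw [smul_add, mul_comm a c, mul_smul, e, mul_comm c a, mul_smul, e', add_smul, mul_smul,
      mul_smul]
  zero_mem' := ⟨1, one_ne_zero, 0, by simp⟩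
  smul_mem' := by
    rintro n x ⟨a, ha, b, e⟩
    exact ⟨a, ha, n * b, by rw [smul_comm, e, mul_smul]⟩

lemma mem_satSpan_of_smul_mem {ν x : L} {n : ℤ} (hn : n ≠ 0) (h : n • x ∈ satSpan ν) :
    x ∈ satSpan ν := by
  obtain ⟨a, ha, b, e⟩ := h
  exact ⟨a * n, mul_ne_zero ha hn, b, by rw [mul_smul, e]⟩

lemma self_mem_satSpan (ν : L) : ν ∈ satSpan ν := ⟨1, one_ne_zero, 1, rfl⟩

/-- A lattice is not the union of finitely many proper saturated sublattices. -/
lemma exists_forall_notMem {κ : Type*} [Finite κ] (p : κ → Submodule ℤ L)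
    (hp : ∀ k x (n : ℤ), n ≠ 0 → n • x ∈ p k → x ∈ p k) (h : ∀ k, ∃ x, x ∉ p k) :
    ∃ x, ∀ k, x ∉ p k := by
  have := Fintype.ofFinite κ
  by_contra! H
  obtain ⟨k, -, hk⟩ := Submodule.exists_finiteIndex_of_cover (p := p) (s := Finset.univ)
    (by ext x; simpa using H x)
  obtain ⟨x, hx⟩ := h k
  refine hx (hp k x (p k).toAddSubgroup.index (by exact_mod_cast hk.index_ne_zero) ?_)
  rw [natCast_zsmul]
  exact (p k).toAddSubgroup.nsmul_index_mem x

variable [Module.Free ℤ L]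

lemma exists_dual_of_notMem_satSpan {ν x : L} (hx : x ∉ satSpan ν) :
    ∃ f : L →ₗ[ℤ] ℤ, f ν = 0 ∧ f x ≠ 0 := by
  rcases eq_or_ne ν 0 with rfl | hν
  · have hx0 : x ≠ 0 := fun h => hx (by rw [h]; exact zero_mem _)
    by_contra! H
    exact hx0 ((Module.forall_dual_apply_eq_zero_iff ℤ x).1 fun f => H f (map_zero f))
  · obtain ⟨g, hg⟩ : ∃ g : L →ₗ[ℤ] ℤ, g ν ≠ 0 := by
      by_contra! H
      exact hν ((Module.forall_dual_apply_eq_zero_iff ℤ ν).1 H)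
    have hy : g ν • x - g x • ν ≠ 0 := fun h => hx ⟨_, hg, _, sub_eq_zero.1 h⟩
    obtain ⟨h, hh⟩ : ∃ h : L →ₗ[ℤ] ℤ, h (g ν • x - g x • ν) ≠ 0 := by
      by_contra! H
      exact hy ((Module.forall_dual_apply_eq_zero_iff ℤ _).1 H)
    -- This functional vanishes on `ν` by construction, and its value at `x` is that of `h` on `g ν
    -- • x - g x • ν`.
    refine ⟨g ν • h - h ν • g, ?_, ?_⟩
    · simp [mul_comm]
    · intro e
      apply hh
      simp only [LinearMap.sub_apply, LinearMap.smul_apply, smul_eq_mul] at e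
      simp only [map_sub, map_smul, smul_eq_mul]
      linarith

lemma exists_dual_forall_of_notMem_satSpan [Module.Finite ℤ L] {κ : Type*} [Finite κ] (ν : L) (x : κ → L)
    (hx : ∀ k, x k ∉ satSpan ν) : ∃ f : L →ₗ[ℤ] ℤ, f ν = 0 ∧ ∀ k, f (x k) ≠ 0 := by
  let D : Submodule ℤ (L →ₗ[ℤ] ℤ) := LinearMap.ker (LinearMap.applyₗ ν)
  let p : κ → Submodule ℤ D := fun k => LinearMap.ker ((LinearMap.applyₗ (x k)).comp D.subtype)
  obtain ⟨f, hf⟩ := exists_forall_notMem p (fun k f n hn h => by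
    simp only [p, LinearMap.mem_ker, map_smul] at h ⊢
    exact (smul_eq_zero.1 h).resolve_left hn) (fun k => by
    obtain ⟨f, hf, hf'⟩ := exists_dual_of_notMem_satSpan (hx k)
    exact ⟨⟨f, hf⟩, hf'⟩)
  exact ⟨f, f.2, hf⟩

end Lattice

/-! ### Weyl group elements, reflections, and the determinant. -/

section Weyl

variable {ι X Y : Type} [AddCommGroup X] [AddCommGroup Y] (P : RootPairing ι ℤ X Y)

/-- The reflection in the Weyl group attached to a root. -/
abbrev simpleRefl (i : ι) : P.weylGroup := RootPairing.weylGroup.ofIdx P i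

/-- The action of the Weyl group on the indices of roots. -/
def idxAct (w : P.weylGroup) (i : ι) : ι := P.weylGroupToPerm w i

lemma weylX_simpleRefl (i : ι) (x : X) :
    weylX P (simpleRefl P i) x = x - P.toLinearMap x (P.coroot i) • P.root i := rfl

lemma weylX_root (w : P.weylGroup) (i : ι) : weylX P w (P.root i) = P.root (idxAct P w i) :=
  RootPairing.Hom.root_weightMap_apply _ _ _ _

lemma weylY_coroot (w : P.weylGroup) (i : ι) :
    weylY P w (P.coroot i) = P.coroot (idxAct P w i) :=
  RootPairing.Hom.coroot_coweightMap_apply P P i ((w : P.Aut)⁻¹).toHom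

lemma weylY_simpleRefl (i : ι) (y : Y) :
    weylY P (simpleRefl P i) y = y - P.toLinearMap (P.root i) y • P.coroot i := by
  change RootPairing.Equiv.coweightEquiv P P (RootPairing.Equiv.reflection P i)⁻¹ y = _
  rw [RootPairing.Equiv.reflection_inv]
  rfl

lemma idxAct_simpleRefl_self (i : ι) : P.root (idxAct P (simpleRefl P i) i) = -P.root i := by
  rw [← weylX_root, weylX_simpleRefl, P.root_coroot_two, two_smul]
  abel

lemma simpleRefl_mul_self (i : ι) : simpleRefl P i * simpleRefl P i = 1 := by
  apply Subtype.ext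
  change RootPairing.Equiv.reflection P i * RootPairing.Equiv.reflection P i = 1
  rw [mul_eq_one_iff_inv_eq, RootPairing.Equiv.reflection_inv]

lemma eq_one_of_weylX {w : P.weylGroup} (h : ∀ x, weylX P w x = x) : w = 1 := by
  apply Subtype.ext
  apply RootPairing.Equiv.weightHom_injective P
  ext x
  simpa using! h x

/-- Coroots span `Y`, so an element is determined by its permutation of the finite set of coroots.
-/
lemma finite_weylGroup [Finite ι] (hP : IsSimplyConnected P) : Finite P.weylGroup := by
  apply Finite.of_injective (fun w => (P.weylGroupToPerm w : ι ≃ ι))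
  intro v w h
  have h' : ∀ i, idxAct P v i = idxAct P w i := fun i => Equiv.congr_fun h i
  have key : weylY P v = weylY P w := by
    apply LinearEquiv.toLinearMap_injective
    apply LinearMap.ext_on_range hP
    intro i
    change weylY P v (P.coroot i) = weylY P w (P.coroot i)
    rw [weylY_coroot, weylY_coroot, h']
  apply Subtype.ext
  apply inv_injective
  apply RootPairing.Equiv.coweightHom_injective P
  exact MulOpposite.unop_injective key

lemma root_eq_or_eq_neg [P.IsReduced] {i j : ι} (h : P.root j ∈ satSpan (P.root i)) :
    P.root j = P.root i ∨ P.root j = -P.root i := by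
  apply RootPairing.IsReduced.eq_or_eq_neg (P := P)
  obtain ⟨a, ha, b, e⟩ := h
  rw [LinearIndependent.pair_iff]
  intro H
  exact ha (H a (-b) (by rw [e, neg_smul, add_neg_cancel])).1

/-- The product of the values of a functional on the positive roots is multiplied by `-1` when
the functional is composed with a reflection. -/
lemma prod_reflection [P.IsReduced] [Fintype ι] (p : Finset ι)
    (hp : ∀ i, i ∈ p ↔ idxAct P (simpleRefl P i) i ∉ p) (i : ι) (f : X →ₗ[ℤ] ℤ) :
    ∏ j ∈ p, f (weylX P (simpleRefl P i) (P.root j)) = -∏ j ∈ p, f (P.root j) := by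
  classical
  let neg : ι → ι := fun j => idxAct P (simpleRefl P j) j
  have hneg : ∀ j, P.root (neg j) = -P.root j := idxAct_simpleRefl_self P
  have hnn : ∀ j, neg (neg j) = j := fun j => P.root.injective (by rw [hneg, hneg, neg_neg])
  let σ : ι → ι := idxAct P (simpleRefl P i)
  have hσ : ∀ j, P.root (σ j) = weylX P (simpleRefl P i) (P.root j) := fun j =>
    (weylX_root P _ j).symm
  have hσσ : ∀ j, σ (σ j) = j := fun j => P.root.injective (by
    rw [hσ, hσ]
    change (weylX P (simpleRefl P i) * weylX P (simpleRefl P i)) _ = _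
    rw [← map_mul, simpleRefl_mul_self, map_one]; rfl)
  have hσn : ∀ j, σ (neg j) = neg (σ j) := fun j => P.root.injective (by
    rw [hσ, hneg, hneg, map_neg, hσ])
  -- The reflection `σ` followed by the choice of sign that returns to `p`; `ε` records the sign. On
  -- `p` the map `τ` is an involution preserving `ε`.
  let τ : ι → ι := fun j => if σ j ∈ p then σ j else neg (σ j)
  let ε : ι → ℤ := fun j => if σ j ∈ p then 1 else -1
  have hτ : ∀ j, f (weylX P (simpleRefl P i) (P.root j)) = ε j * f (P.root (τ j)) := fun j => by
    rw [← hσ]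
    by_cases h : σ j ∈ p
    · simp [ε, τ, h]
    · simp [ε, τ, h, hneg]
  have hτp : ∀ j ∈ p, τ j ∈ p := fun j _ => by
    by_cases h : σ j ∈ p
    · simp [τ, h]
    · simp only [τ, h, if_false]
      by_contra h'
      exact h ((hp _).2 h')
  have hττ : ∀ j ∈ p, τ (τ j) = j := fun j hj => by
    by_cases h : σ j ∈ p
    · simp [τ, h, hσσ, hj]
    · have : neg j ∉ p := (hp j).1 hj
      simp [τ, h, hσn, hσσ, this, hnn]
  have hετ : ∀ j ∈ p, ε (τ j) = ε j := fun j hj => by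
    by_cases h : σ j ∈ p
    · simp [ε, τ, h, hσσ, hj]
    · have : neg j ∉ p := (hp j).1 hj
      simp [ε, τ, h, hσn, hσσ, this]
  obtain ⟨i₀, hi₀, hi₀'⟩ : ∃ i₀ ∈ p, i₀ = i ∨ i₀ = neg i := by
    by_cases h : i ∈ p
    · exact ⟨i, h, Or.inl rfl⟩
    · refine ⟨neg i, ?_, Or.inr rfl⟩
      by_contra h'
      exact h ((hp i).2 h')
  have hσi : σ i = neg i := rfl
  have hσi₀ : σ i₀ = neg i₀ := by
    rcases hi₀' with rfl | rfl
    · rfl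
    · rw [hσn, hσi]
  have hε₀ : ε i₀ = -1 := by
    have : neg i₀ ∉ p := (hp i₀).1 hi₀
    simp [ε, hσi₀, this]
  have hτ₀ : τ i₀ = i₀ := by
    have : neg i₀ ∉ p := (hp i₀).1 hi₀
    simp [τ, hσi₀, this, hnn]
  -- A fixed point of `τ` with sign `-1` is a root negated by the reflection, hence `± root i`. All
  -- other signs `-1` cancel in pairs, leaving exactly one.
  have hfix : ∀ j ∈ p, j ≠ i₀ → ε j ≠ 1 → τ j ≠ j := by
    intro j hj hj₀ hε h
    have hj' : σ j ∉ p := fun h' => hε (by simp [ε, h'])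
    simp only [τ, hj', if_false] at h
    have h₁ : P.root (σ j) = -P.root j := by rw [← hneg, ← hnn (σ j), h]
    rw [hσ, weylX_simpleRefl] at h₁
    have h₂ : P.root j ∈ satSpan (P.root i) :=
      ⟨2, two_ne_zero, P.toLinearMap (P.root j) (P.coroot i), by
        rw [two_smul, eq_comm, ← sub_eq_zero]
        rw [← sub_eq_zero] at h₁
        rw [← neg_eq_zero, ← h₁]
        abel⟩
    have h₃ : j = i ∨ j = neg i := by
      rcases root_eq_or_eq_neg P h₂ with e | e
      · exact Or.inl (P.root.injective e)
      · exact Or.inr (P.root.injective (e.trans (hneg i).symm))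
    have hip := hp i
    have hnip := hp (neg i)
    have e : idxAct P (simpleRefl P (neg i)) (neg i) = i := hnn i
    rw [e] at hnip
    change i ∈ p ↔ neg i ∉ p at hip
    rcases h₃ with rfl | rfl <;> rcases hi₀' with rfl | rfl
    · exact hj₀ rfl
    · exact hip.1 hj hi₀
    · exact hip.1 hi₀ hj
    · exact hj₀ rfl
  have hprod : ∏ j ∈ p, ε j = -1 := by
    rw [← Finset.mul_prod_erase p ε hi₀, hε₀]
    have : ∏ j ∈ p.erase i₀, ε j = 1 := by
      refine Finset.prod_involution (fun j _ => τ j) ?_ ?_ ?_ ?_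
      · intro j hj
        rw [hετ j (Finset.mem_of_mem_erase hj)]
        by_cases h : σ j ∈ p <;> simp [ε, h]
      · intro j hj h
        exact hfix j (Finset.mem_of_mem_erase hj) (Finset.ne_of_mem_erase hj) h
      · intro j hj
        refine Finset.mem_erase.2 ⟨fun h => ?_, hτp j (Finset.mem_of_mem_erase hj)⟩
        have := hττ j (Finset.mem_of_mem_erase hj)
        rw [h, hτ₀] at this
        exact Finset.ne_of_mem_erase hj this.symm
      · intro j hj
        exact hττ j (Finset.mem_of_mem_erase hj)
    rw [this, mul_one]
  calc ∏ j ∈ p, f (weylX P (simpleRefl P i) (P.root j)) = ∏ j ∈ p, ε j * f (P.root (τ j)) :=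
        Finset.prod_congr rfl fun j _ => hτ j
    _ = -∏ j ∈ p, f (P.root (τ j)) := by rw [Finset.prod_mul_distrib, hprod, neg_one_mul]
    _ = -∏ j ∈ p, f (P.root j) := by
        congr 1
        exact Finset.prod_nbij' τ τ hτp hτp hττ hττ fun _ _ => rfl

variable [Module.Free ℤ X]

/-- An element of finite order which is unipotent is trivial. -/
lemma eq_one_of_unipotent [Finite P.weylGroup] {w : P.weylGroup} {ν : X} (hν : weylX P w ν = ν)
    (h : ∀ x, x - weylX P w x ∈ satSpan ν) : w = 1 := by
  apply eq_one_of_weylX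
  intro x
  set d := x - weylX P w x with hd
  have hwd : weylX P w d = d := by
    obtain ⟨a, ha, b, e⟩ := h x
    apply smul_right_injective X ha
    change a • weylX P w d = a • d
    rw [← map_smul, e, map_smul, hν]
  -- Since `w` fixes `d`, its powers translate `x` by multiples of `d`; finite order then makes `d`
  -- torsion, hence zero.
  have hn : ∀ n : ℕ, weylX P (w ^ n) x = x - (n : ℤ) • d := fun n => by
    induction n with
    | zero => simp
    | succ n ih =>
      rw [pow_succ', map_mul]
      change weylX P w (weylX P (w ^ n) x) = _
      rw [ih, map_sub, map_smul, hwd]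
      have : weylX P w x = x - d := by rw [hd]; abel
      rw [this]
      push_cast
      rw [add_smul, one_smul]
      abel
  have h₀ := hn (orderOf w)
  rw [pow_orderOf_eq_one, map_one] at h₀
  have h₁ : ((orderOf w : ℕ) : ℤ) • d = 0 := by
    have : x = x - ((orderOf w : ℕ) : ℤ) • d := h₀
    exact sub_eq_self.1 this.symm
  have h₂ := (smul_eq_zero.1 h₁).resolve_left (by exact_mod_cast (orderOf_pos w).ne')
  exact (sub_eq_zero.1 h₂).symm

/-- A Weyl group element acting trivially modulo a root is trivial or the reflection in the root. -/
lemma eq_one_or_eq_simpleRefl [Finite P.weylGroup] [P.IsReduced] {w : P.weylGroup} {i : ι}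
    (h : ∀ x, x - weylX P w x ∈ satSpan (P.root i)) : w = 1 ∨ w = simpleRefl P i := by
  have h₁ : P.root (idxAct P w i) ∈ satSpan (P.root i) := by
    rw [← weylX_root, ← sub_sub_cancel (P.root i) (weylX P w (P.root i))]
    exact sub_mem (self_mem_satSpan _) (h _)
  rcases root_eq_or_eq_neg P h₁ with e | e
  · rw [← weylX_root] at e
    exact Or.inl (eq_one_of_unipotent P e h)
  · rw [← weylX_root] at e
    right
    have hmul : ∀ x, weylX P (simpleRefl P i * w) x = weylX P (simpleRefl P i) (weylX P w x) :=
      fun x => by rw [map_mul]; rfl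
    have : simpleRefl P i * w = 1 := by
      apply eq_one_of_unipotent P (ν := P.root i)
      · rw [hmul, e, map_neg, weylX_root, idxAct_simpleRefl_self, neg_neg]
      · intro x
        rw [hmul, weylX_simpleRefl, ← sub_add]
        exact add_mem (h x) (Submodule.smul_mem _ _ (self_mem_satSpan _))
    rw [← mul_one (simpleRefl P i), ← this, ← mul_assoc, simpleRefl_mul_self, one_mul]

/-- Away from the identity and a given reflection, some `x - w x` is not proportional to the
root. -/
lemma exists_notMem_satSpan_root [Finite P.weylGroup] [P.IsReduced] {w : P.weylGroup} {i : ι}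
    (hw : w ≠ 1) (hw' : w ≠ simpleRefl P i) : ∃ x, x - weylX P w x ∉ satSpan (P.root i) := by
  by_contra! H
  rcases eq_one_or_eq_simpleRefl P H with h | h
  · exact hw h
  · exact hw' h

open IsAddIndecomposable in
/-- For a simply connected root datum, every coroot takes the value `1` on the character lattice. -/
lemma exists_pairing_eq_one [Finite ι] [P.IsReduced] [Module.Free ℤ Y] [Module.Finite ℤ Y]
    (hP : IsSimplyConnected P) (i : ι) : ∃ x, P.toLinearMap x (P.coroot i) = 1 := by
  classical
  have := Fintype.ofFinite ι
  have hred : ∀ j : {j // P.coroot j ∉ satSpan (P.coroot i)}, P.coroot j ∉ satSpan (P.coroot i) :=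
    fun j => j.2
  obtain ⟨f₀, h₀, h₀'⟩ := exists_dual_forall_of_notMem_satSpan (P.coroot i) _ hred
  have hpm : ∀ j, P.coroot j ∈ satSpan (P.coroot i) →
      P.coroot j = P.coroot i ∨ P.coroot j = -P.coroot i := fun j hj =>
    root_eq_or_eq_neg P.flip hj
  set N : ℤ := 3 + ∑ j, |P.toLinearMap (P.root i) (P.coroot j)| with hN
  have hNj : ∀ j, 3 + |P.toLinearMap (P.root i) (P.coroot j)| ≤ N := fun j => by
    have := Finset.single_le_sum (f := fun j => |P.toLinearMap (P.root i) (P.coroot j)|)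
      (fun j _ => abs_nonneg _) (Finset.mem_univ j)
    lia
  -- A perturbation of a large multiple of `f₀`. It takes the value `2` on `coroot i` and absolute
  -- values at least `3` on coroots other than `± coroot i`. A sum of two positive coroots thus has
  -- value at least `4`, so `coroot i` is indecomposable and belongs to the base defined by `f`.
  let f : Module.Dual ℤ Y := N • f₀ + P.toLinearMap (P.root i)
  have hfi : f (P.coroot i) = 2 := by simp [f, h₀]
  have hfj : ∀ j, P.coroot j ∉ satSpan (P.coroot i) → 3 ≤ |f (P.coroot j)| := fun j hj => by
    have h₁ := h₀' ⟨j, hj⟩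
    have h₂ := hNj j
    have h₃ : 1 ≤ |f₀ (P.coroot j)| := Int.one_le_abs h₁
    have h₄ : N * 1 ≤ N * |f₀ (P.coroot j)| :=
      mul_le_mul_of_nonneg_left h₃ (by have := abs_nonneg (P.toLinearMap (P.root i) (P.coroot j)); lia)
    have h₅ : |N * f₀ (P.coroot j)| = N * |f₀ (P.coroot j)| := by
      rw [abs_mul, abs_of_nonneg]
      have := abs_nonneg (P.toLinearMap (P.root i) (P.coroot j)); lia
    have h₆ := abs_sub_abs_le_abs_sub (N * f₀ (P.coroot j))
      (-(P.toLinearMap (P.root i) (P.coroot j)))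
    rw [abs_neg, sub_neg_eq_add] at h₆
    change 3 ≤ |N * f₀ (P.coroot j) + P.toLinearMap (P.root i) (P.coroot j)|
    lia
  have hfge : ∀ j, 0 < f (P.coroot j) → 2 ≤ f (P.coroot j) := fun j hj => by
    by_cases h : P.coroot j ∈ satSpan (P.coroot i)
    · rcases hpm j h with e | e
      · rw [e, hfi]
      · rw [e, map_neg, hfi] at hj
        lia
    · have := hfj j h
      rw [abs_of_pos hj] at this
      lia
  have hf0 : ∀ j, f (P.flip.root j) ≠ 0 := fun j => by
    change f (P.coroot j) ≠ 0
    intro h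
    by_cases h' : P.coroot j ∈ satSpan (P.coroot i)
    · rcases hpm j h' with e | e
      · rw [e, hfi] at h; lia
      · rw [e, map_neg, hfi] at h; lia
    · have := hfj j h'
      rw [h] at this
      simp at this
  have hi : i ∈ baseOf P.flip.root (f : Y →+ ℤ) := by
    refine ⟨?_, ?_⟩
    · change 0 < f (P.coroot i)
      rw [hfi]; norm_num
    · intro j hj k hk e
      exfalso
      have h₁ := congrArg f e
      rw [map_add] at h₁
      change f (P.coroot i) = f (P.coroot j) + f (P.coroot k) at h₁
      have h₂ := hfge j hj
      have h₃ := hfge k hk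
      rw [hfi] at h₁
      lia
  -- The base is independent and spans the lattice of coroots, which is all of `Y`. It is thus a
  -- `ℤ`-basis, and perfectness of the pairing represents the coordinate at `coroot i` by an element
  -- of `X`.
  have hli := P.flip.linearIndepOn_root_baseOf' (S := ℤ) f hf0
  let _ := P.flip.indexNeg
  have hspan : Submodule.span ℤ (Set.range fun j : baseOf P.flip.root (f : Y →+ ℤ) =>
      P.flip.root j) = ⊤ := by
    rw [← Set.image_eq_range, ← Submodule.toAddSubgroup_inj, Submodule.span_int_eq_addSubgroupClosure,
      AddSubgroup.closure_image_isAddIndecomposable_baseOf P.flip.root (by simp) (f : Y →+ ℤ)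
        (by simpa using hf0),
      ← Submodule.span_int_eq_addSubgroupClosure]
    exact congrArg Submodule.toAddSubgroup hP
  let B : Module.Basis _ ℤ Y := Module.Basis.mk hli hspan.ge
  obtain ⟨x, hx⟩ := P.toPerfPair.surjective (B.coord ⟨i, hi⟩)
  refine ⟨x, ?_⟩
  have h₁ := congrArg (fun g : Module.Dual ℤ Y => g (P.coroot i)) hx
  have h₂ : P.coroot i = B ⟨i, hi⟩ := (Module.Basis.mk_apply hli hspan.ge ⟨i, hi⟩).symm
  refine h₁.trans ?_
  rw [h₂]
  simp

variable [Module.Finite ℤ X]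

/-- The product of the values of a functional on the positive roots is multiplied by the determinant
when the functional is composed with a Weyl group element. -/
lemma prod_weyl [P.IsReduced] [Fintype ι] (p : Finset ι)
    (hp : ∀ i, i ∈ p ↔ idxAct P (simpleRefl P i) i ∉ p) (w : P.weylGroup) :
    ∀ f : X →ₗ[ℤ] ℤ, ∏ j ∈ p, f (weylX P w (P.root j)) =
      LinearMap.det (weylX P w : X →ₗ[ℤ] X) * ∏ j ∈ p, f (P.root j) := by
  obtain ⟨w, hw⟩ := w
  induction hw using RootPairing.weylGroup.induction with
  | mem i =>
    intro f
    have h₁ : (weylX P (simpleRefl P i) : X →ₗ[ℤ] X) =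
        LinearMap.transvection (-(P.toLinearMap.flip (P.coroot i))) (P.root i) := by
      ext x
      simp [weylX_simpleRefl, LinearMap.transvection.apply, sub_eq_add_neg]
    have h₂ : LinearMap.det (weylX P (simpleRefl P i) : X →ₗ[ℤ] X) = -1 := by
      rw [h₁, LinearMap.transvection.det, LinearMap.neg_apply, LinearMap.flip_apply,
        P.root_coroot_two]
      norm_num
    change ∏ j ∈ p, f (weylX P (simpleRefl P i) (P.root j)) = LinearMap.det
      (weylX P (simpleRefl P i) : X →ₗ[ℤ] X) * _
    rw [h₂, prod_reflection P p hp, neg_one_mul]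
  | one =>
    intro f
    change ∏ j ∈ p, f (weylX P 1 (P.root j)) = LinearMap.det (weylX P 1 : X →ₗ[ℤ] X) * _
    rw [map_one]
    change _ = LinearMap.det (LinearMap.id : X →ₗ[ℤ] X) * _
    rw [LinearMap.det_id, one_mul]
    rfl
  | mul x y hx hy ihx ihy =>
    intro f
    generalize hu : (⟨x, hx⟩ : P.weylGroup) = u at ihx
    generalize hv : (⟨y, hy⟩ : P.weylGroup) = v at ihy
    have hm : (⟨x * y, mul_mem hx hy⟩ : P.weylGroup) = u * v := by rw [← hu, ← hv]; rfl
    have h : (weylX P (u * v) : X →ₗ[ℤ] X) =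
        (weylX P u : X →ₗ[ℤ] X).comp (weylX P v : X →ₗ[ℤ] X) := by rw [map_mul]; rfl
    rw [hm, h, LinearMap.det_comp, mul_right_comm, mul_comm _ (∏ j ∈ p, _),
      mul_comm (∏ j ∈ p, _) _, ← ihx f]
    have h₁ := ihy (f.comp (weylX P u : X →ₗ[ℤ] X))
    simp only [LinearMap.comp_apply, LinearEquiv.coe_coe] at h₁
    rw [mul_comm, ← h₁, map_mul]
    rfl

/-- A reflection in the Weyl group is the reflection in a root. -/
lemma exists_mem_satSpan_of_reflection [Finite ι] [Finite P.weylGroup] [P.IsReduced]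
    {w : P.weylGroup} (hw : w ≠ 1) {ν : X} (hν : ν ≠ 0) (h : ∀ x, x - weylX P w x ∈ satSpan ν) :
    ∃ i, P.root i ∈ satSpan ν := by
  classical
  have := Fintype.ofFinite ι
  by_contra! H
  obtain ⟨f, hf, hf'⟩ := exists_dual_forall_of_notMem_satSpan ν P.root H
  have hfw : ∀ x, f (weylX P w x) = f x := fun x => by
    obtain ⟨a, ha, b, e⟩ := h x
    have h₁ := congrArg f e
    rw [map_smul, map_smul, hf, smul_zero, smul_eq_zero, map_sub] at h₁
    exact (sub_eq_zero.1 (h₁.resolve_left ha)).symm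
  have h₁ := prod_weyl P (Finset.univ.filter fun i => 0 < f (P.root i)) (fun i => by
    have := hf' i
    simp only [Finset.mem_filter, Finset.mem_univ, true_and, idxAct_simpleRefl_self, map_neg]
    lia) w f
  simp only [hfw] at h₁
  -- As `f` is unchanged by `w`, both products in `prod_weyl` coincide, and they are nonzero by the
  -- choice of `f`.
  have hdet : LinearMap.det (weylX P w : X →ₗ[ℤ] X) = 1 := by
    refine (mul_right_cancel₀ ?_ (h₁.symm.trans (one_mul _).symm))
    exact Finset.prod_ne_zero_iff.2 fun i _ => hf' i
  -- over `ℚ`, the element `w` is a transvection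
  obtain ⟨g, hg⟩ : ∃ g : X →ₗ[ℤ] ℤ, g ν ≠ 0 := by
    by_contra! H
    exact hν ((Module.forall_dual_apply_eq_zero_iff ℤ ν).1 H)
  have hgw : ∀ x, g ν • (x - weylX P w x) = g (x - weylX P w x) • ν := fun x => by
    obtain ⟨a, ha, b, e⟩ := h x
    apply smul_right_injective X ha
    have h₁ := congrArg g e
    simp only [map_smul, smul_eq_mul] at h₁
    change a • g ν • _ = a • g _ • ν
    rw [smul_comm, e, ← mul_smul, ← mul_smul, h₁, mul_comm]
  let φ : X →ₗ[ℤ] ℤ := g.comp ((weylX P w : X →ₗ[ℤ] X) - LinearMap.id)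
  have hgν : (g ν : ℚ) ≠ 0 := by exact_mod_cast hg
  have hφ : (weylX P w : X →ₗ[ℤ] X).baseChange ℚ = LinearMap.transvection
      ((g ν : ℚ)⁻¹ • Module.Dual.baseChange ℚ φ) (1 ⊗ₜ ν) := by
    ext x
    have h₂ : (1 : ℚ) ⊗ₜ[ℤ] (weylX P w x - x) = ((g ν : ℚ)⁻¹ * φ x) • ((1 : ℚ) ⊗ₜ[ℤ] ν) := by
      have h₃ : g ν • (weylX P w x - x) = φ x • ν := by
        have := hgw x
        rw [← neg_sub (weylX P w x) x, smul_neg, map_neg, neg_smul, neg_inj] at this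
        exact this
      rw [mul_smul, eq_inv_smul_iff₀ hgν, Int.cast_smul_eq_zsmul, Int.cast_smul_eq_zsmul,
        ← TensorProduct.tmul_smul, ← TensorProduct.tmul_smul, h₃]
    have h₄ : weylX P w x = x + (weylX P w x - x) := by abel
    simp only [TensorProduct.AlgebraTensorModule.curry_apply, TensorProduct.curry_apply, LinearMap.coe_restrictScalars,
      LinearMap.baseChange_tmul, LinearEquiv.coe_coe, LinearMap.transvection.apply,
      LinearMap.smul_apply]
    rw [h₄, TensorProduct.tmul_add, h₂]
    simp
  -- The determinant of `x ↦ x + l(x) ν` is `1 + l(ν)`. Being `1`, it forces `w ν = ν`, so `w` is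
  -- unipotent of finite order.
  have h₂ := congrArg LinearMap.det hφ
  rw [LinearMap.det_baseChange, hdet, LinearMap.transvection.det] at h₂
  have h₃ : φ ν = 0 := by
    simpa [hg] using h₂
  refine hw (eq_one_of_unipotent P ?_ h)
  have h₄ := hgw ν
  have h₅ : g (ν - weylX P w ν) = 0 := by
    rw [← neg_sub, map_neg, neg_eq_zero]
    exact h₃
  rw [h₅, zero_smul] at h₄
  exact (sub_eq_zero.1 ((smul_eq_zero.1 h₄).resolve_left hg)).symm

/-- For a Weyl group element which is not a reflection, some `x - w x` is not proportional to any
root. -/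
lemma exists_generic [Finite ι] [Finite P.weylGroup] [P.IsReduced] {w : P.weylGroup} (hw : w ≠ 1)
    (hw' : ∀ i, w ≠ simpleRefl P i) :
    ∃ x, (∀ w' : P.weylGroup, w' ≠ 1 → ∃ x', x' - weylX P w' x' ∉ satSpan (x - weylX P w x)) ∧
      x - weylX P w x ≠ 0 := by
  -- The extra index `none` stands for the zero vector, so that avoiding its span makes `x - w x`
  -- nonzero.
  let ν : Option ι → X := fun o => o.elim 0 P.root
  let p : Option ι → Submodule ℤ X := fun o =>
    (satSpan (ν o)).comap (LinearMap.id - (weylX P w : X →ₗ[ℤ] X))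
  obtain ⟨x, hx⟩ := exists_forall_notMem p (fun k x n hn h => by
    refine mem_satSpan_of_smul_mem hn ?_
    rw [← map_smul]
    exact h) (fun o => by
    by_contra! H
    rcases o with _ | i
    · refine hw (eq_one_of_weylX P fun x => ?_)
      obtain ⟨a, ha, b, e⟩ : x - weylX P w x ∈ satSpan (0 : X) := H x
      rw [smul_zero] at e
      exact (sub_eq_zero.1 ((smul_eq_zero.1 e).resolve_left ha)).symm
    · rcases eq_one_or_eq_simpleRefl P (i := i) H with h | h
      · exact hw h
      · exact hw' i h)
  have hx0 : x - weylX P w x ≠ 0 := fun h => hx none (by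
    change x - weylX P w x ∈ satSpan (0 : X)
    rw [h]
    exact zero_mem _)
  refine ⟨x, fun w' hw₁ => ?_, hx0⟩
  by_contra! H
  obtain ⟨i, a, ha, b, e⟩ := exists_mem_satSpan_of_reflection P hw₁ hx0 H
  refine hx (some i) ⟨b, ?_, a, e.symm⟩
  rintro rfl
  rw [zero_smul] at e
  exact P.ne_zero i ((smul_eq_zero.1 e).resolve_left ha)

end Weyl

end AffineBlowUp

end

noncomputable section

namespace AffineBlowUp

open scoped nonZeroDivisors

/-! ### Group algebras -/

section GroupAlgebra

variable {M : Type*} [AddCommGroup M]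

local notation "𝐞" μ:max => AddMonoidAlgebra.single μ (1 : ℂ)

lemma single_one_mul (μ ν : M) : 𝐞 μ * 𝐞 ν = 𝐞 (μ + ν) := by
  rw [AddMonoidAlgebra.single_mul_single, one_mul]

lemma single_one_zero : 𝐞 (0 : M) = 1 := rfl

lemma isUnit_single_one (μ : M) : IsUnit (𝐞 μ) :=
  IsUnit.of_mul_eq_one (𝐞 (-μ)) (by rw [single_one_mul, add_neg_cancel, single_one_zero])

/-- `e ^ ν - 1` divides `e ^ (n ν) - 1`. -/
lemma single_sub_one_dvd {ν μ : M} (h : μ ∈ AddSubgroup.zmultiples ν) : 𝐞 ν - 1 ∣ 𝐞 μ - 1 := by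
  let H : AddSubgroup M :=
    { carrier := {μ | 𝐞 ν - 1 ∣ 𝐞 μ - 1}
      zero_mem' := by simp [single_one_zero]
      add_mem' := fun {a b} ha hb => by
        have : 𝐞 (a + b) - 1 = 𝐞 a * (𝐞 b - 1) + (𝐞 a - 1) := by
          rw [mul_sub, single_one_mul]; ring
        simp only [Set.mem_ofPred_eq] at *
        rw [this]
        exact (hb.mul_left _).add ha
      neg_mem' := fun {a} ha => by
        have : 𝐞 (-a) - 1 = -(𝐞 (-a) * (𝐞 a - 1)) := by
          rw [mul_sub, single_one_mul, neg_add_cancel, single_one_zero]; ring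
        simp only [Set.mem_ofPred_eq] at *
        rw [this]
        exact (ha.mul_left _).neg_right }
  have : AddSubgroup.zmultiples ν ≤ H := by
    rw [AddSubgroup.zmultiples_le]
    exact dvd_refl _
  exact this h

lemma single_sub_one_dvd_sub {ν μ μ' : M} (h : μ - μ' ∈ AddSubgroup.zmultiples ν) :
    𝐞 ν - 1 ∣ 𝐞 μ - 𝐞 μ' := by
  have : 𝐞 μ - 𝐞 μ' = 𝐞 μ' * (𝐞 (μ - μ') - 1) := by
    rw [mul_sub, single_one_mul, add_sub_cancel, mul_one]
  rw [this]
  exact (single_sub_one_dvd h).mul_left _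

/-- The coefficients of an element killed by `e^ν - 1` are invariant under translation by `ν`, which
has infinite order; finite support leaves only zero. -/
lemma single_sub_one_mem {ν : M} (hν : ∀ n : ℤ, n • ν = 0 → n = 0) :
    𝐞 ν - 1 ∈ (AddMonoidAlgebra ℂ M)⁰ := by
  rw [mem_nonZeroDivisors_iff_right]
  intro r hr
  rw [mul_sub, mul_one, sub_eq_zero] at hr
  have h₁ : ∀ μ, r.coeff (μ + ν) = r.coeff μ := fun μ => by
    conv_lhs => rw [← hr]
    simp
  have h₂ : ∀ (μ) (n : ℕ), r.coeff (μ + n • ν) = r.coeff μ := fun μ n => by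
    induction n with
    | zero => simp
    | succ n ih => rw [succ_nsmul, ← add_assoc, h₁, ih]
  ext μ
  by_contra h
  refine Set.infinite_of_injective_forall_mem (f := fun n : ℕ => μ + n • ν) ?_ (s := r.coeff.support)
    (fun n => ?_) r.coeff.support.finite_toSet
  · intro m n e
    have := hν (m - n) (by
      simp only [add_right_inj] at e
      rw [sub_smul, natCast_zsmul, natCast_zsmul, e, sub_self])
    lia
  · simpa [h₂] using h

/-- The kernel of `ℂ[M] → ℂ[M / ℤ ν]` is generated by `e ^ ν - 1`. -/
lemma single_sub_one_dvd_of_mapDomain {ν : M} {r : AddMonoidAlgebra ℂ M}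
    (h : AddMonoidAlgebra.mapDomain (QuotientAddGroup.mk' (AddSubgroup.zmultiples ν)) r = 0) :
    𝐞 ν - 1 ∣ r := by
  let s : M ⧸ AddSubgroup.zmultiples ν → M := Quotient.out
  have key : ∀ r : AddMonoidAlgebra ℂ M, 𝐞 ν - 1 ∣ r - AddMonoidAlgebra.mapDomain s
      (AddMonoidAlgebra.mapDomain (QuotientAddGroup.mk' (AddSubgroup.zmultiples ν)) r) := fun r => by
    induction r using AddMonoidAlgebra.induction_linear with
    | zero => simp
    | add x y hx hy =>
      rw [AddMonoidAlgebra.mapDomain_add, AddMonoidAlgebra.mapDomain_add, add_sub_add_comm]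
      exact hx.add hy
    | single μ c =>
      rw [AddMonoidAlgebra.mapDomain_single, AddMonoidAlgebra.mapDomain_single]
      have hd : 𝐞 ν - 1 ∣ 𝐞 μ - 𝐞 (s (QuotientAddGroup.mk' (AddSubgroup.zmultiples ν) μ)) := by
        apply single_sub_one_dvd_sub
        rw [← QuotientAddGroup.eq_zero_iff, QuotientAddGroup.mk_sub, sub_eq_zero]
        exact (QuotientAddGroup.out_eq' _).symm
      have e : ∀ κ : M, AddMonoidAlgebra.single κ c = c • 𝐞 κ := fun κ => by simp
      rw [e, e, ← smul_sub]
      obtain ⟨d, hd⟩ := hd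
      exact ⟨c • d, by rw [hd, mul_smul_comm]⟩
  have := key r
  rwa [h, AddMonoidAlgebra.mapDomain_zero, sub_zero] at this

/-- Modulo `e^ν - 1` the ring becomes the group algebra of `M / ℤ ν`, where `φ` shows that `ν'`
still has infinite order. No primality is involved: `ν` may be a multiple of another element, and
then `e^ν - 1` factors. -/
lemma regMod_single_sub_one {ν ν' : M} (φ : M →ₗ[ℤ] ℤ) (h : φ ν = 0) (h' : φ ν' ≠ 0) :
    RegMod (𝐞 ν - 1) (𝐞 ν' - 1) := by
  intro r r' e
  apply single_sub_one_dvd_of_mapDomain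
  let p := AddMonoidAlgebra.mapDomainRingHom ℂ (QuotientAddGroup.mk' (AddSubgroup.zmultiples ν))
  change p r = 0
  have hp : ∀ μ, p (𝐞 μ) = 𝐞 (QuotientAddGroup.mk' (AddSubgroup.zmultiples ν) μ) := fun μ => by
    simp [p]
  have hz : QuotientAddGroup.mk' (AddSubgroup.zmultiples ν) ν = 0 := by
    rw [QuotientAddGroup.mk'_apply, QuotientAddGroup.eq_zero_iff]
    exact AddSubgroup.mem_zmultiples ν
  have e' := congrArg p e
  rw [map_mul, map_mul, map_sub, map_sub, hp, hp, hz, map_one, single_one_zero, sub_self,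
    zero_mul] at e'
  have hm := single_sub_one_mem (ν := QuotientAddGroup.mk' (AddSubgroup.zmultiples ν) ν') (by
    intro n hn
    rw [← map_zsmul, QuotientAddGroup.mk'_apply, QuotientAddGroup.eq_zero_iff,
      AddSubgroup.mem_zmultiples_iff] at hn
    obtain ⟨k, hk⟩ := hn
    have := congrArg φ hk
    rw [map_zsmul, map_zsmul, h, smul_zero] at this
    exact (smul_eq_zero.1 this.symm).resolve_right h')
  exact (mul_left_mem_nonZeroDivisors_eq_zero_iff hm).1 e'

end GroupAlgebra

/-! ### Symmetric algebras -/

section SymmetricAlgebra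

variable {L : Type*} [AddCommGroup L]

/-- The linear function attached to a lattice element. -/
def linFun (ν : L) : SymmetricAlgebra ℂ (ℂ ⊗[ℤ] L) := SymmetricAlgebra.ι ℂ (ℂ ⊗[ℤ] L) (1 ⊗ₜ ν)

lemma linFun_sub (μ ν : L) : linFun (μ - ν) = linFun μ - linFun ν := by
  rw [linFun, TensorProduct.tmul_sub, map_sub]; rfl

lemma exists_eval (φ : L →ₗ[ℤ] ℤ) :
    ∃ ψ : SymmetricAlgebra ℂ (ℂ ⊗[ℤ] L) →ₐ[ℂ] ℂ, ∀ ν, ψ (linFun ν) = φ ν := by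
  refine ⟨SymmetricAlgebra.lift
    (LinearMap.liftBaseChange ℂ ((Int.castAddHom ℂ).toIntLinearMap.comp φ)), fun ν => ?_⟩
  simp [linFun]

variable [Module.Free ℤ L]

lemma exists_dual_ne_zero {ν : L} (hν : ν ≠ 0) : ∃ φ : L →ₗ[ℤ] ℤ, φ ν ≠ 0 := by
  by_contra! H
  refine hν ((Module.Free.chooseBasis ℤ L).ext_elem fun i => ?_)
  rw [map_zero, Finsupp.zero_apply]
  exact H ((Module.Free.chooseBasis ℤ L).coord i)

/-- The vector `1 ⊗ ν` extends to a basis, in which the linear function becomes a variable of a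
polynomial ring. -/
lemma prime_linFun {ν : L} (hν : ν ≠ 0) : Prime (linFun ν) := by
  have hv : (1 : ℂ) ⊗ₜ[ℤ] ν ≠ 0 := by
    intro h
    obtain ⟨φ, hφ⟩ := exists_dual_ne_zero hν
    obtain ⟨ψ, hψ⟩ := exists_eval φ
    have := hψ ν
    rw [linFun, h, map_zero, map_zero] at this
    exact hφ (by exact_mod_cast this.symm)
  have hli : LinearIndepOn ℂ id {(1 : ℂ) ⊗ₜ[ℤ] ν} := LinearIndepOn.singleton (v := id) hv
  obtain ⟨κ, b, k, hb⟩ : ∃ (κ : Type _) (b : Module.Basis κ ℂ (ℂ ⊗[ℤ] L)) (k : κ),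
      b k = (1 : ℂ) ⊗ₜ[ℤ] ν :=
    ⟨_, Module.Basis.extend hli, ⟨_, Module.Basis.subset_extend hli rfl⟩,
      Module.Basis.extend_apply_self hli _⟩
  rw [linFun, ← hb, ← MulEquiv.prime_iff (SymmetricAlgebra.equivMvPolynomial b).toMulEquiv]
  change Prime (SymmetricAlgebra.equivMvPolynomial b (SymmetricAlgebra.ι _ _ _))
  rw [SymmetricAlgebra.equivMvPolynomial_ι_apply]
  exact MvPolynomial.X_prime

lemma linFun_mem {ν : L} (hν : ν ≠ 0) : linFun ν ∈ (SymmetricAlgebra ℂ (ℂ ⊗[ℤ] L))⁰ :=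
  mem_nonZeroDivisors_of_ne_zero (prime_linFun hν).ne_zero

/-- By primality it suffices that `linFun ν` does not divide `linFun ν'`; evaluation at the point
`φ` kills the former but not the latter. -/
lemma regMod_linFun {ν ν' : L} (hν : ν ≠ 0) (φ : L →ₗ[ℤ] ℤ) (h : φ ν = 0) (h' : φ ν' ≠ 0) :
    RegMod (linFun ν) (linFun ν') := by
  intro r r' e
  refine ((prime_linFun hν).dvd_or_dvd ⟨r', e⟩).resolve_left fun hd => h' ?_
  obtain ⟨ψ, hψ⟩ := exists_eval φ
  obtain ⟨c, hc⟩ := hd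
  have := congrArg ψ hc
  rw [map_mul, hψ, hψ, h, Int.cast_zero, zero_mul] at this
  exact_mod_cast this

end SymmetricAlgebra

/-! ### Tori and Cartan algebras -/

namespace WScheme

section

variable {W : Type*} [Group W] {ι : Type*} {L : Type} [AddCommGroup L]
  (σ : W →* (L ≃ₗ[ℤ] L)) (α : ι → L)

/-- The character `e ^ μ` as a function on the torus. -/
def torusChar (μ : L) : (torusOf σ α).A := (AddMonoidAlgebra.single μ 1 : AddMonoidAlgebra ℂ L)

lemma torusChar_ρ (w : W) (μ : L) :
    (torusOf σ α).ρ w (torusChar σ α μ) = torusChar σ α (σ w μ) :=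
  AddMonoidAlgebra.domCongr_single ..

lemma torusChar_mul (μ ν : L) : torusChar σ α μ * torusChar σ α ν = torusChar σ α (μ + ν) :=
  single_one_mul μ ν

lemma torusChar_zero : torusChar σ α 0 = 1 := rfl

lemma isUnit_torusChar (μ : L) : IsUnit (torusChar σ α μ) := isUnit_single_one μ

lemma torusOf_wall (i : ι) : (torusOf σ α).wall i = torusChar σ α (α i) - 1 := rfl

lemma torusOf_induction {p : (torusOf σ α).A → Prop} (zero : p 0)
    (add : ∀ a b, p a → p b → p (a + b)) (smul : ∀ (c : ℂ) a, p a → p (c • a))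
    (char : ∀ μ, p (torusChar σ α μ)) (a : (torusOf σ α).A) : p a := by
  change AddMonoidAlgebra ℂ L at a
  induction a using AddMonoidAlgebra.induction_linear with
  | zero => exact zero
  | add x y hx hy => exact add _ _ hx hy
  | single μ c =>
    have e : AddMonoidAlgebra.single μ c = c • AddMonoidAlgebra.single μ (1 : ℂ) := by simp
    rw [e]
    exact smul _ _ (char μ)

lemma torusChar_dvd {μ μ' ν : L} (h : μ - μ' ∈ AddSubgroup.zmultiples ν) :
    torusChar σ α ν - 1 ∣ torusChar σ α μ - torusChar σ α μ' :=
  single_sub_one_dvd_sub h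

/-- The linear function attached to `μ`, as a function on the Cartan algebra. -/
def lieFun (μ : L) : (lieOf σ α).A := (linFun μ : SymmetricAlgebra ℂ (ℂ ⊗[ℤ] L))

lemma lieFun_ρ (w : W) (μ : L) : (lieOf σ α).ρ w (lieFun σ α μ) = lieFun σ α (σ w μ) := by
  change SymmetricAlgebra.lift _ (linFun μ) = linFun _
  simp [linFun]

lemma lieFun_sub (μ ν : L) : lieFun σ α (μ - ν) = lieFun σ α μ - lieFun σ α ν := linFun_sub μ ν

lemma lieFun_neg (μ : L) : lieFun σ α (-μ) = -lieFun σ α μ := by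
  change linFun (-μ) = -linFun μ
  rw [linFun, TensorProduct.tmul_neg, map_neg]
  rfl

lemma lieFun_zsmul (n : ℤ) (μ : L) : lieFun σ α (n • μ) = n • lieFun σ α μ := by
  change linFun (n • μ) = n • linFun μ
  rw [linFun, TensorProduct.tmul_smul, map_zsmul]
  rfl

lemma lieOf_wall (i : ι) : (lieOf σ α).wall i = lieFun σ α (α i) := rfl

lemma lieOf_induction {p : (lieOf σ α).A → Prop} (const : ∀ c, p (algebraMap ℂ _ c))
    (add : ∀ a b, p a → p b → p (a + b)) (mul : ∀ a b, p a → p b → p (a * b))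
    (lin : ∀ μ, p (lieFun σ α μ)) (a : (lieOf σ α).A) : p a := by
  change SymmetricAlgebra ℂ (ℂ ⊗[ℤ] L) at a
  induction a using SymmetricAlgebra.induction with
  | algebraMap r => exact const r
  | ι x =>
    induction x using TensorProduct.induction_on with
    | zero =>
      rw [map_zero]
      convert const 0
      rw [map_zero]
      rfl
    | tmul c μ =>
      have e : SymmetricAlgebra.ι ℂ (ℂ ⊗[ℤ] L) (c ⊗ₜ μ) =
          algebraMap ℂ (SymmetricAlgebra ℂ (ℂ ⊗[ℤ] L)) c * linFun μ := by
        rw [linFun, ← Algebra.smul_def, ← map_smul, TensorProduct.smul_tmul', smul_eq_mul, mul_one]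
      rw [e]
      exact mul _ _ (const c) (lin μ)
    | add x y hx hy =>
      rw [map_add]
      exact add _ _ hx hy
  | mul a b ha hb => exact mul _ _ ha hb
  | add a b ha hb => exact add _ _ ha hb

variable {σ α} {s : ι → W} {π : W → ι → ι} (h₁ : ∀ i, s i * s i = 1)
  (h₂ : ∀ w i, σ w (α i) = α (π w i)) (h₃ : ∀ i μ, ∃ n : ℤ, σ (s i) μ = μ - n • α i)
  (h₄ : ∀ i, σ (s i) (α i) = -α i)

include h₁ h₂ h₃ h₄

lemma isReflective_torusOf : IsReflective (torusOf σ α) s π where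
  mul_self := h₁
  perm w i := by rw [torusOf_wall, torusOf_wall, map_sub, map_one, torusChar_ρ, h₂]
  dvd_sub i a := by
    induction a using torusOf_induction with
    | zero => simp
    | add x y hx hy =>
      rw [map_add, add_sub_add_comm]
      exact hx.add hy
    | smul c a h =>
      rw [map_smul, ← smul_sub]
      obtain ⟨d, hd⟩ := h
      exact ⟨c • d, by rw [hd, mul_smul_comm]⟩
    | char μ =>
      obtain ⟨n, hn⟩ := h₃ i μ
      rw [torusChar_ρ, torusOf_wall]
      apply torusChar_dvd
      rw [hn, sub_sub_cancel_left, ← neg_smul]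
      exact AddSubgroup.zsmul_mem_zmultiples _ _
  refl i := by
    -- From `e^(-α) - 1 = -e^(-α) (e^α - 1)`.
    refine ⟨-torusChar σ α (-α i), ?_, torusChar σ α (-α i), ?_⟩
    · rw [torusOf_wall, map_sub, map_one, torusChar_ρ, h₄, mul_sub, neg_mul, torusChar_mul,
        neg_add_cancel, torusChar_zero, mul_one, sub_neg_eq_add, neg_add_eq_sub]
    · rw [torusOf_wall, sub_mul, torusChar_mul, add_neg_cancel, torusChar_zero, one_mul,
        neg_add_eq_sub]

lemma isReflective_lieOf : IsReflective (lieOf σ α) s π where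
  mul_self := h₁
  perm w i := by rw [lieOf_wall, lieOf_wall, lieFun_ρ, h₂]
  dvd_sub i a := by
    induction a using lieOf_induction with
    | const r => simp
    | lin μ =>
      obtain ⟨n, hn⟩ := h₃ i μ
      rw [lieFun_ρ, hn, lieFun_sub, sub_sub_cancel_left, lieFun_zsmul, lieOf_wall, zsmul_eq_mul]
      exact (dvd_mul_left _ _).neg_right
    | mul a b ha hb =>
      have : (lieOf σ α).ρ (s i) (a * b) - a * b = ((lieOf σ α).ρ (s i) a - a) *
          (lieOf σ α).ρ (s i) b + a * ((lieOf σ α).ρ (s i) b - b) := by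
        rw [map_mul]; ring
      rw [this]
      exact (ha.mul_right _).add (hb.mul_left _)
    | add a b ha hb =>
      rw [map_add, add_sub_add_comm]
      exact ha.add hb
  refl i := by
    refine ⟨-1, ?_, ?_⟩
    · rw [lieOf_wall, lieFun_ρ, h₄, lieFun_neg, neg_one_mul]
    · rw [neg_add_cancel]
      exact dvd_zero _

end

section

variable {ι X Y : Type} [AddCommGroup X] [AddCommGroup Y] (P : RootPairing ι ℤ X Y)

lemma isReflective_torus : IsReflective (torus P) (simpleRefl P) (idxAct P) :=
  isReflective_torusOf (simpleRefl_mul_self P) (weylX_root P)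
    (fun i μ => ⟨_, weylX_simpleRefl P i μ⟩)
    (fun i => by rw [weylX_root, idxAct_simpleRefl_self])

lemma isReflective_cartan : IsReflective (cartan P) (simpleRefl P) (idxAct P) :=
  isReflective_lieOf (simpleRefl_mul_self P) (weylX_root P)
    (fun i μ => ⟨_, weylX_simpleRefl P i μ⟩)
    (fun i => by rw [weylX_root, idxAct_simpleRefl_self])

lemma isReflective_dualTorus : IsReflective (dualTorus P) (simpleRefl P) (idxAct P) :=
  isReflective_torusOf (simpleRefl_mul_self P) (weylY_coroot P)
    (fun i μ => ⟨_, weylY_simpleRefl P i μ⟩)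
    (fun i => by
      rw [weylY_simpleRefl, P.root_coroot_two, two_smul]
      abel)

variable [Finite ι] [Module.Free ℤ X] [Module.Finite ℤ X] [Module.Free ℤ Y] [Module.Finite ℤ Y]
  [P.IsReduced] (hP : IsSimplyConnected P)

include hP

/-- The functions `e μ - w (e μ)` separate the walls. -/
lemma isSeparated_of (Z : WScheme P.weylGroup ι) (δ : X → Z.A)
    (h₁ : ∀ i, Z.wall i = δ (P.root i)) (h₂ : ∀ ν, ν ≠ 0 → δ ν ∈ Z.A⁰)
    (h₃ : ∀ ν ν', ν ≠ 0 → ν' ∉ satSpan ν → RegMod (δ ν) (δ ν'))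
    (h₄ : ∀ w μ, ∃ a u, IsUnit u ∧ a - Z.ρ w a = u * δ (μ - weylX P w μ)) :
    IsSeparated Z (simpleRefl P) (idxAct P) := by
  have := finite_weylGroup P hP
  refine ⟨fun i => ?_, fun i j => ?_, fun i w hw hw' => ?_, fun w hw => ?_⟩
  · rw [h₁]
    exact h₂ _ (P.ne_zero i)
  · by_cases h : P.root j ∈ satSpan (P.root i)
    · right
      rcases root_eq_or_eq_neg P h with e | e
      · exact Or.inl (P.root.injective e)
      · rw [← idxAct_simpleRefl_self] at e
        exact Or.inr (P.root.injective e)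
    · rw [h₁, h₁]
      exact Or.inl (h₃ _ _ (P.ne_zero i) h)
  · obtain ⟨x, hx⟩ := exists_notMem_satSpan_root P hw hw'
    obtain ⟨a, u, hu, e⟩ := h₄ w x
    refine ⟨a, ?_⟩
    rw [e, h₁]
    exact (h₃ _ _ (P.ne_zero i) hx).mul_isUnit hu
  · by_cases hs : ∃ i, w = simpleRefl P i
    · obtain ⟨i, rfl⟩ := hs
      -- Simple connectedness enters: for pairing `1`, the difference `x - s x` is the root itself,
      -- so `a - s a` is a unit times the wall.
      obtain ⟨x, hx⟩ := exists_pairing_eq_one P hP i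
      obtain ⟨a, u, hu, e⟩ := h₄ (simpleRefl P i) x
      rw [weylX_simpleRefl, sub_sub_cancel, hx, one_smul, ← h₁] at e
      refine ⟨a, ?_, Or.inl ⟨i, rfl, ?_⟩⟩
      · rw [e, h₁]
        exact mul_mem hu.mem_nonZeroDivisors (h₂ _ (P.ne_zero i))
      · rw [e]
        exact (hu.mul_left_dvd).2 dvd_rfl
    · push Not at hs
      obtain ⟨x, hx, hx0⟩ := exists_generic P hw hs
      obtain ⟨a, u, hu, e⟩ := h₄ w x
      refine ⟨a, ?_, Or.inr fun w' hw' => ?_⟩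
      · rw [e]
        exact mul_mem hu.mem_nonZeroDivisors (h₂ _ hx0)
      · obtain ⟨x', hx'⟩ := hx w' hw'
        obtain ⟨a', u', hu', e'⟩ := h₄ w' x'
        refine ⟨a', ?_⟩
        rw [e, e']
        have h := (h₃ _ _ hx0 hx').mul_isUnit hu'
        exact h.of_dvd_dvd (dvd_mul_left _ _) ((hu.mul_left_dvd).2 dvd_rfl)

lemma isSeparated_torus : IsSeparated (torus P) (simpleRefl P) (idxAct P) := by
  refine isSeparated_of P hP (torusOf (weylX P) P.root)
    (fun ν => torusChar (weylX P) P.root ν - 1) (torusOf_wall _ _)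
    (fun ν hν => ?_) (fun ν ν' hν h => ?_) (fun w μ => ?_)
  · exact single_sub_one_mem fun n hn => (smul_eq_zero.1 hn).resolve_right hν
  · obtain ⟨φ, h, h'⟩ := exists_dual_of_notMem_satSpan h
    exact regMod_single_sub_one φ h h'
  · refine ⟨torusChar _ _ μ, torusChar _ _ (weylX P w μ), isUnit_torusChar _ _ _, ?_⟩
    rw [torusChar_ρ, mul_sub, torusChar_mul, add_sub_cancel, mul_one]

lemma isSeparated_cartan : IsSeparated (cartan P) (simpleRefl P) (idxAct P) := by
  refine isSeparated_of P hP (lieOf (weylX P) P.root) (lieFun (weylX P) P.root) (lieOf_wall _ _)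
    (fun ν hν => linFun_mem hν) (fun ν ν' hν h => ?_) (fun w μ => ?_)
  · obtain ⟨φ, h, h'⟩ := exists_dual_of_notMem_satSpan h
    exact regMod_linFun hν φ h h'
  · exact ⟨lieFun _ _ μ, 1, isUnit_one, by rw [lieFun_ρ, one_mul, lieFun_sub]⟩

end

end WScheme

end AffineBlowUp

end

noncomputable section

namespace AffineBlowUp

open scoped nonZeroDivisors

/-! ### Sections of schemes -/

section Sections

open TopologicalSpace Opposite

variable {X Y : Scheme.{0}}

/-- Restriction of sections to a smaller open set. -/
abbrev res {U V : X.Opens} (h : U ≤ V) : Γ(X, V) →+* Γ(X, U) := (X.presheaf.map (homOfLE h).op).hom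

lemma res_res {U V O : X.Opens} (h : U ≤ V) (h' : V ≤ O) (s : Γ(X, O)) :
    res h (res h' s) = res (h.trans h') s := by
  rw [res, res, ← CommRingCat.comp_apply, ← X.presheaf.map_comp]
  rfl

lemma eq_of_res_eq {O : X.Opens} {s t : Γ(X, O)}
    (h : ∀ (U : X.Opens) (hU : U ≤ O), IsAffineOpen U → res hU s = res hU t) : s = t := by
  refine X.sheaf.eq_of_locally_eq' (fun U : {U : X.affineOpens // U.1 ≤ O} => U.1.1) O
    (fun U => homOfLE U.2) ?_ s t (fun U => h U.1.1 U.2 U.1.2)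
  intro x hx
  obtain ⟨U, hU, hxU, hUO⟩ := Opens.isBasis_iff_nbhd.1 X.isBasis_affineOpens hx
  exact Opens.mem_iSup.2 ⟨⟨⟨U, hU⟩, hUO⟩, hxU⟩

lemma exists_res_eq {κ : Type} (U : κ → X.Opens) (hU : ⊤ ≤ iSup U) (s : ∀ k, Γ(X, U k))
    (h : ∀ k l, res (inf_le_left : U k ⊓ U l ≤ U k) (s k) =
      res (inf_le_right : U k ⊓ U l ≤ U l) (s l)) :
    ∃ t : Γ(X, ⊤), ∀ k, res le_top t = s k :=
  (X.sheaf.existsUnique_gluing' U ⊤ (fun _ => homOfLE le_top) hU s h).exists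

lemma exists_affine_cover (X : Scheme.{0}) : ⊤ ≤ iSup fun U : X.affineOpens => U.1 := by
  rw [iSup_affineOpens_eq_top]

/-- A section which is locally divisible by `x` is divisible by `x`, if `x` is nowhere a zero
divisor. -/
lemma dvd_of_res_dvd {κ : Type} (U : κ → X.Opens) (hU : ⊤ ≤ iSup U) {x y : Γ(X, ⊤)}
    (hx : ∀ O : X.Opens, res le_top x ∈ Γ(X, O)⁰)
    (h : ∀ k, (res le_top x : Γ(X, U k)) ∣ res le_top y) : x ∣ y := by
  choose c hc using h
  obtain ⟨t, ht⟩ := exists_res_eq U hU c (fun k l => by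
    have h₁ := congrArg (res (inf_le_left : U k ⊓ U l ≤ U k)) (hc k)
    have h₂ := congrArg (res (inf_le_right : U k ⊓ U l ≤ U l)) (hc l)
    rw [map_mul, res_res, res_res] at h₁ h₂
    rw [h₁] at h₂
    exact (mul_cancel_left_mem_nonZeroDivisors (hx _)).1 h₂)
  refine ⟨t, X.sheaf.eq_of_locally_eq' U ⊤ (fun k => homOfLE le_top) hU _ _ fun k => ?_⟩
  change res le_top y = res le_top (x * t)
  rw [map_mul, ht, hc]

lemma le_preimage_top (f : X ⟶ Y) (U : X.Opens) : U ≤ f ⁻¹ᵁ ⊤ := fun _ _ => trivial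

/-- The homomorphism of rings of functions defined by a morphism to an affine scheme. -/
def sectionHom {A : Type} [CommRing A] (f : X ⟶ Spec (CommRingCat.of A)) (U : X.Opens) :
    A →+* Γ(X, U) :=
  ((Scheme.ΓSpecIso (CommRingCat.of A)).inv ≫ f.appLE ⊤ U (le_preimage_top f U)).hom

variable {A A' : Type} [CommRing A] [CommRing A']

lemma res_sectionHom (f : X ⟶ Spec (CommRingCat.of A)) {U V : X.Opens} (h : U ≤ V) (a : A) :
    res h (sectionHom f V a) = sectionHom f U a := by
  rw [sectionHom, res, ← CommRingCat.comp_apply, Category.assoc, Scheme.Hom.appLE_map]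
  rfl

lemma sectionHom_top (f : X ⟶ Spec (CommRingCat.of A)) :
    sectionHom f ⊤ = ((Scheme.ΓSpecIso (CommRingCat.of A)).inv ≫ f.appTop).hom := by
  rw [sectionHom, Scheme.Hom.appTop, Scheme.Hom.app_eq_appLE]
  rfl

lemma sectionHom_comp (g : Y ⟶ X) (f : X ⟶ Spec (CommRingCat.of A)) {U : X.Opens} {V : Y.Opens}
    (e : V ≤ g ⁻¹ᵁ U) : sectionHom (g ≫ f) V = (g.appLE U V e).hom.comp (sectionHom f U) := by
  rw [sectionHom, sectionHom, ← CommRingCat.hom_comp, Category.assoc, Scheme.Hom.appLE_comp_appLE]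

lemma sectionHom_SpecMap (f : X ⟶ Spec (CommRingCat.of A)) (φ : A' →+* A) (U : X.Opens) :
    sectionHom (f ≫ Spec.map (CommRingCat.ofHom φ)) U = (sectionHom f U).comp φ := by
  have e : φ = (CommRingCat.ofHom φ).hom := rfl
  conv_rhs => rw [e]
  rw [sectionHom, sectionHom, ← CommRingCat.hom_comp, ← Category.assoc,
    Scheme.ΓSpecIso_inv_naturality, Category.assoc]
  congr 2

lemma sectionHom_injective {f g : X ⟶ Spec (CommRingCat.of A)}
    (h : sectionHom f ⊤ = sectionHom g ⊤) : f = g := by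
  rw [sectionHom_top, sectionHom_top] at h
  exact ext_to_Spec (CommRingCat.hom_ext h)

lemma exists_sectionHom_eq (φ : A →+* Γ(X, ⊤)) :
    ∃ f : X ⟶ Spec (CommRingCat.of A), sectionHom f ⊤ = φ := by
  refine ⟨X.toSpecΓ ≫ Spec.map (CommRingCat.ofHom φ), ?_⟩
  rw [sectionHom_SpecMap, sectionHom_top, Scheme.toSpecΓ_appTop]
  ext a
  simp

end Sections

end AffineBlowUp

end

/-! ### Functions on the cover `S ×_{Z'/W} Z'`. -/

noncomputable section

namespace AffineBlowUp

open scoped nonZeroDivisors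

/-- Flat base change of the injection `i`. -/
lemma injective_of_isPushout {K R A' R' : CommRingCat.{0}} {k : K ⟶ R} {i : K ⟶ A'} {j : R ⟶ R'}
    {q : A' ⟶ R'} (h : IsPushout k i j q) (hk : k.hom.Flat) (hi : Function.Injective i) :
    Function.Injective j := by
  algebraize [k.hom, i.hom]
  have := Algebra.TensorProduct.includeLeft_injective (R := K) (S := K) (A := R) (B := A') hi
  let e := (CommRingCat.isPushout_tensorProduct K R A').isoIsPushout R A' h
  intro x y hxy
  apply this
  have he : ∀ x, e.hom ((Algebra.TensorProduct.includeLeft : R →ₐ[K] R ⊗[K] A') x) = j x :=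
    fun x => by
      have := (CommRingCat.isPushout_tensorProduct K R A').inl_isoIsPushout_hom R A' h
      exact ConcreteCategory.congr_hom this x
  apply e.commRingCatIsoToRingEquiv.injective
  exact (he x).trans (hxy.trans (he y).symm)

/-- Sums of products `j r * q a` are closed under multiplication, so they exhaust `R'`. An additive
subgroup `M` is allowed because the averaging operator to which this is applied is only additive. -/
lemma mem_of_closure_eq_top {R A' R' : Type*} [CommRing R] [CommRing A'] [CommRing R'] {j : R →+* R'}
    {q : A' →+* R'} (h : Subring.closure (Set.range j ∪ Set.range q) = ⊤) {M : AddSubgroup R'}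
    (hM : ∀ r a, j r * q a ∈ M) (x : R') : x ∈ M := by
  let N : AddSubgroup R' := AddSubgroup.closure {x | ∃ r a, j r * q a = x}
  have hN : ∀ r a, j r * q a ∈ N := fun r a => AddSubgroup.subset_closure ⟨r, a, rfl⟩
  have hNM : N ≤ M := by
    rw [AddSubgroup.closure_le]
    rintro _ ⟨r, a, rfl⟩
    exact hM r a
  have key : ∀ x ∈ Subring.closure (Set.range j ∪ Set.range q), ∀ y ∈ N, x * y ∈ N := by
    intro x hx
    induction hx using Subring.closure_induction with
    | mem x hx =>
      intro y hy
      induction hy using AddSubgroup.closure_induction with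
      | mem y hy =>
        obtain ⟨r, a, rfl⟩ := hy
        rcases hx with ⟨r', rfl⟩ | ⟨a', rfl⟩
        · rw [← mul_assoc, ← map_mul]
          exact hN _ _
        · rw [mul_left_comm, ← map_mul]
          exact hN _ _
      | zero => rw [mul_zero]; exact zero_mem _
      | add y z _ _ hy hz => rw [mul_add]; exact add_mem hy hz
      | neg y _ hy => rw [mul_neg]; exact neg_mem hy
    | zero => exact fun y _ => by rw [zero_mul]; exact zero_mem _
    | one => exact fun y hy => by rwa [one_mul]
    | add x z _ _ hx hz => exact fun y hy => by rw [add_mul]; exact add_mem (hx y hy) (hz y hy)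
    | neg x _ hx => exact fun y hy => by rw [neg_mul]; exact neg_mem (hx y hy)
    | mul x z _ _ hx hz => exact fun y hy => by rw [mul_assoc]; exact hx _ (hz y hy)
  have h1 : (1 : R') ∈ N := by simpa using hN 1 1
  simpa using hNM (key x (h ▸ Subring.mem_top x) 1 h1)

namespace WScheme

variable {W : Type*} [Group W] {ι : Type*} (Z' : WScheme W ι) (S : Over Z'.quot)

/-- The inverse image in `S ×_{Z'/W} Z'` of an open subset of `S`. -/
abbrev coverOpen (U : S.left.Opens) : (Z'.cover S).Opens := Z'.coverFst S ⁻¹ᵁ U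

/-- Pullback of functions from an open subset of `S`. -/
def coverJ (U : S.left.Opens) : Γ(S.left, U) →+* Γ(Z'.cover S, Z'.coverOpen S U) :=
  ((Z'.coverFst S).app U).hom

/-- The action on functions on the inverse image of an open subset of `S`. -/
def coverσ (U : S.left.Opens) (w : W) :
    Γ(Z'.cover S, Z'.coverOpen S U) →+* Γ(Z'.cover S, Z'.coverOpen S U) :=
  ((Z'.coverAct S w⁻¹).appLE (Z'.coverOpen S U) (Z'.coverOpen S U)
    (by rw [coverOpen, ← Scheme.Hom.comp_preimage, coverAct_fst])).hom

/-- Pullback of functions from `Z'`. -/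
def coverQ (O : (Z'.cover S).Opens) : Z'.A →+* Γ(Z'.cover S, O) := sectionHom (Z'.coverSnd S) O

/-- Pullback of functions from `Z' / W`. -/
def coverK (U : S.left.Opens) : Z'.invariants →+* Γ(S.left, U) := sectionHom S.hom U

variable {S}

lemma coverJ_res {U V : S.left.Opens} (h : U ≤ V) (s : Γ(S.left, V)) :
    res (show Z'.coverOpen S U ≤ Z'.coverOpen S V from fun _ hx => h hx) (Z'.coverJ S V s) =
      Z'.coverJ S U (res h s) := by
  have := (Z'.coverFst S).naturality (homOfLE h).op
  exact ConcreteCategory.congr_hom this.symm s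

lemma coverσ_res {U V : S.left.Opens} (h : U ≤ V) (w : W) (s : Γ(Z'.cover S, Z'.coverOpen S V)) :
    res (show Z'.coverOpen S U ≤ Z'.coverOpen S V from fun _ hx => h hx) (Z'.coverσ S V w s) =
      Z'.coverσ S U w (res (show Z'.coverOpen S U ≤ Z'.coverOpen S V from fun _ hx => h hx) s) := by
  rw [coverσ, coverσ, res, ← CommRingCat.comp_apply, ← CommRingCat.comp_apply,
    Scheme.Hom.appLE_map, Scheme.Hom.map_appLE]

lemma coverσ_J (U : S.left.Opens) (w : W) (s : Γ(S.left, U)) :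
    Z'.coverσ S U w (Z'.coverJ S U s) = Z'.coverJ S U s := by
  rw [coverσ, coverJ, Scheme.Hom.app_eq_appLE, ← CommRingCat.comp_apply,
    Scheme.Hom.appLE_comp_appLE]
  congr 3
  exact Z'.coverAct_fst S _

lemma coverσ_Q (U : S.left.Opens) (w : W) (a : Z'.A) :
    Z'.coverσ S U w (Z'.coverQ S _ a) = Z'.coverQ S _ (Z'.ρ w a) := by
  have h := sectionHom_comp (Z'.coverAct S w⁻¹) (Z'.coverSnd S)
    (U := Z'.coverOpen S U) (V := Z'.coverOpen S U)
    (by rw [coverOpen, ← Scheme.Hom.comp_preimage, coverAct_fst])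
  rw [coverAct_snd, act, sectionHom_SpecMap] at h
  have := RingHom.congr_fun h a
  rw [inv_inv] at this
  exact this.symm

lemma coverJ_K (U : S.left.Opens) (x : Z'.invariants) :
    Z'.coverJ S U (Z'.coverK S U x) = Z'.coverQ S _ x := by
  have h := sectionHom_comp (Z'.coverFst S) S.hom (U := U) (V := Z'.coverOpen S U) le_rfl
  have h' := sectionHom_SpecMap (Z'.coverSnd S) Z'.invariants.subtype (Z'.coverOpen S U)
  have e : Z'.coverFst S ≫ S.hom = Z'.coverSnd S ≫ Z'.quotMap := pullback.condition
  rw [e] at h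
  rw [← Scheme.Hom.app_eq_appLE] at h
  exact RingHom.congr_fun (h.symm.trans h') x

lemma coverQ_res {O O' : (Z'.cover S).Opens} (h : O ≤ O') (a : Z'.A) :
    res h (Z'.coverQ S O' a) = Z'.coverQ S O a := res_sectionHom _ _ _

lemma isPushout_cover {U : S.left.Opens} (hU : IsAffineOpen U) :
    IsPushout (CommRingCat.ofHom (Z'.coverK S U)) (CommRingCat.ofHom Z'.invariants.subtype)
      (CommRingCat.ofHom (Z'.coverJ S U)) (CommRingCat.ofHom (Z'.coverQ S (Z'.coverOpen S U))) := by
  have H : IsPullback (Z'.coverFst S) (Z'.coverSnd S) S.hom Z'.quotMap := IsPullback.of_hasPullback _ _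
  have hUY : Z'.coverOpen S U = Z'.coverFst S ⁻¹ᵁ U ⊓ Z'.coverSnd S ⁻¹ᵁ ⊤ := by simp
  have h := (isIso_pushoutSection_iff H (le_preimage_top Z'.quotMap ⊤) (le_preimage_top S.hom U)
    hUY).1 (isIso_pushoutSection_of_isAffineOpen _ _ _ _ (isAffineOpen_top _) (isAffineOpen_top _) hU)
  refine h.of_iso (Scheme.ΓSpecIso _) (Iso.refl _) (Scheme.ΓSpecIso _) (Iso.refl _) ?_ ?_ ?_ ?_
  · rw [← Iso.inv_comp_eq]; rfl
  · have := Scheme.ΓSpecIso_naturality (CommRingCat.ofHom Z'.invariants.subtype)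
    rw [← this, Scheme.Hom.appTop, Scheme.Hom.app_eq_appLE]
    rfl
  · rw [← Scheme.Hom.app_eq_appLE]; rfl
  · rw [← Iso.inv_comp_eq]; rfl

/-- Functions on the inverse image of an affine open subset are sums of products of functions on
this affine open subset and on `Z'`. -/
lemma closure_cover {U : S.left.Opens} (hU : IsAffineOpen U) :
    Subring.closure (Set.range (Z'.coverJ S U) ∪ Set.range (Z'.coverQ S (Z'.coverOpen S U))) = ⊤ :=
  CommRingCat.closure_range_union_range_eq_top_of_isPushout (Z'.isPushout_cover hU)

section Flat

variable [Flat S.hom]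

/-- Base change of the flat morphism `S → Z'/W`; flatness of `Z' → Z'/W` is not needed. -/
lemma flat_coverQ {O : (Z'.cover S).Opens} (hO : IsAffineOpen O) : (Z'.coverQ S O).Flat := by
  have : Flat (Z'.coverSnd S) := Flat.instSndScheme S.hom Z'.quotMap
  have h := (Z'.coverSnd S).flat_appLE (isAffineOpen_top _) hO (le_preimage_top _ _)
  have h' : ((Scheme.ΓSpecIso (CommRingCat.of Z'.A)).inv.hom).Flat :=
    RingHom.Flat.of_bijective (ConcreteCategory.bijective_of_isIso _)
  exact RingHom.Flat.comp h' h

lemma flat_coverK {U : S.left.Opens} (hU : IsAffineOpen U) : (Z'.coverK S U).Flat := by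
  have h := S.hom.flat_appLE (isAffineOpen_top _) hU (le_preimage_top _ _)
  have h' : ((Scheme.ΓSpecIso (CommRingCat.of Z'.invariants)).inv.hom).Flat :=
    RingHom.Flat.of_bijective (ConcreteCategory.bijective_of_isIso _)
  exact RingHom.Flat.comp h' h

lemma coverQ_mem (O : (Z'.cover S).Opens) {a : Z'.A} (ha : a ∈ Z'.A⁰) :
    Z'.coverQ S O a ∈ Γ(Z'.cover S, O)⁰ := by
  rw [mem_nonZeroDivisors_iff_right]
  intro r hr
  refine eq_of_res_eq fun U hUO hU => ?_
  let _ := (Z'.coverQ S U).toAlgebra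
  have : Module.Flat Z'.A Γ(Z'.cover S, U) := Z'.flat_coverQ hU
  have h := algebraMap_mem_nonZeroDivisors_of_flat (M := Γ(Z'.cover S, U)) ha
  have e := congrArg (res hUO) hr
  rw [map_mul, map_zero, coverQ_res] at e
  rw [map_zero]
  exact (mul_right_mem_nonZeroDivisors_eq_zero_iff h).1 e

lemma regMod_coverQ {a b : Z'.A} (ha : a ∈ Z'.A⁰) (h : RegMod a b) :
    RegMod (Z'.coverQ S ⊤ a) (Z'.coverQ S ⊤ b) := by
  intro r r' e
  refine dvd_of_res_dvd _ (exists_affine_cover _) (fun O => ?_) (fun U => ?_)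
  · rw [coverQ_res]
    exact Z'.coverQ_mem O ha
  · let _ := (Z'.coverQ S U.1).toAlgebra
    have : Module.Flat Z'.A Γ(Z'.cover S, U.1) := Z'.flat_coverQ U.2
    have e' := congrArg (res (le_top : U.1 ≤ ⊤)) e
    rw [map_mul, map_mul, coverQ_res, coverQ_res] at e'
    rw [coverQ_res]
    exact h.algebraMap_of_flat (M := Γ(Z'.cover S, U.1)) _ _ e'

/-- Over an affine open set this is the flat base change of the inclusion of invariants. -/
lemma coverJ_injective (O : S.left.Opens) : Function.Injective (Z'.coverJ S O) := by
  intro r r' h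
  refine eq_of_res_eq fun U hUO hU => ?_
  refine injective_of_isPushout (Z'.isPushout_cover hU) (Z'.flat_coverK hU)
    Subtype.val_injective ?_
  change Z'.coverJ S U _ = Z'.coverJ S U _
  rw [← coverJ_res, ← coverJ_res, h]

end Flat

section Finite

variable [Finite W]

/-- Averaging an invariant function on the inverse image of an affine open subset shows that it
comes from this affine open subset. -/
lemma exists_coverJ_eq {U : S.left.Opens} (hU : IsAffineOpen U)
    {r' : Γ(Z'.cover S, Z'.coverOpen S U)} (h : ∀ w, Z'.coverσ S U w r' = r') :
    ∃ r, Z'.coverJ S U r = r' := by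
  have := Fintype.ofFinite W
  let q := Z'.coverQ S (Z'.coverOpen S U)
  let c : Z'.A := algebraMap ℂ Z'.A (Fintype.card W : ℂ)⁻¹
  have hc : (Fintype.card W : Z'.A) * c = 1 := by
    rw [← map_natCast (algebraMap ℂ Z'.A), ← map_mul, mul_inv_cancel₀, map_one]
    exact_mod_cast Fintype.card_ne_zero
  -- The averaging operator. It maps `j r * q a` to `j r` times the pullback of an averaged, hence
  -- invariant, function on `Z'`.
  let e : Γ(Z'.cover S, Z'.coverOpen S U) →+ Γ(Z'.cover S, Z'.coverOpen S U) :=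
    ∑ w, (Z'.coverσ S U w).toAddMonoidHom.comp (AddMonoidHom.mulRight (q c))
  have he : ∀ x, e x = ∑ w, Z'.coverσ S U w (x * q c) := fun x => by simp [e]
  let M : AddSubgroup Γ(Z'.cover S, Z'.coverOpen S U) := (Z'.coverJ S U).range.toAddSubgroup.comap e
  have hM : ∀ r a, Z'.coverJ S U r * q a ∈ M := fun r a => by
    refine ⟨r * Z'.coverK S U ⟨∑ w, Z'.ρ w (a * c), fun v => ?_⟩, ?_⟩
    · rw [map_sum]
      simp_rw [← ρ_mul_apply]
      exact Fintype.sum_equiv (Equiv.mulLeft v) _ _ fun w => rfl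
    · rw [map_mul, coverJ_K, he]
      simp only [mul_assoc, ← map_mul, q]
      simp only [map_mul, coverσ_J, coverσ_Q]
      rw [← Finset.mul_sum]
      simp only [map_sum, map_mul]
  obtain ⟨r, hr⟩ := mem_of_closure_eq_top (Z'.closure_cover hU) hM r'
  refine ⟨r, hr.trans ?_⟩
  change e r' = r'
  have : ∀ w, Z'.coverσ S U w (q c) = q c := fun w => by
    rw [coverσ_Q, AlgEquiv.commutes]
  simp only [he, map_mul, h, this, Finset.sum_const, Finset.card_univ, nsmul_eq_mul]
  rw [mul_left_comm, ← map_natCast q, ← map_mul, hc, map_one, mul_one]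

/-- The rings of functions on `S` and on `S ×_{Z'/W} Z'`. -/
lemma coverData [Flat S.hom] :
    CoverData Z' (Z'.coverJ S ⊤) (Z'.coverσ S ⊤) (Z'.coverQ S ⊤) (Z'.coverK S ⊤) where
  inj := Z'.coverJ_injective ⊤
  fixed r' h := by
    have hU : ∀ U : S.left.affineOpens, ∃ r, Z'.coverJ S U.1 r =
        res (show Z'.coverOpen S U.1 ≤ Z'.coverOpen S ⊤ from fun _ _ => trivial) r' := fun U =>
      Z'.exists_coverJ_eq U.2 fun w =>
        (Z'.coverσ_res (le_top : U.1 ≤ ⊤) w r').symm.trans (congrArg _ (h w))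
    choose r hr using hU
    obtain ⟨t, ht⟩ := exists_res_eq _ (exists_affine_cover S.left) r fun U V => by
      apply Z'.coverJ_injective
      rw [← coverJ_res, ← coverJ_res, hr, hr, res_res, res_res]
    refine ⟨t, (Z'.cover S).sheaf.eq_of_locally_eq' (fun U : S.left.affineOpens => Z'.coverOpen S U.1)
      (Z'.coverOpen S ⊤) (fun U => homOfLE fun _ _ => trivial) ?_ _ _ fun U => ?_⟩
    · intro x _
      have := exists_affine_cover S.left (show Z'.coverFst S x ∈ (⊤ : S.left.Opens) from trivial)
      obtain ⟨U, hU⟩ := TopologicalSpace.Opens.mem_iSup.1 this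
      exact TopologicalSpace.Opens.mem_iSup.2 ⟨U, hU⟩
    · exact (Z'.coverJ_res (le_top : U.1 ≤ ⊤) t).trans ((congrArg _ (ht U)).trans (hr U))
  σ_j := Z'.coverσ_J ⊤
  σ_q := Z'.coverσ_Q ⊤
  comm := Z'.coverJ_K ⊤
  nzd a ha := Z'.coverQ_mem ⊤ ha
  regMod a b := Z'.regMod_coverQ

end Finite

end WScheme

end AffineBlowUp

end

/-! ### Invariance and the wall condition in terms of functions. -/

noncomputable section

namespace AffineBlowUp

open scoped nonZeroDivisors

lemma fromSpec_comp {X : Scheme.{0}} {A : Type} [CommRing A] (f : X ⟶ Spec (CommRingCat.of A))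
    {U : X.Opens} (hU : IsAffineOpen U) :
    hU.fromSpec ≫ f = Spec.map (CommRingCat.ofHom (sectionHom f U)) := by
  rw [← IsAffineOpen.SpecMap_appLE_fromSpec f (isAffineOpen_top _) hU (le_preimage_top f U),
    IsAffineOpen.fromSpec_top, Scheme.isoSpec_Spec_inv, ← Spec.map_comp]
  rfl

namespace WScheme

variable {W : Type*} [Group W] {ι : Type*} {Z Z' : WScheme W ι} {S : Over Z'.quot}

lemma isInvariant_iff {f : Z'.cover S ⟶ Z.space} :
    IsInvariant Z Z' S f ↔
      (∀ c : ℂ, sectionHom f ⊤ (algebraMap ℂ Z.A c) = Z'.coverQ S ⊤ (algebraMap ℂ Z'.A c)) ∧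
      ∀ w a, Z'.coverσ S ⊤ w (sectionHom f ⊤ a) = sectionHom f ⊤ (Z.ρ w a) := by
  refine and_congr ?_ ⟨fun h w a => ?_, fun h w => ?_⟩
  · have h₁ := sectionHom_SpecMap f (algebraMap ℂ Z.A) ⊤
    have h₂ := sectionHom_SpecMap (Z'.coverSnd S) (algebraMap ℂ Z'.A) ⊤
    constructor
    · intro h c
      have h' : sectionHom (f ≫ Z.toC) ⊤ = sectionHom (Z'.coverSnd S ≫ Z'.toC) ⊤ := by rw [h]
      exact RingHom.congr_fun (h₁.symm.trans (h'.trans h₂)) c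
    · intro h
      apply sectionHom_injective
      refine h₁.trans (Eq.trans ?_ h₂.symm)
      ext c
      exact h c
  · have h₁ := sectionHom_comp (Z'.coverAct S w⁻¹) f (U := ⊤) (V := ⊤) (le_preimage_top _ _)
    have h₂ := sectionHom_SpecMap f (Z.ρ w⁻¹⁻¹ : Z.A →+* Z.A) ⊤
    have h' : sectionHom (Z'.coverAct S w⁻¹ ≫ f) ⊤ = sectionHom (f ≫ Z.act w⁻¹) ⊤ := by rw [h]
    have := RingHom.congr_fun (h₁.symm.trans (h'.trans h₂)) a
    rw [inv_inv] at this
    exact this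
  · have h₁ := sectionHom_comp (Z'.coverAct S w) f (U := ⊤) (V := ⊤) (le_preimage_top _ _)
    have h₂ := sectionHom_SpecMap f (Z.ρ w⁻¹ : Z.A →+* Z.A) ⊤
    apply sectionHom_injective
    refine h₁.trans (Eq.trans ?_ h₂.symm)
    ext a
    have := h w⁻¹ a
    simp only [coverσ, inv_inv] at this
    exact this

/-- The equation of the target wall vanishes on the inverse image of the source wall, so the map
factors through the quotient ring. -/
lemma WallCondition.of_dvd {f : Z'.cover S ⟶ Z.space}
    (h : ∀ i, Z'.coverQ S ⊤ (Z'.wall i) ∣ sectionHom f ⊤ (Z.wall i)) : WallCondition Z Z' S f := by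
  intro i
  let p := pullback.fst (Z'.coverSnd S) (Z'.wallIncl i)
  let p' := pullback.snd (Z'.coverSnd S) (Z'.wallIncl i)
  have h₁ := sectionHom_comp p (Z'.coverSnd S) (U := ⊤) (V := ⊤) (le_preimage_top _ _)
  have h₂ := sectionHom_comp p f (U := ⊤) (V := ⊤) (le_preimage_top _ _)
  have h₃ := sectionHom_SpecMap p' (Ideal.Quotient.mk (Ideal.span {Z'.wall i})) ⊤
  have e : sectionHom (p ≫ Z'.coverSnd S) ⊤ = sectionHom (p' ≫ Z'.wallIncl i) ⊤ := by
    rw [pullback.condition]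
  have h₀ : sectionHom (p ≫ Z'.coverSnd S) ⊤ (Z'.wall i) = 0 := by
    refine (RingHom.congr_fun (e.trans h₃) (Z'.wall i)).trans ?_
    rw [RingHom.comp_apply, Ideal.Quotient.eq_zero_iff_mem.2 (Ideal.mem_span_singleton_self _),
      map_zero]
  have h₀' : sectionHom (p ≫ f) ⊤ (Z.wall i) = 0 := by
    obtain ⟨c, hc⟩ := h i
    rw [h₁] at h₀
    rw [h₂, RingHom.comp_apply, hc, map_mul]
    exact mul_eq_zero_of_left h₀ _
  have hle : ∀ a ∈ Ideal.span {Z.wall i}, sectionHom (p ≫ f) ⊤ a = 0 := fun a ha => by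
    obtain ⟨c, rfl⟩ := Ideal.mem_span_singleton.1 ha
    rw [map_mul, h₀', zero_mul]
  obtain ⟨g, hg⟩ := exists_sectionHom_eq (Ideal.Quotient.lift _ (sectionHom (p ≫ f) ⊤) hle)
  refine ⟨g, sectionHom_injective ?_⟩
  refine (sectionHom_SpecMap g (Ideal.Quotient.mk (Ideal.span {Z.wall i})) ⊤).trans ?_
  rw [hg]
  ext a
  rfl

/-- Divisibility is tested on affine open sets; flatness makes the local quotients unique, so they
glue. -/
lemma WallCondition.dvd [Flat S.hom] (hw : ∀ i, Z'.wall i ∈ Z'.A⁰) {f : Z'.cover S ⟶ Z.space}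
    (h : WallCondition Z Z' S f) (i : ι) :
    Z'.coverQ S ⊤ (Z'.wall i) ∣ sectionHom f ⊤ (Z.wall i) := by
  obtain ⟨g, hg⟩ := h i
  refine dvd_of_res_dvd _ (exists_affine_cover _) (fun O => ?_) (fun U => ?_)
  · rw [coverQ_res]
    exact Z'.coverQ_mem O (hw i)
  · have hU : IsAffineOpen U.1 := U.2
    rw [coverQ_res, res_sectionHom, ← Ideal.mem_span_singleton, ← Ideal.Quotient.eq_zero_iff_mem]
    let m := Ideal.Quotient.mk (Ideal.span {Z'.coverQ S U.1 (Z'.wall i)})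
    -- The part of the wall's inverse image lying in `U`, given by the quotient ring. Vanishing of
    -- the target equation there is exactly divisibility in `Γ(U)`.
    let t : Spec (CommRingCat.of (Γ(Z'.cover S, U.1) ⧸ Ideal.span {Z'.coverQ S U.1 (Z'.wall i)})) ⟶
      Z'.cover S := Spec.map (CommRingCat.ofHom m) ≫ hU.fromSpec
    have hle : ∀ a ∈ Ideal.span {Z'.wall i}, (m.comp (Z'.coverQ S U.1)) a = 0 := fun a ha => by
      obtain ⟨c, rfl⟩ := Ideal.mem_span_singleton.1 ha
      rw [RingHom.comp_apply, map_mul, map_mul]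
      exact mul_eq_zero_of_left
        (Ideal.Quotient.eq_zero_iff_mem.2 (Ideal.mem_span_singleton_self _)) _
    let l := Ideal.Quotient.lift _ (m.comp (Z'.coverQ S U.1)) hle
    have e : t ≫ Z'.coverSnd S = Spec.map (CommRingCat.ofHom l) ≫ Z'.wallIncl i := by
      rw [Category.assoc, fromSpec_comp, wallIncl, ← Spec.map_comp, ← Spec.map_comp]
      congr 1
    obtain ⟨ψ, hψ⟩ := Spec.map_surjective (pullback.lift t _ e ≫ g)
    have e' : Spec.map ψ ≫ Z.wallIncl i = t ≫ f := by
      rw [hψ, Category.assoc, hg, ← Category.assoc, pullback.lift_fst]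
    rw [Category.assoc, fromSpec_comp, wallIncl, ← Spec.map_comp, ← Spec.map_comp,
      Spec.map_inj] at e'
    have e₁ : m (sectionHom f U.1 (Z.wall i)) =
        ψ.hom (Ideal.Quotient.mk (Ideal.span {Z.wall i}) (Z.wall i)) := ConcreteCategory.congr_hom e'.symm (Z.wall i)
    refine e₁.trans ?_
    rw [Ideal.Quotient.eq_zero_iff_mem.2 (Ideal.mem_span_singleton_self _), map_zero]

/-- The reflection `s i` acts trivially on the wall of the cover. -/
lemma dvd_coverσ_sub {s : ι → W} {π : W → ι → ι} (hZ' : IsReflective Z' s π) {U : S.left.Opens}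
    (hU : IsAffineOpen U) (i : ι) (r : Γ(Z'.cover S, Z'.coverOpen S U)) :
    Z'.coverQ S _ (Z'.wall i) ∣ Z'.coverσ S U (s i) r - r := by
  have hr : r ∈ Subring.closure
      (Set.range (Z'.coverJ S U) ∪ Set.range (Z'.coverQ S (Z'.coverOpen S U))) := by
    rw [closure_cover Z' hU]; trivial
  induction hr using Subring.closure_induction with
  | mem x hx =>
    rcases hx with ⟨r, rfl⟩ | ⟨a, rfl⟩
    · rw [coverσ_J, sub_self]
      exact dvd_zero _
    · rw [coverσ_Q, ← map_sub]
      exact map_dvd _ (hZ'.dvd_sub i a)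
  | zero => simp
  | one => simp
  | add x y _ _ hx hy =>
    rw [map_add, add_sub_add_comm]
    exact hx.add hy
  | neg x _ hx =>
    rw [map_neg, ← neg_sub', dvd_neg]
    exact hx
  | mul x y _ _ hx hy =>
    have : Z'.coverσ S U (s i) (x * y) - x * y = (Z'.coverσ S U (s i) x - x) *
        Z'.coverσ S U (s i) y + x * (Z'.coverσ S U (s i) y - y) := by
      rw [map_mul]; ring
    rw [this]
    exact (hx.mul_right _).add (hy.mul_left _)

/-- If the reflections map the walls of the target to their negatives, then the wall condition
holds for all invariant morphisms. -/
lemma IsInvariant.wallCondition [Flat S.hom] {s : ι → W} {π : W → ι → ι}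
    (hZ' : IsReflective Z' s π) (hw : ∀ i, Z'.wall i ∈ Z'.A⁰)
    (hZ : ∀ i, Z.ρ (s i) (Z.wall i) = -Z.wall i) {f : Z'.cover S ⟶ Z.space}
    (hf : IsInvariant Z Z' S f) : WallCondition Z Z' S f := by
  refine WallCondition.of_dvd fun i => ?_
  refine dvd_of_res_dvd (fun U : S.left.affineOpens => Z'.coverOpen S U.1) ?_ (fun O => ?_)
    (fun U => ?_)
  · intro x _
    have := exists_affine_cover S.left (show Z'.coverFst S x ∈ (⊤ : S.left.Opens) from trivial)
    obtain ⟨U, hU⟩ := TopologicalSpace.Opens.mem_iSup.1 this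
    exact TopologicalSpace.Opens.mem_iSup.2 ⟨U, hU⟩
  · rw [coverQ_res]
    exact Z'.coverQ_mem O (hw i)
  · have h := (isInvariant_iff.1 hf).2 (s i) (Z.wall i)
    rw [hZ, map_neg] at h
    have hle : Z'.coverOpen S U.1 ≤ ⊤ := fun _ _ => trivial
    have h₁ : Z'.coverσ S U.1 (s i) (res hle (sectionHom f ⊤ (Z.wall i))) =
        res hle (-sectionHom f ⊤ (Z.wall i)) :=
      (Z'.coverσ_res (le_top : U.1 ≤ ⊤) (s i) (sectionHom f ⊤ (Z.wall i))).symm.trans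
        (congrArg _ h)
    have h₂ := dvd_coverσ_sub hZ' U.2 i (res hle (sectionHom f ⊤ (Z.wall i)))
    rw [h₁, map_neg] at h₂
    rw [coverQ_res]
    -- The section is negated by the reflection, so the divisible difference is `-2` times it; the
    -- factor is removed with `1/2`.
    have h₃ : (2 : Z'.A) * algebraMap ℂ Z'.A 2⁻¹ = 1 := by
      rw [← map_ofNat (algebraMap ℂ Z'.A), ← map_mul, mul_inv_cancel₀ two_ne_zero, map_one]
    have h₄ := congrArg (Z'.coverQ S (Z'.coverOpen S U.1)) h₃
    rw [map_mul, map_one, map_ofNat] at h₄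
    have h₅ := h₂.mul_right (-Z'.coverQ S (Z'.coverOpen S U.1) (algebraMap ℂ Z'.A 2⁻¹))
    convert h₅ using 1
    linear_combination (-res hle (sectionHom f ⊤ (Z.wall i))) * h₄

end WScheme

end AffineBlowUp

end

/-! ### Representability. -/

noncomputable section

namespace AffineBlowUp

namespace WScheme

open Opposite

section Represented

variable {W : Type*} [Group W] {ι : Type*} {Z Z' : WScheme W ι} {s : ι → W}
  {π : W → ι → ι}

/-- The relation between morphisms to the blow-up and invariant morphisms. -/
def CorrespondsOver (S : Over Z'.quot) (f : Z'.cover S ⟶ Z.space) (g : S ⟶ blowUp Z Z') : Prop :=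
  Corresponds (Z := Z) (Z' := Z') (Z'.coverJ S ⊤) (Z'.coverQ S ⊤) (sectionHom f ⊤)
    (sectionHom (A := blowUpInvariants Z Z') g.left ⊤)

/-- The intermediate `F` is composed with pullback along `coverMap t`. With uniqueness of
correspondents this yields naturality of the bijection. -/
lemma CorrespondsOver.comp {S S' : Over Z'.quot} (t : S' ⟶ S) {f : Z'.cover S ⟶ Z.space}
    {g : S ⟶ blowUp Z Z'} (h : CorrespondsOver S f g) :
    CorrespondsOver S' (Z'.coverMap t ≫ f) (t ≫ g) := by
  obtain ⟨F, h₁, h₂, h₃⟩ := h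
  let m : Γ(Z'.cover S, Z'.coverOpen S ⊤) →+* Γ(Z'.cover S', Z'.coverOpen S' ⊤) :=
    ((Z'.coverMap t).appLE ⊤ ⊤ (le_preimage_top _ _)).hom
  have hm : m.comp (Z'.coverJ S ⊤) =
      (Z'.coverJ S' ⊤).comp (t.left.appLE ⊤ ⊤ (le_preimage_top _ _)).hom := by
    have h₁ := Scheme.Hom.appLE_comp_appLE (Z'.coverMap t) (Z'.coverFst S) ⊤ ⊤ ⊤
      (le_preimage_top _ _) (le_preimage_top _ _)
    have h₂ := Scheme.Hom.appLE_comp_appLE (Z'.coverFst S') t.left ⊤ ⊤ ⊤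
      (le_preimage_top _ _) (le_preimage_top _ _)
    rw [coverJ, coverJ, Scheme.Hom.app_eq_appLE, Scheme.Hom.app_eq_appLE]
    refine congrArg CommRingCat.Hom.hom (h₁.trans (Eq.trans ?_ h₂.symm))
    congr 1
    exact coverMap_fst _ _
  refine ⟨m.comp F, ?_, ?_, ?_⟩
  · exact (RingHom.comp_assoc _ _ _).trans ((congrArg m.comp h₁).trans
      (sectionHom_comp (Z'.coverMap t) f (U := ⊤) (le_preimage_top _ _)).symm)
  · refine (RingHom.comp_assoc _ _ _).trans ((congrArg m.comp h₂).trans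
      ((sectionHom_comp (Z'.coverMap t) (Z'.coverSnd S) (U := ⊤) (le_preimage_top _ _)).symm.trans
        ?_))
    rw [coverMap_snd]
    rfl
  · refine (RingHom.comp_assoc _ _ _).trans ((congrArg m.comp h₃).trans
      ((RingHom.comp_assoc _ _ _).symm.trans ?_))
    rw [hm, RingHom.comp_assoc]
    exact congrArg (Z'.coverJ S' ⊤).comp (sectionHom_comp (A := blowUpInvariants Z Z') t.left g.left
      (U := ⊤) (le_preimage_top _ _)).symm

variable (hZ : IsReflective Z s π) (hZ' : IsReflective Z' s π) (hS : IsSeparated Z' s π)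

lemma isInvHom_iff {S : Over Z'.quot} [Flat S.hom] (hw : ∀ i, Z'.wall i ∈ nonZeroDivisors Z'.A)
    {f : Z'.cover S ⟶ Z.space} :
    IsInvHom (Z := Z) (Z'.coverσ S ⊤) (Z'.coverQ S ⊤) (sectionHom f ⊤) ↔
      IsInvariant Z Z' S f ∧ WallCondition Z Z' S f :=
  ⟨fun h => ⟨isInvariant_iff.2 ⟨h.alg, h.σ_f⟩, WallCondition.of_dvd h.wall⟩,
    fun h => ⟨(isInvariant_iff.1 h.1).1, (isInvariant_iff.1 h.1).2, h.2.dvd hw⟩⟩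

variable [Finite W]

include hZ hZ' hS

/-- A morphism to an affine scheme is determined by global sections, so the ring statement applies
to `R = Γ(S)` without `S` being affine. -/
lemma existsUnique_correspondsOver_right {S : Over Z'.quot} [Flat S.hom] {f : Z'.cover S ⟶ Z.space}
    (hf : IsInvariant Z Z' S f ∧ WallCondition Z Z' S f) :
    ∃! g : S ⟶ blowUp Z Z', CorrespondsOver S f g := by
  have D := coverData Z' (S := S)
  obtain ⟨φ, hφ, hu⟩ := existsUnique_corresponds_right hZ hZ' hS.wall_mem D
    ((isInvHom_iff hS.wall_mem).2 hf)
  obtain ⟨g, hg⟩ := exists_sectionHom_eq φ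
  have h := hφ.comp_toBlowUpInvariants D
  have hw : g ≫ Spec.map (CommRingCat.ofHom (toBlowUpInvariants Z Z')) = S.hom := by
    apply sectionHom_injective
    refine (sectionHom_SpecMap g (toBlowUpInvariants Z Z') ⊤).trans ?_
    rw [hg]
    exact h
  refine ⟨Over.homMk g hw, ?_, fun g' hg' => ?_⟩
  · subst hg
    exact hφ
  · apply Over.OverMorphism.ext
    apply sectionHom_injective (A := blowUpInvariants Z Z')
    exact (hu _ hg').trans hg.symm

lemma existsUnique_correspondsOver_left {S : Over Z'.quot} [Flat S.hom] (g : S ⟶ blowUp Z Z') :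
    ∃! f : Z'.cover S ⟶ Z.space, (IsInvariant Z Z' S f ∧ WallCondition Z Z' S f) ∧
      CorrespondsOver S f g := by
  classical
  have := Fintype.ofFinite W
  have D := coverData Z' (S := S)
  have hg : (sectionHom (A := blowUpInvariants Z Z') g.left ⊤).comp (toBlowUpInvariants Z Z') =
      Z'.coverK S ⊤ := by
    refine (sectionHom_SpecMap (A := blowUpInvariants Z Z') g.left
      (toBlowUpInvariants Z Z') ⊤).symm.trans ?_
    exact congrArg (fun h => sectionHom h ⊤) (Over.w g)
  obtain ⟨φ, ⟨hφ, hφ'⟩, hu⟩ := existsUnique_corresponds_left hZ hZ' hS D hg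
  obtain ⟨f, hf⟩ := exists_sectionHom_eq φ
  subst hf
  refine ⟨f, ⟨(isInvHom_iff hS.wall_mem).1 hφ, hφ'⟩, fun f' hf' => ?_⟩
  apply sectionHom_injective
  exact hu _ ⟨(isInvHom_iff hS.wall_mem).2 hf'.1, hf'.2⟩

/-- The bijection between invariant morphisms subject to the wall condition and morphisms to the
blow-up. -/
def invMorZeroEquiv (S : FlatOver Z'.quot) :
    {f : Z'.cover S.obj ⟶ Z.space // IsInvariant Z Z' S.obj f ∧ WallCondition Z Z' S.obj f} ≃
      (S.obj ⟶ blowUp Z Z') :=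
  have : Flat S.obj.hom := S.property
  Equiv.ofBijective
    (fun f => (existsUnique_correspondsOver_right hZ hZ' hS f.2).choose)
    ⟨fun f f' h => by
      have h₁ := (existsUnique_correspondsOver_right hZ hZ' hS f.2).choose_spec.1
      have h₂ := (existsUnique_correspondsOver_right hZ hZ' hS f'.2).choose_spec.1
      dsimp only at h h₁ h₂
      rw [← h] at h₂
      exact Subtype.ext ((existsUnique_correspondsOver_left hZ hZ' hS _).unique
        ⟨f.2, h₁⟩ ⟨f'.2, h₂⟩),
    fun g => by
      obtain ⟨f, ⟨hf, hfg⟩, -⟩ := existsUnique_correspondsOver_left hZ hZ' hS g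
      exact ⟨⟨f, hf⟩, (existsUnique_correspondsOver_right hZ hZ' hS hf).unique
        (existsUnique_correspondsOver_right hZ hZ' hS hf).choose_spec.1 hfg⟩⟩

lemma invMorZeroEquiv_spec (S : FlatOver Z'.quot)
    (f : {f : Z'.cover S.obj ⟶ Z.space // IsInvariant Z Z' S.obj f ∧ WallCondition Z Z' S.obj f}) :
    CorrespondsOver S.obj f.1 (invMorZeroEquiv hZ hZ' hS S f) :=
  have : Flat S.obj.hom := S.property
  (existsUnique_correspondsOver_right hZ hZ' hS f.2).choose_spec.1

theorem representedBy_invMorZero : RepresentedBy (invMorZero Z Z') (blowUp Z Z') := by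
  refine ⟨NatIso.ofComponents (fun S => (invMorZeroEquiv hZ hZ' hS S.unop).toIso) ?_⟩
  intro S S' t
  ext f
  have : Flat S'.unop.obj.hom := S'.unop.property
  exact (existsUnique_correspondsOver_right hZ hZ' hS
    ((invMorZero Z Z').map t f).2).unique (invMorZeroEquiv_spec hZ hZ' hS _ _)
    ((invMorZeroEquiv_spec hZ hZ' hS _ f).comp t.unop.hom)

/-- Under `h` the wall condition follows from invariance, so the two functors coincide. -/
theorem representedBy_invMor (h : ∀ i, Z.ρ (s i) (Z.wall i) = -Z.wall i) :
    RepresentedBy (invMor Z Z') (blowUp Z Z') := by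
  obtain ⟨e⟩ := representedBy_invMorZero hZ hZ' hS
  let e' : invMor Z Z' ≅ invMorZero Z Z' := NatIso.ofComponents
    (fun S => (Equiv.subtypeEquivRight fun f =>
      have : Flat S.unop.obj.hom := S.unop.property
      ⟨fun hf => ⟨hf, hf.wallCondition hZ' hS.wall_mem h⟩, fun hf => hf.1⟩).toIso)
    (fun t => rfl)
  exact ⟨e' ≪≫ e⟩

end Represented

lemma cartan_ρ_wall {ι X Y : Type} [AddCommGroup X] [AddCommGroup Y] (P : RootPairing ι ℤ X Y)
    (i : ι) : (cartan P).ρ (simpleRefl P i) ((cartan P).wall i) = -(cartan P).wall i :=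
  (lieFun_ρ (weylX P) P.root (simpleRefl P i) (P.root i)).trans (by
    rw [weylX_root, idxAct_simpleRefl_self, lieFun_neg]
    rfl)

end WScheme

end AffineBlowUp

end

open AffineBlowUp AffineBlowUp.WScheme
theorem mainTheorem5 {ι X Y : Type} [Finite ι] [AddCommGroup X] [AddCommGroup Y]
    [Module.Free ℤ X] [Module.Finite ℤ X] [Module.Free ℤ Y] [Module.Finite ℤ Y]
    (P : RootPairing ι ℤ X Y) [P.IsReduced] (hP : IsSimplyConnected P) :
    RepresentedBy (invMor (cartan P) (cartan P)) (blowUp (cartan P) (cartan P)) ∧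
    RepresentedBy (invMor (cartan P) (torus P)) (blowUp (cartan P) (torus P)) ∧
    RepresentedBy (invMorZero (torus P) (cartan P)) (blowUp (torus P) (cartan P)) ∧
    RepresentedBy (invMorZero (torus P) (torus P)) (blowUp (torus P) (torus P)) ∧
    RepresentedBy (invMorZero (dualTorus P) (torus P)) (blowUp (dualTorus P) (torus P)) := by
  have := finite_weylGroup P hP
  have hc := isReflective_cartan P
  have ht := isReflective_torus P
  have hsc := isSeparated_cartan P hP
  have hst := isSeparated_torus P hP
  exact ⟨representedBy_invMor hc hc hsc (cartan_ρ_wall P),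
    representedBy_invMor hc ht hst (cartan_ρ_wall P), representedBy_invMorZero ht hc hsc,
    representedBy_invMorZero ht ht hst,
    representedBy_invMorZero (isReflective_dualTorus P) ht hst⟩
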